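/- **Setting.** Let $X\subset\mathbb R^D$ be finite and nonempty, $A\subset\mathbb R^J$ compact, and $S=\{1,\dots,N_s\}$ a finite set of data sources. The target function $\theta:X\times A\to\mathbb R$ is a Gaussian process with continuous paths, continuous mean $\mu^0$ and continuous covariance $k^0$. A simulation at $(x,a)$ returns $\theta(x,a)+\varepsilon$ with independent $\varepsilon\sim N(0,\sigma_\epsilon^2)$, $\sigma_\epsilon^2>0$. Let $a^*\in A$ be the true parameter. Successive queries of source $s$ return independent observations with density $\mathbb P[r\mid a^*,s]$ with respect to a $\sigma$-finite measure, where the likelihood $\mathbb P[r\mid a,s]>0$ is measurable in $r$ and continuous in $a\in A$. The parameter has a prior probability distribution on $A$. In each iteration $t=0,1,2,\dots$ the algorithm chooses a simulation point or a source as a measurable function of the values observed so far and of its own internal randomisation; $\theta$, the simulation noises, the answers of the sources and the internal randomisation are independent. Let $\mathscr F_t$ and $\mathscr R_t$ be the simulation triplets $(x,a,y)$ and the source pairs $(s,r)$ collected in the first $t$ iterations. For simulation data $\mathscr F$ let $\mu_{\mathscr F},k_{\mathscr F}$ be the posterior mean and covariance of the Gaussian process, and for source data $\mathscr R$ let $\mathbb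 P[da\mid\mathscr R]$ be the posterior distribution, proportional to the prior times $\prod_{(s,r)\in\mathscr R}\mathbb P[r\mid a,s]$. Put $$G(x;\mathscr R,\mathscr F)=\int_A\mu_{\mathscr F}(x,a)\,\mathbb P[da\mid\mathscr R],\qquad G^*(\mathscr R,\mathscr F)=\max_{x\in X}G(x;\mathscr R,\mathscr F).$$ With costs $c_f,c_s>0$, the values of information are $$\mathrm{VoI}((x,a);\mathscr R,\mathscr F)=\mathbb E_y\Big[\tfrac{G^*(\mathscr R,\mathscr F\cup\{(x,a,y)\})-G^*(\mathscr R,\mathscr F)}{c_f}\Big],\qquad \mathrm{VoI}(s;\mathscr R,\mathscr F)=\mathbb E_r\Big[\tfrac{G^*(\mathscr R\cup\{(s,r)\},\mathscr F)-G^*(\mathscr R,\mathscr F)}{c_s}\Big],$$ where $y\sim N\big(\mu_{\mathscr F}(x,a),\,k_{\mathscr F}((x,a),(x,a))+\sigma_\epsilon^2\big)$ and $r$ has the predictive density $\int_A\mathbb P[r\mid a,s]\,\mathbb P[da\mid\mathscr R]$. For $a\in A$ let $KL_s(a)=\mathbb E_{r\sim\mathbb P[\cdot\mid a^*,s]}\big[\log(\mathbb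 P[r\mid a^*,s]/\mathbb P[r\mid a,s])\big]$. **Proposition.** Almost surely, the limit $G(x;\mathscr R_T,\mathscr F^\infty)=\lim_{t\to\infty}G(x;\mathscr R_T,\mathscr F_t)$ exists for every $T$ and every $x\in X$, and the following hold. 1. For every $T$, with $\mathscr R^m=\mathscr R_T$: if $\lim_{t\to\infty}\mathrm{VoI}((x,a);\mathscr R^m,\mathscr F_t)=0$ for all $(x,a)\in X\times A$, then $$\operatorname*{argmax}_{x\in X}G(x;\mathscr R^m,\mathscr F^\infty)=\operatorname*{argmax}_{x\in X}\int_A\theta(x,a)\,\mathbb P[da\mid\mathscr R^m]$$ as sets of maximisers. 2. Suppose that every neighbourhood of $a^*$ has positive prior probability, and that for each $s$ the functions $r\mapsto|\log(\mathbb P[r\mid a^*,s]/\mathbb P[r\mid a,s])|$, $a\in A$, are bounded by one function that is integrable under $\mathbb P[\cdot\mid a^*,s]$. Suppose also that the number $|\mathscr R_t|$ of source queries tends to infinity, that for each $a\ne a^*$ there is $c>0$ with $\sum_{(s,r)\in\mathscr R_t}KL_s(a)\ge c\,|\mathscr R_t|$ for all large $t$ (for a single source: $a^*$ is the unique minimiser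 of $KL$), and that $\mathrm{VoI}(s;\mathscr R_t,\mathscr F_{\tau(t)})\to0$ for all $s\in S$, for some sequence $\tau(t)$ of iterations (for instance a constant one, or $\tau(t)=t$). Then $a^*$ is identified: $\mathbb P[U\mid\mathscr R_t]\to1$ for every neighbourhood $U$ of $a^*$ in $A$. If moreover the hypothesis of 1 holds for every $T$, then the true best solution is identified: for all large $T$, $$\operatorname*{argmax}_{x\in X}G(x;\mathscr R_T,\mathscr F^\infty)\subseteq\operatorname*{argmax}_{x\in X}\theta(x,a^*).$$ -/

import Mathlib

open MeasureTheory ProbabilityTheory Filter Topology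
open scoped NNReal ENNReal Matrix

noncomputable section

namespace BICO

/-- The fixed data of the problem: the finite solution space `X ⊂ ℝ^D`, the parameter space
`A ⊂ ℝ^J`, `Ns` data sources with values in `ℛ`, the Gaussian process prior on the target function,
the prior on the parameter, the likelihood of the sources, and the costs of the actions. -/
structure Setup {D J : ℕ} (X : Finset (EuclideanSpace ℝ (Fin D)))
    (A : Set (EuclideanSpace ℝ (Fin J))) (Ns : ℕ) (ℛ : Type*) [MeasurableSpace ℛ] where
  /-- prior mean of the target function -/
  mu0 : X × A → ℝ
  mu0_continuous : Continuous mu0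
  /-- prior covariance function of the target function -/
  k0 : X × A → X × A → ℝ
  k0_continuous : Continuous (Function.uncurry k0)
  /-- variance of the simulation noise -/
  noiseVar : ℝ≥0
  noiseVar_pos : 0 < noiseVar
  /-- prior distribution of the parameter (for instance, the uniform one) -/
  prior : Measure A
  prior_prob : IsProbabilityMeasure prior
  /-- reference measure for the densities of the data sources -/
  ref : Measure ℛ
  ref_sigmaFinite : SigmaFinite ref
  /-- `dens s a r` is the likelihood `P[r | s, a]` -/
  dens : Fin Ns → A → ℛ → ℝ
  dens_pos : ∀ s a r, 0 < dens s a r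
  dens_continuous : ∀ s r, Continuous fun a => dens s a r
  dens_measurable : ∀ s a, Measurable (dens s a)
  dens_lintegral : ∀ s a, ∫⁻ r, ENNReal.ofReal (dens s a r) ∂ref = 1
  /-- cost of a simulation -/
  costSim : ℝ
  costSim_pos : 0 < costSim
  /-- cost of a query of each data source -/
  costSrc : Fin Ns → ℝ
  costSrc_pos : ∀ s, 0 < costSrc s

section Model

variable {D J Ns : ℕ} {X : Finset (EuclideanSpace ℝ (Fin D))}
  {A : Set (EuclideanSpace ℝ (Fin J))} {ℛ : Type*} [MeasurableSpace ℛ]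

/-- Simulation data `F`: a list of triplets `((x, a), y)`. -/
abbrev SimData (X : Finset (EuclideanSpace ℝ (Fin D))) (A : Set (EuclideanSpace ℝ (Fin J))) :=
  List ((X × A) × ℝ)

/-- Source data `R`: a list of pairs `(s, r)`. -/
abbrev SrcData (Ns : ℕ) (ℛ : Type*) := List (Fin Ns × ℛ)

/-- An action: run a simulation at a point `(x, a)`, or query a data source. -/
abbrev Action (X : Finset (EuclideanSpace ℝ (Fin D))) (A : Set (EuclideanSpace ℝ (Fin J)))
    (Ns : ℕ) := (X × A) ⊕ Fin Ns

namespace Setup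

variable (M : Setup X A Ns ℛ)

/-! #### Gaussian process posterior -/

/-- `k⁰(X̃ⁿ, X̃ⁿ) + σ² I`. -/
def gram (F : SimData X A) : Matrix (Fin F.length) (Fin F.length) ℝ :=
  Matrix.of (fun i j => M.k0 (F.get i).1 (F.get j).1) + (M.noiseVar : ℝ) • 1

/-- `k⁰(z, X̃ⁿ)`. -/
def kvec (F : SimData X A) (z : X × A) : Fin F.length → ℝ := fun i => M.k0 z (F.get i).1

/-- Posterior mean `μⁿ(z) = E[θ(z) | F]`. -/
def postMean (F : SimData X A) (z : X × A) : ℝ :=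
  M.mu0 z + M.kvec F z ⬝ᵥ ((M.gram F)⁻¹ *ᵥ fun i => (F.get i).2 - M.mu0 (F.get i).1)

/-- Posterior covariance `kⁿ(z, z') = Cov[θ(z), θ(z') | F]`. -/
def postCov (F : SimData X A) (z z' : X × A) : ℝ :=
  M.k0 z z' - M.kvec F z ⬝ᵥ ((M.gram F)⁻¹ *ᵥ M.kvec F z')

/-! #### Posterior of the parameter -/

/-- The likelihood `∏ P[rⁱ | sⁱ, a]` of the source data. -/
def likelihood (R : SrcData Ns ℛ) (a : A) : ℝ := (R.map fun d => M.dens d.1 a d.2).prod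

/-- The posterior distribution `P[a | R]`, proportional to prior times likelihood. -/
def posterior (R : SrcData Ns ℛ) : Measure A :=
  (∫⁻ a, ENNReal.ofReal (M.likelihood R a) ∂M.prior)⁻¹ •
    M.prior.withDensity fun a => ENNReal.ofReal (M.likelihood R a)

/-- The law `P[· | s, a]` of an observation of source `s` under the parameter `a`. -/
def srcLaw (s : Fin Ns) (a : A) : Measure ℛ :=
  M.ref.withDensity fun r => ENNReal.ofReal (M.dens s a r)

/-- The predictive law `P[· | s; R]` of a new observation of source `s`. -/
def predictive (R : SrcData Ns ℛ) (s : Fin Ns) : Measure ℛ :=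
  M.ref.withDensity fun r => ∫⁻ a, ENNReal.ofReal (M.dens s a r) ∂M.posterior R

/-- Kullback-Leibler divergence of `P[· | s, a]` from `P[· | s, a₀]`:
`E[log (P[r | s, a₀] / P[r | s, a])]` for `r ∼ P[· | s, a₀]`. -/
def kl (a₀ : A) (s : Fin Ns) (a : A) : ℝ :=
  ∫ r, Real.log (M.dens s a₀ r / M.dens s a r) ∂M.srcLaw s a₀

/-! #### Predicted performance and value of information -/

/-- Predicted performance `G(x; R, F) = ∫ μⁿ(x, a) P[a | R] da`. -/
def G (R : SrcData Ns ℛ) (F : SimData X A) (x : X) : ℝ :=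
  ∫ a, M.postMean F (x, a) ∂M.posterior R

/-- `G*(R, F) = max_x G(x; R, F)`. -/
def Gstar (R : SrcData Ns ℛ) (F : SimData X A) : ℝ := ⨆ x : X, M.G R F x

/-- Value of information of a simulation at `z = (x, a)`: the new output `y` has the predictive
law `N(μⁿ(z), kⁿ(z, z) + σ²)`. -/
def voiSim (R : SrcData Ns ℛ) (F : SimData X A) (z : X × A) : ℝ :=
  ∫ y, (M.Gstar R ((z, y) :: F) - M.Gstar R F) / M.costSim
    ∂gaussianReal (M.postMean F z) (M.postCov F z z + M.noiseVar).toNNReal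

/-- Value of information of a query of the data source `s`. -/
def voiSrc (R : SrcData Ns ℛ) (F : SimData X A) (s : Fin Ns) : ℝ :=
  ∫ r, (M.Gstar ((s, r) :: R) F - M.Gstar R F) / M.costSrc s ∂M.predictive R s

end Setup

/-- The set of maximisers of a function on the solution space. -/
def argmax (g : X → ℝ) : Set X := {x | ∀ x', g x' ≤ g x}

/-! #### Data collection -/

section Data

variable {Ω : Type*}

/-- Source data collected in the first `t` iterations. The `k`-th query of source `s` returns
`ρ s k`. -/
def srcData (act : ℕ → Ω → Action X A Ns) (ρ : Fin Ns → ℕ → Ω → ℛ) : ℕ → Ω → SrcData Ns ℛ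
  | 0, _ => []
  | t + 1, ω =>
    match act t ω with
    | Sum.inl _ => srcData act ρ t ω
    | Sum.inr s =>
      (s, ρ s ((srcData act ρ t ω).countP fun d => d.1 = s) ω) :: srcData act ρ t ω

/-- Simulation data collected in the first `t` iterations. A simulation at `z` in iteration `t`
returns `θ z + ε t`. -/
def simData (act : ℕ → Ω → Action X A Ns) (θ : X × A → Ω → ℝ) (ε : ℕ → Ω → ℝ) :
    ℕ → Ω → SimData X A
  | 0, _ => []
  | t + 1, ω =>
    match act t ω with
    | Sum.inl z => (z, θ z ω + ε t ω) :: simData act θ ε t ω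
    | Sum.inr _ => simData act θ ε t ω

/-- The value observed in iteration `t`. -/
def obs (act : ℕ → Ω → Action X A Ns) (θ : X × A → Ω → ℝ) (ε : ℕ → Ω → ℝ)
    (ρ : Fin Ns → ℕ → Ω → ℛ) (t : ℕ) (ω : Ω) : ℝ ⊕ ℛ :=
  match act t ω with
  | Sum.inl z => Sum.inl (θ z ω + ε t ω)
  | Sum.inr s => Sum.inr (ρ s ((srcData act ρ t ω).countP fun d => d.1 = s) ω)

/-- The information available when the action of iteration `t` is chosen: the values observed so
far, and the internal randomisation `ξ` of the algorithm. -/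
abbrev history {Ξ : Type*} [MeasurableSpace Ξ] (ξ : Ω → Ξ) (act : ℕ → Ω → Action X A Ns) (θ : X × A → Ω → ℝ)
    (ε : ℕ → Ω → ℝ) (ρ : Fin Ns → ℕ → Ω → ℛ) (t : ℕ) : MeasurableSpace Ω :=
  MeasurableSpace.comap ξ inferInstance ⊔
    ⨆ i : Fin t, MeasurableSpace.comap (obs act θ ε ρ i) inferInstance

/-- The probabilistic model of a run. The target function `θ` is a Gaussian process with mean `μ⁰`,
covariance `k⁰` and continuous paths; the simulation noises `ε t` are independent `N(0, σ²)`; the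
successive answers `ρ s 0, ρ s 1, …` of source `s` are independent with law `P[· | s, a*]`; all
these and the internal randomisation of the algorithm are independent; and each action depends only
on the information available when it is chosen. -/
structure IsRun (M : Setup X A Ns ℛ) (astar : A) [MeasurableSpace Ω] (P : Measure Ω)
    {Ξ : Type*} [MeasurableSpace Ξ] (ξ : Ω → Ξ) (θ : X × A → Ω → ℝ) (ε : ℕ → Ω → ℝ)
    (ρ : Fin Ns → ℕ → Ω → ℛ) (act : ℕ → Ω → Action X A Ns) : Prop where
  theta_measurable : ∀ z, Measurable (θ z)
  theta_continuous : ∀ ω, Continuous fun z => θ z ω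
  theta_gaussian : IsGaussianProcess θ P
  theta_mean : ∀ z, ∫ ω, θ z ω ∂P = M.mu0 z
  theta_cov : ∀ z z', cov[θ z, θ z'; P] = M.k0 z z'
  noise_measurable : ∀ t, Measurable (ε t)
  noise_law : ∀ t, P.map (ε t) = gaussianReal 0 M.noiseVar
  noise_indep : iIndepFun ε P
  src_measurable : ∀ s k, Measurable (ρ s k)
  src_law : ∀ s k, P.map (ρ s k) = M.srcLaw s astar
  src_indep : iIndepFun (fun i : Fin Ns × ℕ => ρ i.1 i.2) P
  rand_measurable : Measurable ξ
  indep : iIndep ![⨆ z, MeasurableSpace.comap (θ z) inferInstance,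
    ⨆ t, MeasurableSpace.comap (ε t) inferInstance,
    ⨆ i : Fin Ns × ℕ, MeasurableSpace.comap (ρ i.1 i.2) inferInstance,
    MeasurableSpace.comap ξ inferInstance] P
  act_adapted : ∀ t, Measurable[history ξ act θ ε ρ t] (act t)

end Data

/-- The source data `R t`, `t → ∞`, carry information on every parameter `a ≠ a₀` at a linear rate:
the accumulated Kullback-Leibler divergence is at least a positive multiple of the number of
queries. For a single source this says that `a₀` is the unique minimiser of `kl a₀ s`. -/
def Identifies (M : Setup X A Ns ℛ) (a₀ : A) (R : ℕ → SrcData Ns ℛ) : Prop :=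
  ∀ a, a ≠ a₀ → ∃ c > 0, ∀ᶠ t in atTop, c * ((R t).length : ℝ) ≤
    ((R t).map fun d => M.kl a₀ d.1 a).sum

end Model

end BICO

end

/-! Fix source data and let π be the resulting posterior of the parameter. A simulation at z moves
every G(x) by an affine function of its Gaussian output, with slope proportional to the posterior
covariance of ∫θ(x,·)dπ and θ(z) (`IsRun.G_cons`, `IsRun.voiSim_eq`). Its value is therefore the
expected gain of a maximum of affine functions of a Gaussian variable, which is bounded below by the
expected excess of one slope difference over the current gap between two values of G. Since G
converges, these gaps stay bounded, so a vanishing value forces the slopes for all x to agree in the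
limit (`IsRun.tendsto_crossCov_sub`). Integrating the slope differences over z shows that the
posterior variance of ∫θ(x,·)dπ − ∫θ(x',·)dπ tends to zero (`IsRun.tendsto_varIntegralSub`).

This becomes a statement about θ itself because the kriging formulas describe the true conditional
law of θ even for adaptively chosen points (`IsRun.isPosterior_gpMeasure`). The conditioning
σ-algebras contain all answers of the sources from the start, so π is known at time 0 and t ↦ G(x)
is a closed martingale, which converges. Where conditional variances vanish, the squared errors have
liminf zero (`ae_liminf_eq_zero_of_tendsto_zero`), so G(x) − G(x') tends to the true difference. The
separate limits may share a common error, but maximisers depend on differences only. The random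
source data cause no trouble, as there are only countably many lists of queried sources
(`srcData_eq_srcList`).

For identification, the strong law in the Banach space C(A, ℝ) makes the log-likelihood ratio follow
the accumulated divergence uniformly in the parameter, for any allocation of queries among the
sources. Compactness turns pointwise identifiability into a uniform rate away from a*, and the
posterior mass there decays exponentially (`tendsto_posterior`). Then ∫θ(x,·)dπ tends to θ(x, a*)
for each of the finitely many x, and strict inequalities between the limits are eventually
inherited. -/

noncomputable section

namespace BICO

/-! ### Gaussian processes through exponential moments, and Bayes' rule for one noisy observation.
-/

section GaussianTilt

/-- Completing the square in v: the joint density of a Gaussian value v and its noisy observation y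
factors into the marginal of y and the conditional law of v. -/
theorem gaussianPDFReal_mul_gaussianPDFReal (a v y : ℝ) {τ σ : ℝ≥0} (hτ : τ ≠ 0) (hσ : σ ≠ 0) :
    gaussianPDFReal a τ v * gaussianPDFReal v σ y =
      gaussianPDFReal a (τ + σ) y *
        gaussianPDFReal ((a * σ + y * τ) / (τ + σ)) (τ * σ / (τ + σ)) v := by
  have h1 : (0 : ℝ) < τ := by positivity
  have h2 : (0 : ℝ) < σ := by positivity
  simp only [gaussianPDFReal, NNReal.coe_add, NNReal.coe_mul, NNReal.coe_div]
  rw [mul_mul_mul_comm, mul_mul_mul_comm (√(2 * Real.pi * (τ + σ)))⁻¹, ← Real.exp_add,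
    ← Real.exp_add, ← mul_inv, ← mul_inv, ← Real.sqrt_mul (by positivity),
    ← Real.sqrt_mul (by positivity)]
  congr 1
  · congr 2
    field_simp
  · congr 1
    field_simp
    ring

/-- Convolution of a Gaussian law with a Gaussian density. -/
theorem lintegral_gaussianPDF_gaussianReal (a y : ℝ) (τ : ℝ≥0) {σ : ℝ≥0} (hσ : σ ≠ 0) :
    ∫⁻ v, gaussianPDF v σ y ∂gaussianReal a τ = gaussianPDF a (τ + σ) y := by
  have hm : Measurable fun v => gaussianPDF v σ y :=
    measurable_uncurry_gaussianPDF.comp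
      (measurable_id.prodMk (measurable_const.prodMk measurable_const))
  -- With zero variance the law is a Dirac mass without density, so the factorisation of densities
  -- is not available.
  by_cases hτ : τ = 0
  · subst hτ
    rw [gaussianReal_zero_var, lintegral_dirac' _ hm, zero_add]
  · have hw : τ * σ / (τ + σ) ≠ 0 := by positivity
    rw [gaussianReal_of_var_ne_zero _ hτ,
      lintegral_withDensity_eq_lintegral_mul _ (measurable_gaussianPDF a τ) hm]
    have : ∀ v, (gaussianPDF a τ * fun v => gaussianPDF v σ y) v = gaussianPDF a (τ + σ) y *
        gaussianPDF ((a * σ + y * τ) / (τ + σ)) (τ * σ / (τ + σ)) v := fun v => by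
      simp only [Pi.mul_apply, gaussianPDF]
      rw [← ENNReal.ofReal_mul (gaussianPDFReal_nonneg _ _ _),
        ← ENNReal.ofReal_mul (gaussianPDFReal_nonneg _ _ _),
        gaussianPDFReal_mul_gaussianPDFReal _ _ _ hτ hσ]
    simp_rw [this]
    rw [lintegral_const_mul _ (measurable_gaussianPDF _ _), lintegral_gaussianPDF_eq_one _ hw,
      mul_one]

/-- A moment generating function finite on the whole line extends analytically to the complex one,
which determines the law. -/
theorem map_eq_gaussianReal_of_mgf {Ω : Type*} [MeasurableSpace Ω] {μ : Measure Ω}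
    [IsProbabilityMeasure μ] {X : Ω → ℝ} (hX : Measurable X) (m : ℝ) (v : ℝ≥0)
    (h : ∀ s, mgf X μ s = Real.exp (m * s + v * s ^ 2 / 2)) : μ.map X = gaussianReal m v := by
  have hm : mgf X μ = mgf id (gaussianReal m v) := by
    rw [mgf_id_gaussianReal]
    exact funext h
  have h0 : integrableExpSet X μ = Set.univ := by
    ext s
    simp only [Set.mem_univ, iff_true, integrableExpSet, Set.mem_ofPred_eq]
    -- An undefined integral has the value `0`, while the prescribed value is an exponential, so the
    -- formula itself forces integrability.
    by_contra hs
    have := h s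
    rw [mgf, integral_undef hs] at this
    exact (Real.exp_pos _).ne this
  have h1 := eqOn_complexMGF_of_mgf hm
  simp only [h0, interior_univ, Set.mem_univ, Set.ofPred_true, Set.eqOn_univ] at h1
  simpa using Measure.ext_of_complexMGF_eq hX.aemeasurable aemeasurable_id h1

variable {Z 𝒞 : Type*} [MeasurableSpace 𝒞]

/-- The value of a linear combination of point evaluations. -/
abbrev lin (m : Z → ℝ) : (Z →₀ ℝ) →ₗ[ℝ] ℝ := Finsupp.linearCombination ℝ m

/-- The bilinear form on linear combinations of point evaluations defined by a kernel. -/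
def quad (k : Z → Z → ℝ) : LinearMap.BilinForm ℝ (Z →₀ ℝ) :=
  Finsupp.linearCombination ℝ fun w => Finsupp.linearCombination ℝ (k w)

@[simp] theorem quad_single_right (k : Z → Z → ℝ) (u : Z →₀ ℝ) (z : Z) (a : ℝ) :
    quad k u (Finsupp.single z a) = a * lin (fun w => k w z) u := by
  have : (quad k).flip (Finsupp.single z a) = a • lin (fun w => k w z) := by
    ext w
    simp [quad]
  exact congrArg (fun f => f u) this

@[simp] theorem quad_single_left (k : Z → Z → ℝ) (u : Z →₀ ℝ) (z : Z) (a : ℝ) :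
    quad k (Finsupp.single z a) u = a * lin (k z) u := by
  simp [quad]

theorem quad_symm {k : Z → Z → ℝ} (hk : ∀ z z', k z z' = k z' z) (u v : Z →₀ ℝ) :
    quad k u v = quad k v u := by
  have : quad k = (quad k).flip := by
    ext z z'
    simp [hk z z']
  conv_lhs => rw [this]
  rfl

theorem quad_rankOne (b c : Z → ℝ) (u v : Z →₀ ℝ) :
    quad (fun z z' => b z * c z') u v = lin b u * lin c v := by
  have : quad (fun z z' => b z * c z') = (LinearMap.lsmul ℝ ℝ).compl₁₂ (lin b) (lin c) := by
    ext z z'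
    simp
  rw [this]
  simp

theorem quad_sub (k l : Z → Z → ℝ) (u v : Z →₀ ℝ) :
    quad (fun z z' => k z z' - l z z') u v = quad k u v - quad l u v := by
  have : quad (fun z z' => k z z' - l z z') = quad k - quad l := by
    ext z z'
    simp
  rw [this]
  simp

/-- `ν` is the law of a Gaussian process with mean `m` and covariance `k`, expressed by the moment
generating functions of the linear combinations of its values. -/
structure IsGP (ev : Z → 𝒞 → ℝ) (ν : Measure 𝒞) (m : Z → ℝ) (k : Z → Z → ℝ) : Prop where
  symm : ∀ z z', k z z' = k z' z
  psd : ∀ u, 0 ≤ quad k u u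
  exp_lin : ∀ u, ∫⁻ c, ENNReal.ofReal (Real.exp (lin (fun z => ev z c) u)) ∂ν =
    ENNReal.ofReal (Real.exp (lin m u + quad k u u / 2))

theorem measurable_lin {ev : Z → 𝒞 → ℝ} (hev : ∀ z, Measurable (ev z)) (u : Z →₀ ℝ) :
    Measurable fun c => lin (fun z => ev z c) u := by
  simp only [Finsupp.linearCombination_apply, Finsupp.sum]
  exact Finset.measurable_fun_sum _ fun z _ => (hev z).const_mul _

namespace IsGP

variable {ev : Z → 𝒞 → ℝ} {ν : Measure 𝒞} {m : Z → ℝ} {k : Z → Z → ℝ}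

theorem diag_nonneg (h : IsGP ev ν m k) (z : Z) : 0 ≤ k z z := by
  simpa using h.psd (Finsupp.single z 1)

theorem sq_quad_le (h : IsGP ev ν m k) (u v : Z →₀ ℝ) :
    quad k u v ^ 2 ≤ quad k u u * quad k v v :=
  LinearMap.BilinForm.apply_sq_le_of_symm _ h.psd ⟨fun u v => quad_symm h.symm u v⟩ u v

theorem sq_le (h : IsGP ev ν m k) (z z' : Z) : k z z' ^ 2 ≤ k z z * k z' z' := by
  simpa using h.sq_quad_le (Finsupp.single z 1) (Finsupp.single z' 1)

theorem isProbabilityMeasure (h : IsGP ev ν m k) : IsProbabilityMeasure ν :=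
  ⟨by simpa using h.exp_lin 0⟩

/-- The identity `exp_lin` is stated for the Lebesgue integral of a nonnegative function, so its
finite right-hand side carries integrability. -/
theorem integrable_exp_lin (hev : ∀ z, Measurable (ev z)) (h : IsGP ev ν m k) (u : Z →₀ ℝ) :
    Integrable (fun c => Real.exp (lin (fun z => ev z c) u)) ν := by
  refine ⟨(Real.measurable_exp.comp (measurable_lin hev u)).aestronglyMeasurable, ?_⟩
  rw [hasFiniteIntegral_iff_ofReal (ae_of_all _ fun _ => (Real.exp_pos _).le), h.exp_lin]
  exact ENNReal.ofReal_lt_top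

theorem integral_exp_lin (hev : ∀ z, Measurable (ev z)) (h : IsGP ev ν m k) (u : Z →₀ ℝ) :
    ∫ c, Real.exp (lin (fun z => ev z c) u) ∂ν = Real.exp (lin m u + quad k u u / 2) := by
  rw [integral_eq_lintegral_of_nonneg_ae (ae_of_all _ fun _ => (Real.exp_pos _).le)
    (h.integrable_exp_lin hev u).1, h.exp_lin, ENNReal.toReal_ofReal (Real.exp_pos _).le]

theorem map_lin (hev : ∀ z, Measurable (ev z)) (h : IsGP ev ν m k) (u : Z →₀ ℝ) :
    ν.map (fun c => lin (fun z => ev z c) u) = gaussianReal (lin m u) (quad k u u).toNNReal := by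
  have := h.isProbabilityMeasure
  refine map_eq_gaussianReal_of_mgf (measurable_lin hev u) _ _ fun s => ?_
  have := h.integral_exp_lin hev (s • u)
  simp only [map_smul, smul_eq_mul, LinearMap.smul_apply] at this
  rw [mgf, this, Real.coe_toNNReal _ (h.psd u)]
  ring_nf

/-- Exponential tilting by a linear functional of the process leaves the variance at z unchanged and
shifts the mean by the covariance with that functional. The remaining integral is a Gaussian
convolution. -/
theorem lintegral_exp_lin_mul_gaussianPDF (hev : ∀ z, Measurable (ev z)) (h : IsGP ev ν m k)
    (u : Z →₀ ℝ) (z : Z) (y : ℝ) {σ : ℝ≥0} (hσ : σ ≠ 0) :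
    ∫⁻ c, ENNReal.ofReal (Real.exp (lin (fun z => ev z c) u)) * gaussianPDF (ev z c) σ y ∂ν =
      ENNReal.ofReal (Real.exp (lin m u + quad k u u / 2)) *
        gaussianPDF (m z + lin (fun w => k w z) u) ((k z z).toNNReal + σ) y := by
  have := h.isProbabilityMeasure
  have hi := h.integrable_exp_lin hev u
  set f : 𝒞 → ℝ := fun c => lin (fun z => ev z c) u with hf
  have : IsProbabilityMeasure (ν.tilted f) := isProbabilityMeasure_tilted hi
  have hpdf : Measurable fun v => gaussianPDF v σ y :=
    measurable_uncurry_gaussianPDF.comp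
      (measurable_id.prodMk (measurable_const.prodMk measurable_const))
  have hmap : (ν.tilted f).map (ev z) =
      gaussianReal (m z + lin (fun w => k w z) u) (k z z).toNNReal := by
    refine map_eq_gaussianReal_of_mgf (hev z) _ _ fun s => ?_
    -- The moment generating function under the tilted measure is a quotient of the exponential
    -- moments at `u + Finsupp.single z s` and at `u`.
    have h1 := integral_exp_tilted (μ := ν) f (fun c => s * ev z c)
    have h2 := h.integral_exp_lin hev (u + Finsupp.single z s)
    have h3 := h.integral_exp_lin hev u
    have h4 : ∀ c, (f + fun c => s * ev z c) c = lin (fun z => ev z c) (u + Finsupp.single z s) :=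
      fun c => by simp [hf]
    simp only [h4, h2] at h1
    simp only [hf, h3] at h1
    rw [mgf, h1, ← Real.exp_sub, Real.coe_toNNReal _ (h.diag_nonneg z)]
    congr 1
    have hs : lin (k z) u = lin (fun w => k w z) u := by
      congr 2; ext w; exact h.symm _ _
    simp [hs]
    ring
  have h1 := lintegral_gaussianPDF_gaussianReal (m z + lin (fun w => k w z) u) y (k z z).toNNReal hσ
  rw [← hmap, lintegral_map hpdf (hev z), lintegral_tilted] at h1
  rw [← h1, ← lintegral_const_mul]
  · refine lintegral_congr fun c => ?_
    rw [← mul_assoc, ← ENNReal.ofReal_mul (Real.exp_pos _).le]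
    simp only [hf, h.integral_exp_lin hev u]
    congr 2
    field_simp
  · exact (((Real.measurable_exp.comp (measurable_lin hev u)).div_const _).ennreal_ofReal).mul
      (hpdf.comp (hev z))

theorem lintegral_gaussianPDF (hev : ∀ z, Measurable (ev z)) (h : IsGP ev ν m k)
    (z : Z) (y : ℝ) {σ : ℝ≥0} (hσ : σ ≠ 0) :
    ∫⁻ c, gaussianPDF (ev z c) σ y ∂ν = gaussianPDF (m z) ((k z z).toNNReal + σ) y := by
  simpa using h.lintegral_exp_lin_mul_gaussianPDF hev 0 z y hσ

/-- Bayes' formula for a Gaussian process and one noisy observation of a value. -/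
theorem tilt (hev : ∀ z, Measurable (ev z)) (h : IsGP ev ν m k) (z : Z) (y : ℝ) {σ : ℝ≥0}
    (hσ : σ ≠ 0) :
    IsGP ev ((∫⁻ c, gaussianPDF (ev z c) σ y ∂ν)⁻¹ •
        ν.withDensity fun c => gaussianPDF (ev z c) σ y)
      (fun w => m w + k w z / (k z z + σ) * (y - m z))
      (fun w w' => k w w' - k w z / (k z z + σ) * k z w') := by
  have hz := h.diag_nonneg z
  have hσ' : (0 : ℝ) < σ := by positivity
  have hs : 0 < k z z + σ := by positivity
  have hpdf : Measurable fun v => gaussianPDF v σ y :=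
    measurable_uncurry_gaussianPDF.comp
      (measurable_id.prodMk (measurable_const.prodMk measurable_const))
  have hk : ∀ u, quad (fun w w' => k w w' - k w z / (k z z + σ) * k z w') u u =
      quad k u u - lin (fun w => k w z) u ^ 2 / (k z z + σ) := fun u => by
    rw [quad_sub, quad_rankOne]
    have h1 : (fun w => k w z / (k z z + σ)) = (k z z + (σ : ℝ))⁻¹ • fun w => k w z := by
      ext w; simp; ring
    have h2 : k z = fun w => k w z := by ext w; exact h.symm _ _
    have h3 : lin ((k z z + (σ : ℝ))⁻¹ • fun w => k w z) u =
        (k z z + (σ : ℝ))⁻¹ * lin (fun w => k w z) u := by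
      simp [Finsupp.linearCombination_apply, Finsupp.sum, Finset.mul_sum]
      exact Finset.sum_congr rfl fun _ _ => by ring
    rw [h1, h3, ← h2]
    ring
  refine ⟨fun w w' => ?_, fun u => ?_, fun u => ?_⟩
  · rw [h.symm w w', h.symm w z, h.symm z w']; ring
  -- Cauchy–Schwarz bounds the rank-one decrement by the prior variance; the noise only enlarges its
  -- denominator.
  · have := h.sq_quad_le u (Finsupp.single z 1)
    simp at this
    rw [hk, sub_nonneg, div_le_iff₀ hs]
    nlinarith [h.psd u]
  · have hd : Measurable fun c => gaussianPDF (ev z c) σ y := hpdf.comp (hev z)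
    have he : Measurable fun c => ENNReal.ofReal (Real.exp (lin (fun z => ev z c) u)) :=
      (Real.measurable_exp.comp (measurable_lin hev u)).ennreal_ofReal
    rw [lintegral_smul_measure, lintegral_withDensity_eq_lintegral_mul _ hd he, hk,
      h.lintegral_gaussianPDF hev z y hσ]
    simp only [Pi.mul_apply, mul_comm (gaussianPDF _ _ _)]
    rw [h.lintegral_exp_lin_mul_gaussianPDF hev u z y hσ]
    have hl : lin (fun w => m w + k w z / (k z z + σ) * (y - m z)) u =
        lin m u + lin (fun w => k w z) u / (k z z + σ) * (y - m z) := by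
      simp [Finsupp.linearCombination_apply, Finsupp.sum, Finset.sum_div, Finset.sum_mul,
        ← Finset.sum_add_distrib]
      exact Finset.sum_congr rfl fun _ _ => by ring
    rw [hl]
    set b := lin (fun w => k w z) u
    have hv : (k z z).toNNReal + σ ≠ 0 := by positivity
    have hp := gaussianPDFReal_pos (m z) _ y hv
    rw [smul_eq_mul, gaussianPDF, gaussianPDF, ← ENNReal.ofReal_inv_of_pos hp,
      ← ENNReal.ofReal_mul (Real.exp_pos _).le, ← ENNReal.ofReal_mul (by positivity)]
    congr 1
    -- The quotient of two Gaussian densities in y with equal variances and means differing by b is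
    -- the exponential of b(y − m z) − b²/2 over that variance: the linear term corrects the mean,
    -- the quadratic one the covariance.
    rw [inv_mul_eq_iff_eq_mul₀ hp.ne']
    simp only [gaussianPDFReal, NNReal.coe_add, Real.coe_toNNReal _ hz]
    rw [mul_left_comm, ← Real.exp_add, mul_assoc (_)⁻¹, ← Real.exp_add]
    congr 2
    field_simp
    ring

theorem integrable_lin_sq (hev : ∀ z, Measurable (ev z)) (h : IsGP ev ν m k) (u : Z →₀ ℝ) :
    MemLp (fun c => lin (fun z => ev z c) u) 2 ν := by
  have h1 : MemLp id 2 (ν.map fun c => lin (fun z => ev z c) u) := by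
    rw [h.map_lin hev u]; exact memLp_id_gaussianReal' 2 (by simp)
  exact (memLp_map_measure_iff aestronglyMeasurable_id (measurable_lin hev u).aemeasurable).1 h1

theorem memLp_two (hev : ∀ z, Measurable (ev z)) (h : IsGP ev ν m k) (z : Z) :
    MemLp (ev z) 2 ν := by
  simpa using h.integrable_lin_sq hev (Finsupp.single z 1)

theorem integral_lin (hev : ∀ z, Measurable (ev z)) (h : IsGP ev ν m k) (u : Z →₀ ℝ) :
    ∫ c, lin (fun z => ev z c) u ∂ν = lin m u := by
  have h1 := integral_map (μ := ν) (measurable_lin hev u).aemeasurable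
    (f := fun x : ℝ => x) aestronglyMeasurable_id
  rw [← h1, h.map_lin hev u, integral_id_gaussianReal]

theorem integral_eval (hev : ∀ z, Measurable (ev z)) (h : IsGP ev ν m k) (z : Z) :
    ∫ c, ev z c ∂ν = m z := by
  simpa using h.integral_lin hev (Finsupp.single z 1)

theorem variance_lin (hev : ∀ z, Measurable (ev z)) (h : IsGP ev ν m k) (u : Z →₀ ℝ) :
    Var[fun c => lin (fun z => ev z c) u; ν] = quad k u u := by
  have h1 := variance_map (μ := ν) (X := fun x : ℝ => x) aemeasurable_id
    (measurable_lin hev u).aemeasurable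
  rw [h.map_lin hev u, variance_fun_id_gaussianReal, Real.coe_toNNReal _ (h.psd u)] at h1
  exact h1.symm

theorem covariance_eval (hev : ∀ z, Measurable (ev z)) (h : IsGP ev ν m k) (z z' : Z) :
    cov[ev z, ev z'; ν] = k z z' := by
  have := h.isProbabilityMeasure
  have h1 := h.variance_lin hev (Finsupp.single z 1 + Finsupp.single z' 1)
  have h2 := h.variance_lin hev (Finsupp.single z 1)
  have h3 := h.variance_lin hev (Finsupp.single z' 1)
  simp at h1 h2 h3
  rw [variance_fun_add (h.memLp_two hev z) (h.memLp_two hev z'), h2, h3, h.symm z' z] at h1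
  linarith

end IsGP

end GaussianTilt

/-! ### The kriging formulas as iterated Bayes updates. -/

section Posterior

variable {D J Ns : ℕ} {X : Finset (EuclideanSpace ℝ (Fin D))}
  {A : Set (EuclideanSpace ℝ (Fin J))} {ℛ : Type*} [MeasurableSpace ℛ]

namespace Setup

variable (M : Setup X A Ns ℛ)

/-- A positive semidefinite kernel matrix plus a positive multiple of the identity is definite, so
repeated simulation points do no harm. -/
theorem posDef_gram (hs : ∀ z z', M.k0 z z' = M.k0 z' z) (hp : ∀ u, 0 ≤ quad M.k0 u u)
    (F : SimData X A) : (M.gram F).PosDef := by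
  refine Matrix.PosDef.posSemidef_add ⟨?_, fun x => ?_⟩ ?_
  · ext i j
    simp [hs F[(j : ℕ)].1]
  -- Coefficients of coinciding simulation points are added up, which turns the quadratic form of
  -- the matrix into one of the kernel.
  · have := hp (x.mapDomain fun i => (F.get i).1)
    simp only [quad, Finsupp.linearCombination_mapDomain] at this
    simp only [Finsupp.linearCombination_apply, Finsupp.sum, LinearMap.sum_apply,
      LinearMap.smul_apply] at this
    simp only [Finsupp.sum]
    refine this.trans_eq (Finset.sum_congr rfl fun i _ => ?_)
    simp only [Function.comp_apply, Finsupp.linearCombination_mapDomain, smul_eq_mul]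
    rw [Finsupp.linearCombination_apply, Finsupp.sum, Finset.mul_sum]
    exact Finset.sum_congr rfl fun j _ => by simp; ring
  · exact Matrix.PosDef.one.smul (by exact_mod_cast M.noiseVar_pos)

theorem gram_inv_mulVec (hs : ∀ z z', M.k0 z z' = M.k0 z' z) (hp : ∀ u, 0 ≤ quad M.k0 u u)
    (F : SimData X A) {x v : Fin F.length → ℝ} (h : M.gram F *ᵥ x = v) :
    (M.gram F)⁻¹ *ᵥ v = x := by
  have : Invertible (M.gram F) := (M.posDef_gram hs hp F).isUnit.invertible
  rw [← h, Matrix.mulVec_mulVec, Matrix.inv_mul_of_invertible, Matrix.one_mulVec]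

theorem gram_mulVec_inv (hs : ∀ z z', M.k0 z z' = M.k0 z' z) (hp : ∀ u, 0 ≤ quad M.k0 u u)
    (F : SimData X A) (v : Fin F.length → ℝ) : M.gram F *ᵥ ((M.gram F)⁻¹ *ᵥ v) = v := by
  have : Invertible (M.gram F) := (M.posDef_gram hs hp F).isUnit.invertible
  rw [Matrix.mulVec_mulVec, Matrix.mul_inv_of_invertible, Matrix.one_mulVec]

/-- Bordering: one more data point updates a solution of the kriging system by a rank-one
correction. -/
theorem kvec_dotProduct_gram_inv_cons (hs : ∀ z z', M.k0 z z' = M.k0 z' z)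
    (hp : ∀ u, 0 ≤ quad M.k0 u u) (F : SimData X A) (z w : X × A) (y v₀ : ℝ)
    (v : Fin F.length → ℝ) (hz : M.postCov F z z + M.noiseVar ≠ 0) :
    M.kvec ((z, y) :: F) w ⬝ᵥ ((M.gram ((z, y) :: F))⁻¹ *ᵥ
        (Fin.cons v₀ v : Fin (F.length + 1) → ℝ)) =
      M.kvec F w ⬝ᵥ ((M.gram F)⁻¹ *ᵥ v) +
        (v₀ - M.kvec F z ⬝ᵥ ((M.gram F)⁻¹ *ᵥ v)) / (M.postCov F z z + M.noiseVar) *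
          M.postCov F w z := by
  set S : (Fin F.length → ℝ) → Fin F.length → ℝ := fun v => (M.gram F)⁻¹ *ᵥ v with hS
  set α := (v₀ - M.kvec F z ⬝ᵥ S v) / (M.postCov F z z + M.noiseVar) with hα
  have hsum : ∀ f : Fin ((z, y) :: F).length → ℝ, ∑ i, f i =
      f (0 : Fin (F.length + 1)) + ∑ j : Fin F.length, f (Fin.succ j) := Fin.sum_univ_succ
  have hk : ∀ w, M.kvec ((z, y) :: F) w = (Fin.cons (M.k0 w z) (M.kvec F w) :
      Fin (F.length + 1) → ℝ) := fun w => by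
    ext i
    refine Fin.cases ?_ (fun i => ?_) i <;> simp [kvec]
  -- Block elimination: α is the residual of the new equation divided by the Schur complement
  -- `M.postCov F z z + M.noiseVar`, and the old solution is corrected along `S (M.kvec F z)`.
  have h : M.gram ((z, y) :: F) *ᵥ (Fin.cons α (S v - α • S (M.kvec F z)) :
      Fin (F.length + 1) → ℝ) = (Fin.cons v₀ v : Fin (F.length + 1) → ℝ) := by
    refine funext fun i : Fin (F.length + 1) => ?_
    rw [Matrix.mulVec, dotProduct, hsum]
    refine Fin.cases ?_ (fun i => ?_) i
    · have h1 : ∀ j : Fin F.length, M.gram ((z, y) :: F) 0 j.succ = M.kvec F z j := fun j => by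
        simp [gram, kvec, Fin.ext_iff]
      have h2 : M.gram ((z, y) :: F) 0 0 = M.k0 z z + M.noiseVar := by
        simp [gram]
      have h3 : ∑ j, M.kvec F z j * (S v - α • S (M.kvec F z)) j =
          M.kvec F z ⬝ᵥ S v - α * (M.kvec F z ⬝ᵥ S (M.kvec F z)) := by
        rw [← smul_eq_mul α, ← dotProduct_smul, ← dotProduct_sub]
        rfl
      simp only [Fin.cons_zero, Fin.cons_succ, h1, h2, h3]
      rw [postCov] at hz hα
      have h4 := div_mul_cancel₀ (v₀ - M.kvec F z ⬝ᵥ S v) hz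
      rw [← hα] at h4
      linear_combination h4
    · have h1 : ∀ j : Fin F.length, M.gram ((z, y) :: F) i.succ j.succ = M.gram F i j :=
        fun j => by simp [gram, Matrix.one_apply, Fin.ext_iff]
      have h2 : M.gram ((z, y) :: F) i.succ 0 = M.kvec F z i := by
        simp [gram, Fin.ext_iff, kvec, hs z]
      have h3 : ∑ j, M.gram F i j * (S v - α • S (M.kvec F z)) j = v i - α * M.kvec F z i := by
        have h5 := congrFun (M.gram_mulVec_inv hs hp F v) i
        have h6 := congrFun (M.gram_mulVec_inv hs hp F (M.kvec F z)) i
        have h7 : (M.gram F *ᵥ (S v - α • S (M.kvec F z))) i =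
            (M.gram F *ᵥ S v) i - α * (M.gram F *ᵥ S (M.kvec F z)) i := by
          rw [Matrix.mulVec_sub, Matrix.mulVec_smul]
          rfl
        rw [← h5, ← h6]
        exact h7
      simp only [Fin.cons_zero, Fin.cons_succ, h1, h2, h3]
      ring
  rw [M.gram_inv_mulVec hs hp _ h, hk, dotProduct, hsum]
  have h3 : ∑ j, M.kvec F w j * (S v - α • S (M.kvec F z)) j =
      M.kvec F w ⬝ᵥ S v - α * (M.kvec F w ⬝ᵥ S (M.kvec F z)) := by
    rw [← smul_eq_mul α, ← dotProduct_smul, ← dotProduct_sub]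
    rfl
  simp only [Fin.cons_zero, Fin.cons_succ, h3]
  simp only [postCov, hS]
  ring

/-- Bordering with the centred outputs on the right-hand side. The result has the form of the mean
in `IsGP.tilt`, which links the matrix formula to Bayes' rule. -/
theorem postMean_cons (hs : ∀ z z', M.k0 z z' = M.k0 z' z) (hp : ∀ u, 0 ≤ quad M.k0 u u)
    (F : SimData X A) (z w : X × A) (y : ℝ) (hz : M.postCov F z z + M.noiseVar ≠ 0) :
    M.postMean ((z, y) :: F) w = M.postMean F w +
      M.postCov F w z / (M.postCov F z z + M.noiseVar) * (y - M.postMean F z) := by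
  have h : (fun i => (((z, y) :: F).get i).2 - M.mu0 (((z, y) :: F).get i).1) =
      (Fin.cons (y - M.mu0 z) (fun i => (F.get i).2 - M.mu0 (F.get i).1) :
        Fin (F.length + 1) → ℝ) := by
    ext i
    refine Fin.cases ?_ (fun i => ?_) i <;> simp
  have h1 := M.kvec_dotProduct_gram_inv_cons hs hp F z w y (y - M.mu0 z)
    (fun i => (F.get i).2 - M.mu0 (F.get i).1) hz
  rw [postMean]
  erw [h, h1]
  simp only [postMean]
  ring

theorem postCov_cons (hs : ∀ z z', M.k0 z z' = M.k0 z' z) (hp : ∀ u, 0 ≤ quad M.k0 u u)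
    (F : SimData X A) (z w w' : X × A) (y : ℝ) (hz : M.postCov F z z + M.noiseVar ≠ 0) :
    M.postCov ((z, y) :: F) w w' = M.postCov F w w' -
      M.postCov F w z / (M.postCov F z z + M.noiseVar) * M.postCov F z w' := by
  have h : M.kvec ((z, y) :: F) w' = (Fin.cons (M.k0 w' z) (M.kvec F w') :
      Fin (F.length + 1) → ℝ) := by
    ext i
    refine Fin.cases ?_ (fun i => ?_) i <;> simp [kvec]
  have h1 := M.kvec_dotProduct_gram_inv_cons hs hp F z w y (M.k0 w' z) (M.kvec F w') hz
  rw [postCov]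
  erw [h, h1]
  rw [hs w' z]
  simp only [postCov]
  ring

variable {𝒞 : Type*} [MeasurableSpace 𝒞]

/-- The conditional law, given the simulation data, of a process with law `ν`. -/
def gpMeasure (ev : X × A → 𝒞 → ℝ) (ν : Measure 𝒞) : SimData X A → Measure 𝒞
  | [] => ν
  | d :: F => (∫⁻ c, gaussianPDF (ev d.1 c) M.noiseVar d.2 ∂gpMeasure ev ν F)⁻¹ •
      (gpMeasure ev ν F).withDensity fun c => gaussianPDF (ev d.1 c) M.noiseVar d.2

/-- Each triplet contributes one application of `IsGP.tilt`, and the bordering formulas show that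
the closed matrix expressions obey the same recursion. -/
theorem isGP_gpMeasure {ev : X × A → 𝒞 → ℝ} (hev : ∀ z, Measurable (ev z)) {ν : Measure 𝒞}
    (h : IsGP ev ν M.mu0 M.k0) (F : SimData X A) :
    IsGP ev (M.gpMeasure ev ν F) (M.postMean F) (M.postCov F) := by
  induction F with
  | nil =>
    have h1 : M.postMean [] = M.mu0 := by ext; simp [postMean, dotProduct, kvec]
    have h2 : M.postCov [] = M.k0 := by ext; simp [postCov, dotProduct, kvec]
    rwa [h1, h2]
  | cons d F ih =>
    have hz : M.postCov F d.1 d.1 + M.noiseVar ≠ 0 := by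
      have h1 := ih.diag_nonneg d.1
      have h2 : (0 : ℝ) < M.noiseVar := M.noiseVar_pos
      positivity
    have h1 : M.postMean (d :: F) = fun w => M.postMean F w +
        M.postCov F w d.1 / (M.postCov F d.1 d.1 + M.noiseVar) * (d.2 - M.postMean F d.1) :=
      funext fun w => M.postMean_cons h.symm h.psd F d.1 w d.2 hz
    have h2 : M.postCov (d :: F) = fun w w' => M.postCov F w w' -
        M.postCov F w d.1 / (M.postCov F d.1 d.1 + M.noiseVar) * M.postCov F d.1 w' :=
      funext fun w => funext fun w' => M.postCov_cons h.symm h.psd F d.1 w w' d.2 hz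
    rw [h1, h2]
    exact ih.tilt hev d.1 d.2 M.noiseVar_pos.ne'

end Setup

end Posterior

/-! ### The Borel structure of the space of continuous paths. -/

section ContinuousPaths

variable {K : Type*} [TopologicalSpace K]

instance : MeasurableSpace C(K, ℝ) := borel _

instance : BorelSpace C(K, ℝ) := ⟨rfl⟩

theorem measurable_eval_continuousMap (x : K) : Measurable fun f : C(K, ℝ) => f x :=
  (continuous_eval_const x).measurable

/-- The Borel `σ`-algebra of the space of continuous functions is generated by the evaluations. -/
theorem measurable_continuousMap_of_eval [CompactSpace K] [SecondCountableTopology K] [T2Space K]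
    {Ω : Type*} {mΩ : MeasurableSpace Ω} {f : Ω → C(K, ℝ)} (hf : ∀ x, Measurable fun ω => f ω x) :
    Measurable f := by
  obtain ⟨S, hSc, hSd⟩ := TopologicalSpace.exists_countable_dense K
  have hball : ∀ (g : C(K, ℝ)) (r : ℝ), 0 ≤ r →
      MeasurableSet (f ⁻¹' Metric.closedBall g r) := fun g r hr => by
    -- By continuity, closeness in the sup norm can be tested on a countable dense set of points.
    have : f ⁻¹' Metric.closedBall g r = ⋂ x ∈ S, {ω | |f ω x - g x| ≤ r} := by
      ext ω
      simp only [Set.mem_preimage, Metric.mem_closedBall, Set.mem_iInter]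
      rw [ContinuousMap.dist_le hr]
      refine ⟨fun h x _ => h x, fun h => ?_⟩
      have hc : IsClosed {x | |f ω x - g x| ≤ r} :=
        isClosed_le (by fun_prop) continuous_const
      have h2 : closure S ⊆ {x | |f ω x - g x| ≤ r} := hc.closure_subset_iff.2 h
      intro x
      exact h2 (hSd x)
    rw [this]
    exact MeasurableSet.biInter hSc fun x _ =>
      measurableSet_le (((hf x).sub_const _).abs) measurable_const
  refine measurable_of_isOpen fun U hU => ?_
  obtain ⟨E, hEc, hEd⟩ := TopologicalSpace.exists_countable_dense C(K, ℝ)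
  -- The path space is separable, so every open set is a countable union of closed balls.
  have : U = ⋃ g ∈ E, ⋃ n ∈ {n : ℕ | Metric.closedBall g (1 / (n + 1) : ℝ) ⊆ U},
      Metric.closedBall g (1 / (n + 1) : ℝ) := by
    refine subset_antisymm (fun φ hφ => ?_) (by simp)
    obtain ⟨ε, hε, hb⟩ := Metric.isOpen_iff.1 hU φ hφ
    obtain ⟨n, hn⟩ := exists_nat_one_div_lt (half_pos hε)
    obtain ⟨g, hg, hgd⟩ := hEd.exists_dist_lt φ (ε := 1 / (n + 1)) (by positivity)
    simp only [Set.mem_iUnion]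
    refine ⟨g, hg, n, fun ψ hψ => hb ?_, hgd.le⟩
    rw [Metric.mem_ball]
    rw [dist_comm] at hgd
    have := dist_triangle ψ g φ
    have := Metric.mem_closedBall.1 hψ
    linarith
  rw [this]
  simp only [Set.preimage_iUnion]
  exact MeasurableSet.biUnion hEc fun g _ => MeasurableSet.biUnion (Set.to_countable _) fun n _ =>
    hball g _ (by positivity)

end ContinuousPaths

/-! ### Enlarging one side of an independence statement. -/

section Independence

/-- On the generating π-system of intersections s ∩ t, independence of m₁ from m' splits off s,
because t ∩ u lies in m'; independence of m₂ and m₃ then splits t and u. -/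
theorem indep_sup_of_indep {Ω : Type*} {m₁ m₂ m₃ m' mΩ : MeasurableSpace Ω} {P : Measure Ω}
    [IsProbabilityMeasure P] (hΩ₁ : m₁ ≤ mΩ) (hΩ' : m' ≤ mΩ) (h : Indep m₁ m' P) (h₂ : m₂ ≤ m')
    (h₃ : m₃ ≤ m') (h₂₃ : Indep m₂ m₃ P) : Indep (m₁ ⊔ m₂) m₃ P := by
  have hgen : m₁ ⊔ m₂ = MeasurableSpace.generateFrom
      (Set.image2 (· ∩ ·) {s | MeasurableSet[m₁] s} {s | MeasurableSet[m₂] s}) := by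
    refine le_antisymm (sup_le (fun s hs => ?_) fun s hs => ?_)
      (MeasurableSpace.generateFrom_le ?_)
    · exact MeasurableSpace.measurableSet_generateFrom
        ⟨s, hs, Set.univ, MeasurableSet.univ, by simp⟩
    · exact MeasurableSpace.measurableSet_generateFrom
        ⟨Set.univ, MeasurableSet.univ, s, hs, by simp⟩
    · rintro _ ⟨s, hs, t, ht, rfl⟩
      exact MeasurableSet.inter ((le_sup_left : m₁ ≤ m₁ ⊔ m₂) _ hs)
        ((le_sup_right : m₂ ≤ m₁ ⊔ m₂) _ ht)
  refine IndepSets.indep (sup_le hΩ₁ (h₂.trans hΩ')) (h₃.trans hΩ') ?_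
    (@MeasurableSpace.isPiSystem_measurableSet Ω m₃) hgen
    (@MeasurableSpace.generateFrom_measurableSet Ω m₃).symm ?_
  · rintro _ ⟨s, hs, t, ht, rfl⟩ _ ⟨s', hs', t', ht', rfl⟩ _
    refine ⟨s ∩ s', ?_, t ∩ t', ?_, Set.inter_inter_inter_comm _ _ _ _⟩
    · exact @MeasurableSet.inter Ω m₁ _ _ hs hs'
    · exact @MeasurableSet.inter Ω m₂ _ _ ht ht'
  · rw [IndepSets_iff]
    rintro _ u ⟨s, hs, t, ht, rfl⟩ hu
    rw [Indep_iff] at h h₂₃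
    have ht' := h₂ _ ht
    have hu' := h₃ _ hu
    simp only
    rw [Set.inter_assoc, h s (t ∩ u) hs (@MeasurableSet.inter Ω m' _ _ ht' hu'), h s t hs ht',
      h₂₃ t u ht hu, mul_assoc]

end Independence

/-! ### Bayes' rule when the observed quantity depends on the past. -/

section AdaptiveBayes

/-- `Q (h ω)` is a regular conditional distribution of `T` given `h`. -/
structure IsPosterior {Ω ℋ 𝒞 : Type*} [MeasurableSpace Ω] [mℋ : MeasurableSpace ℋ]
    [m𝒞 : MeasurableSpace 𝒞] (P : Measure Ω) (T : Ω → 𝒞) (h : Ω → ℋ) (Q : ℋ → Measure 𝒞) :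
    Prop where
  measurable : Measurable Q
  prob : ∀ a, IsProbabilityMeasure (Q a)
  lintegral_eq : ∀ Φ : 𝒞 × ℋ → ℝ≥0∞, Measurable Φ →
    ∫⁻ ω, Φ (T ω, h ω) ∂P = ∫⁻ ω, ∫⁻ c, Φ (c, h ω) ∂Q (h ω) ∂P

variable {Ω ℋ 𝒞 : Type*} {mΩ : MeasurableSpace Ω} {mℋ : MeasurableSpace ℋ}
  {m𝒞 : MeasurableSpace 𝒞}

theorem measurable_lintegral_of_prob {Q : ℋ → Measure 𝒞} (hQ : Measurable Q)
    (hp : ∀ a, IsProbabilityMeasure (Q a)) {Φ : 𝒞 → ℋ → ℝ≥0∞}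
    (hΦ : Measurable (Function.uncurry Φ)) : Measurable fun a => ∫⁻ c, Φ c a ∂Q a := by
  let κ : Kernel ℋ 𝒞 := ⟨Q, hQ⟩
  have : IsMarkovKernel κ := ⟨hp⟩
  exact hΦ.lintegral_kernel_prod_left (κ := κ)

theorem indepFun_prodMk_of_indep_sup {E : Type*} {mE : MeasurableSpace E} {P : Measure Ω}
    {T : Ω → 𝒞} {h : Ω → ℋ} {e : Ω → E} (hi : Indep (m𝒞.comap T ⊔ mℋ.comap h) (mE.comap e) P) :
    IndepFun (fun ω => (T ω, h ω)) e P := by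
  rw [IndepFun_iff_Indep]
  exact indep_of_indep_of_le_left hi (MeasurableSpace.comap_prodMk T h).le

theorem isPosterior_of_indepFun {P : Measure Ω} [IsProbabilityMeasure P] {T : Ω → 𝒞} {h : Ω → ℋ}
    (hT : Measurable T) (hh : Measurable h) (hi : IndepFun T h P) :
    IsPosterior P T h fun _ => P.map T := by
  have hprob : IsProbabilityMeasure (P.map T) := Measure.isProbabilityMeasure_map hT.aemeasurable
  refine ⟨measurable_const, fun _ => hprob, fun Φ hΦ => ?_⟩
  have h1 := (indepFun_iff_map_prod_eq_prod_map_map hT.aemeasurable hh.aemeasurable).1 hi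
  have h2 := lintegral_map (μ := P) hΦ (hT.prodMk hh)
  rw [h1, lintegral_prod_symm _ hΦ.aemeasurable, lintegral_map hΦ.lintegral_prod_left' hh] at h2
  exact h2.symm

namespace IsPosterior

variable {P : Measure Ω} {T : Ω → 𝒞} {h : Ω → ℋ} {Q : ℋ → Measure 𝒞}

/-- The posterior after one more observation `q (T, h) + e` with noise `e ∼ N(0, σ)`. -/
def update (Q : ℋ → Measure 𝒞) (q : 𝒞 × ℋ → ℝ) (σ : ℝ≥0) (p : ℋ × ℝ) : Measure 𝒞 :=
  (∫⁻ c, gaussianPDF (q (c, p.1)) σ p.2 ∂Q p.1)⁻¹ •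
    (Q p.1).withDensity fun c => gaussianPDF (q (c, p.1)) σ p.2

theorem measurable_gaussianPDF_comp {q : 𝒞 × ℋ → ℝ} (hq : Measurable q) (σ : ℝ≥0) :
    Measurable fun p : 𝒞 × (ℋ × ℝ) => gaussianPDF (q (p.1, p.2.1)) σ p.2.2 :=
  measurable_uncurry_gaussianPDF.comp ((hq.comp (measurable_fst.prodMk
    (measurable_fst.comp measurable_snd))).prodMk
      (measurable_const.prodMk (measurable_snd.comp measurable_snd)))

theorem measurable_gaussianPDF_section {q : 𝒞 × ℋ → ℝ} (hq : Measurable q) (σ : ℝ≥0) (a : ℋ)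
    (y : ℝ) : Measurable fun c => gaussianPDF (q (c, a)) σ y := by
  have h1 : Measurable fun c => q (c, a) := hq.comp measurable_prodMk_right
  exact measurable_uncurry_gaussianPDF.comp
    (h1.prodMk (measurable_const.prodMk measurable_const))

theorem lintegral_update {q : 𝒞 × ℋ → ℝ} (hq : Measurable q) (σ : ℝ≥0)
    (p : ℋ × ℝ) {g : 𝒞 → ℝ≥0∞} (hg : Measurable g) :
    ∫⁻ c, g c ∂update Q q σ p = (∫⁻ c, gaussianPDF (q (c, p.1)) σ p.2 ∂Q p.1)⁻¹ *
      ∫⁻ c, gaussianPDF (q (c, p.1)) σ p.2 * g c ∂Q p.1 := by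
  have hd := measurable_gaussianPDF_section hq σ p.1 p.2
  rw [update, lintegral_smul_measure, lintegral_withDensity_eq_lintegral_mul _ hd hg, smul_eq_mul]
  rfl

theorem normalizer_ne_zero (hQ : IsPosterior P T h Q) {q : 𝒞 × ℋ → ℝ} (hq : Measurable q)
    {σ : ℝ≥0} (hσ : σ ≠ 0) (p : ℋ × ℝ) : ∫⁻ c, gaussianPDF (q (c, p.1)) σ p.2 ∂Q p.1 ≠ 0 := by
  have hd := measurable_gaussianPDF_section hq σ p.1 p.2
  have := hQ.prob p.1
  rw [Ne, lintegral_eq_zero_iff hd]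
  intro h0
  obtain ⟨c, hc⟩ := h0.exists
  exact (gaussianPDF_pos _ hσ _).ne' hc

theorem normalizer_ne_top (hQ : IsPosterior P T h Q) (q : 𝒞 × ℋ → ℝ) (σ : ℝ≥0) (p : ℋ × ℝ) :
    ∫⁻ c, gaussianPDF (q (c, p.1)) σ p.2 ∂Q p.1 ≠ ∞ := by
  have := hQ.prob p.1
  have hb : ∀ c, gaussianPDF (q (c, p.1)) σ p.2 ≤ ENNReal.ofReal (√(2 * Real.pi * σ))⁻¹ :=
    fun c => by
      refine ENNReal.ofReal_le_ofReal ?_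
      rw [gaussianPDFReal]
      refine mul_le_of_le_one_right (by positivity) (Real.exp_le_one_iff.2 ?_)
      exact div_nonpos_of_nonpos_of_nonneg (neg_nonpos.2 (sq_nonneg _)) (by positivity)
  refine ((lintegral_mono hb).trans_lt ?_).ne
  rw [lintegral_const, measure_univ, mul_one]
  exact ENNReal.ofReal_lt_top

/-- As the noise is independent of the pair, its law can be integrated first and translated into a
density of the output y; then T is replaced by its conditional law and the integrals are exchanged.
-/
theorem lintegral_observation [IsProbabilityMeasure P] (hT : Measurable T) (hh : Measurable h)
    (hQ : IsPosterior P T h Q)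
    {q : 𝒞 × ℋ → ℝ} (hq : Measurable q) {σ : ℝ≥0} (hσ : σ ≠ 0) {e : Ω → ℝ} (he : Measurable e)
    (hlaw : P.map e = gaussianReal 0 σ) (hind : IndepFun (fun ω => (T ω, h ω)) e P)
    {Ψ : 𝒞 × (ℋ × ℝ) → ℝ≥0∞} (hΨ : Measurable Ψ) :
    ∫⁻ ω, Ψ (T ω, (h ω, q (T ω, h ω) + e ω)) ∂P =
      ∫⁻ ω, ∫⁻ y, ∫⁻ c, gaussianPDF (q (c, h ω)) σ y * Ψ (c, (h ω, y)) ∂Q (h ω)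
        ∂volume ∂P := by
  have hpd : Measurable fun p : 𝒞 × (ℋ × ℝ) => gaussianPDF (q (p.1, p.2.1)) σ p.2.2 * Ψ p :=
    (measurable_gaussianPDF_comp hq σ).mul hΨ
  have hg : Measurable fun p : (𝒞 × ℋ) × ℝ => Ψ (p.1.1, (p.1.2, q p.1 + p.2)) := by fun_prop
  have h1 := (indepFun_iff_map_prod_eq_prod_map_map (hT.prodMk hh).aemeasurable he.aemeasurable).1
    hind
  have h2 := lintegral_map (μ := P) hg ((hT.prodMk hh).prodMk he)
  rw [h1, hlaw, lintegral_prod _ hg.aemeasurable, lintegral_map hg.lintegral_prod_right'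
    (hT.prodMk hh)] at h2
  rw [← h2]
  obtain ⟨F, hF⟩ : ∃ F : 𝒞 × (ℋ × ℝ) → ℝ≥0∞,
      F = fun p => gaussianPDF (q (p.1, p.2.1)) σ p.2.2 * Ψ p := ⟨_, rfl⟩
  rw [← hF] at hpd
  have hF' : ∀ c a y, gaussianPDF (q (c, a)) σ y * Ψ (c, (a, y)) = F (c, (a, y)) := fun c a y => by
    rw [hF]
  have h3 : ∀ c a, ∫⁻ x, Ψ (c, (a, q (c, a) + x)) ∂gaussianReal 0 σ = ∫⁻ y, F (c, (a, y)) :=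
    fun c a => by
      have hm : Measurable fun y => Ψ (c, (a, y)) := by fun_prop
      rw [← lintegral_map (f := fun y => Ψ (c, (a, y))) hm (measurable_const_add (q (c, a))),
        gaussianReal_map_const_add, zero_add, gaussianReal_of_var_ne_zero _ hσ,
        lintegral_withDensity_eq_lintegral_mul _ (measurable_gaussianPDF _ _) hm]
      simp only [Pi.mul_apply, hF']
  simp only [h3, hF']
  have hΦ : Measurable fun p : 𝒞 × ℋ => ∫⁻ y, F (p.1, (p.2, y)) :=
    Measurable.lintegral_prod_right' (f := fun p : (𝒞 × ℋ) × ℝ => F (p.1.1, (p.1.2, p.2)))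
      (by fun_prop)
  rw [hQ.lintegral_eq _ hΦ]
  refine lintegral_congr fun ω => ?_
  have := hQ.prob (h ω)
  have hs : Measurable fun p : 𝒞 × ℝ => F (p.1, (h ω, p.2)) := by fun_prop
  exact lintegral_lintegral_swap hs.aemeasurable

/-- Apply `lintegral_observation` to a test function and to its average under the updated law: the
two densities agree because the normalising constant cancels. The observed functional q may depend
on the past, which covers adaptive choice of the simulation point. -/
theorem isPosterior_update [IsProbabilityMeasure P] (hT : Measurable T) (hh : Measurable h)
    (hQ : IsPosterior P T h Q)
    {q : 𝒞 × ℋ → ℝ} (hq : Measurable q) {σ : ℝ≥0} (hσ : σ ≠ 0) {e : Ω → ℝ} (he : Measurable e)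
    (hlaw : P.map e = gaussianReal 0 σ) (hind : IndepFun (fun ω => (T ω, h ω)) e P) :
    IsPosterior P T (fun ω => (h ω, q (T ω, h ω) + e ω)) (update Q q σ) := by
  have hpdf := measurable_gaussianPDF_comp hq σ
  have hN : Measurable fun p : ℋ × ℝ => ∫⁻ c, gaussianPDF (q (c, p.1)) σ p.2 ∂Q p.1 :=
    measurable_lintegral_of_prob (hQ.measurable.comp measurable_fst) (fun p => hQ.prob p.1)
      (Φ := fun c p => gaussianPDF (q (c, p.1)) σ p.2) hpdf
  have hU : ∀ Ψ : 𝒞 × (ℋ × ℝ) → ℝ≥0∞, Measurable Ψ →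
      Measurable fun p : ℋ × ℝ => ∫⁻ c, Ψ (c, p) ∂update Q q σ p := fun Ψ hΨ => by
    have h1 : ∀ p : ℋ × ℝ, _ := fun p => lintegral_update (Q := Q) hq σ p (g := fun c => Ψ (c, p))
      (hΨ.comp (measurable_prodMk_right (y := p)))
    simp only [h1]
    exact hN.inv.mul (measurable_lintegral_of_prob (hQ.measurable.comp measurable_fst)
      (fun p => hQ.prob p.1) (Φ := fun c p => gaussianPDF (q (c, p.1)) σ p.2 * Ψ (c, p))
      (hpdf.mul hΨ))
  refine ⟨Measure.measurable_of_measurable_coe _ fun S hS => ?_, fun p => ⟨?_⟩, fun Ψ hΨ => ?_⟩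
  · have := hU (fun p => S.indicator 1 p.1) ((measurable_one.indicator hS).comp measurable_fst)
    simpa [lintegral_indicator_one hS] using this
  · rw [← lintegral_one, lintegral_update (Q := Q) hq σ p measurable_const]
    simp only [mul_one]
    exact ENNReal.inv_mul_cancel (hQ.normalizer_ne_zero hq hσ p) (hQ.normalizer_ne_top q σ p)
  · rw [lintegral_observation hT hh hQ hq hσ he hlaw hind hΨ,
      lintegral_observation hT hh hQ hq hσ he hlaw hind
        (Ψ := fun p => ∫⁻ c, Ψ (c, p.2) ∂update Q q σ p.2) ((hU Ψ hΨ).comp measurable_snd)]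
    refine lintegral_congr fun ω => lintegral_congr fun y => ?_
    have h1 := lintegral_update (Q := Q) hq σ (h ω, y) (g := fun c => Ψ (c, (h ω, y)))
      (hΨ.comp (measurable_prodMk_right (y := (h ω, y))))
    have hd := measurable_gaussianPDF_section hq σ (h ω) y
    simp only
    rw [lintegral_mul_const _ hd, h1, ← mul_assoc, ENNReal.mul_inv_cancel
      (hQ.normalizer_ne_zero hq hσ (h ω, y)) (hQ.normalizer_ne_top q σ (h ω, y)), one_mul]

end IsPosterior

/-- A conditional distribution given a map is a conditional distribution given the `σ`-algebra it
generates. -/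
theorem IsPosterior.comap {P : Measure Ω} {T : Ω → 𝒞} {h : Ω → ℋ} {Q : ℋ → Measure 𝒞}
    (hQ : IsPosterior P T h Q) :
    IsPosterior (mℋ := mℋ.comap h) P T id fun ω => Q (h ω) := by
  refine @IsPosterior.mk Ω Ω 𝒞 _ (mℋ.comap h) _ P T id _ ?_ (fun ω => hQ.prob _) fun Φ hΦ => ?_
  · exact hQ.measurable.comp (comap_measurable h)
  · have h1 : @Prod.instMeasurableSpace _ _ m𝒞 (mℋ.comap h) =
        (@Prod.instMeasurableSpace _ _ m𝒞 mℋ).comap (Prod.map id h) := by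
      have := MeasurableSpace.comap_prodMap (mα := m𝒞) (mβ := mℋ) (id : 𝒞 → 𝒞) h
      rw [MeasurableSpace.comap_id] at this
      exact this.symm
    rw [h1] at hΦ
    -- A function measurable for the generated σ-algebra factors through h, so the original identity
    -- applies to the factor.
    obtain ⟨Ψ, hΨ, rfl⟩ := hΦ.exists_eq_measurable_comp
    exact hQ.lintegral_eq Ψ hΨ

end AdaptiveBayes

/-! ### From Gaussian processes to their exponential moments. -/

section GaussianProcess

/-- Linear combinations of the values are Gaussian, with mean and variance given by linearity and
bilinearity; the exponential moment is their moment generating function at `1`. -/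
theorem isGP_of_isGaussianProcess {Z Ω : Type*} [MeasurableSpace Ω] {P : Measure Ω}
    {θ : Z → Ω → ℝ} {m : Z → ℝ} {k : Z → Z → ℝ} (h : IsGaussianProcess θ P)
    (hm : ∀ z, ∫ ω, θ z ω ∂P = m z) (hk : ∀ z z', cov[θ z, θ z'; P] = k z z') :
    IsGP θ P m k := by
  have hP := h.isProbabilityMeasure
  have h2 : ∀ z, MemLp (θ z) 2 P := fun z => (h.hasGaussianLaw_eval z).memLp_two
  have hlin : ∀ u : Z →₀ ℝ, (fun ω => lin (fun z => θ z ω) u) =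
      fun ω => ∑ z ∈ u.support, u z * θ z ω := fun u => by
    ext ω
    simp [Finsupp.linearCombination_apply, Finsupp.sum]
  have hvar : ∀ u : Z →₀ ℝ, Var[fun ω => lin (fun z => θ z ω) u; P] = quad k u u := fun u => by
    have hu : ∀ z ∈ u.support, MemLp (fun ω => u z * θ z ω) 2 P := fun z _ => (h2 z).const_mul _
    rw [hlin, ← covariance_self, covariance_fun_sum_fun_sum' hu hu]
    · simp only [covariance_const_mul_left, covariance_const_mul_right, hk]
      simp only [quad, Finsupp.linearCombination_apply, Finsupp.sum, LinearMap.sum_apply,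
        LinearMap.smul_apply, smul_eq_mul, Finset.mul_sum]
      exact Finset.sum_congr rfl fun _ _ => Finset.sum_congr rfl fun _ _ => by ring
    · have : MemLp (fun ω => ∑ z ∈ u.support, u z * θ z ω) 2 P := memLp_finsetSum _ hu
      exact this.1.aemeasurable
  have hmean : ∀ u : Z →₀ ℝ, ∫ ω, lin (fun z => θ z ω) u ∂P = lin m u := fun u => by
    rw [hlin, integral_finsetSum _ fun z _ => ((h2 z).integrable one_le_two).const_mul _]
    simp [integral_const_mul, hm, Finsupp.linearCombination_apply, Finsupp.sum]
  refine ⟨fun z z' => ?_, fun u => ?_, fun u => ?_⟩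
  · rw [← hk, ← hk, covariance_comm]
  · rw [← hvar]
    exact variance_nonneg _ _
  · have h1 : HasGaussianLaw (fun ω => lin (fun z => θ z ω) u) P := by
      rw [hlin]
      exact (h.smul u).hasGaussianLaw_fun_sum
    have h3 := mgf_gaussianReal h1.map_eq_gaussianReal 1
    rw [hmean, hvar, Real.coe_toNNReal _ (by rw [← hvar]; exact variance_nonneg _ _)] at h3
    simp only [mgf, one_mul, mul_one, one_pow] at h3
    rw [← h3, ofReal_integral_eq_lintegral_ofReal _ (ae_of_all _ fun _ => (Real.exp_pos _).le)]
    by_contra hi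
    rw [integral_undef hi] at h3
    exact (Real.exp_pos _).ne h3

theorem IsGP.map {Z Ω 𝒞 : Type*} [MeasurableSpace Ω] [MeasurableSpace 𝒞] {P : Measure Ω}
    {m : Z → ℝ} {k : Z → Z → ℝ} {ev : Z → 𝒞 → ℝ} {T : Ω → 𝒞} (hT : Measurable T)
    (hev : ∀ z, Measurable (ev z)) (h : IsGP (fun z ω => ev z (T ω)) P m k) :
    IsGP ev (P.map T) m k := by
  refine ⟨h.symm, h.psd, fun u => ?_⟩
  have he : Measurable fun c => ENNReal.ofReal (Real.exp (lin (fun z => ev z c) u)) :=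
    (Real.measurable_exp.comp (measurable_lin hev u)).ennreal_ofReal
  rw [lintegral_map he hT]
  exact h.exp_lin u

end GaussianProcess

/-! ### Adaptivity, and the conditional law of the target function during a run. -/

section Run

variable {D J Ns : ℕ} {X : Finset (EuclideanSpace ℝ (Fin D))}
  {A : Set (EuclideanSpace ℝ (Fin J))} {ℛ : Type*} [MeasurableSpace ℛ]
  {Ω : Type*} {Ξ : Type*} [MeasurableSpace Ξ]

/-- The noise-free outcome of an action: the value of the target function for a simulation, and `0`
for a query of a source. -/
def noiseFree (p : C(X × A, ℝ) × Action X A Ns) : ℝ := Sum.elim (fun z => p.1 z) (fun _ => 0) p.2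

/-- The evaluation point is random too, so joint measurability in path and action is needed; it
comes from joint continuity of evaluation. -/
theorem measurable_noiseFree [CompactSpace A] :
    Measurable (noiseFree : C(X × A, ℝ) × Action X A Ns → ℝ) := by
  have h1 : Measurable (Sum.elim (fun p : C(X × A, ℝ) × (X × A) => p.1 p.2)
      (fun _ : C(X × A, ℝ) × Fin Ns => (0 : ℝ))) := by
    refine Measurable.sumElim ?_ measurable_const
    exact ContinuousEval.continuous_eval.measurable
  have h2 := h1.comp (MeasurableEquiv.prodSumDistrib C(X × A, ℝ) (X × A) (Fin Ns)).measurable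
  convert h2 using 1
  ext ⟨c, a⟩
  cases a <;> rfl

theorem measurable_noiseFree_comp [CompactSpace A] {ℋ : Type*} {mℋ : MeasurableSpace ℋ}
    {a : ℋ → Action X A Ns} (ha : Measurable a) :
    Measurable fun p : C(X × A, ℝ) × ℋ => noiseFree (p.1, a p.2) :=
  measurable_noiseFree.comp (measurable_fst.prodMk (ha.comp measurable_snd))

/-- The noisy outcome of iteration `t`, pure noise if a source is queried. -/
def simObs (act : ℕ → Ω → Action X A Ns) (θ : X × A → Ω → ℝ) (ε : ℕ → Ω → ℝ) (t : ℕ) (ω : Ω) : ℝ :=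
  Sum.elim (fun z => θ z ω) (fun _ => 0) (act t ω) + ε t ω

/-- The information of the observer who knows the internal randomisation, all answers of the sources
and the first `t` simulation outputs. -/
@[reducible] def past (ξ : Ω → Ξ) (act : ℕ → Ω → Action X A Ns) (θ : X × A → Ω → ℝ) (ε : ℕ → Ω → ℝ)
    (ρ : Fin Ns → ℕ → Ω → ℛ) : ℕ → MeasurableSpace Ω
  | 0 => MeasurableSpace.comap ξ inferInstance ⊔
      ⨆ i : Fin Ns × ℕ, MeasurableSpace.comap (ρ i.1 i.2) inferInstance
  | t + 1 => past ξ act θ ε ρ t ⊔ MeasurableSpace.comap (simObs act θ ε t) inferInstance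

variable {ξ : Ω → Ξ} {act : ℕ → Ω → Action X A Ns} {θ : X × A → Ω → ℝ} {ε : ℕ → Ω → ℝ}
  {ρ : Fin Ns → ℕ → Ω → ℛ}

theorem past_mono : Monotone (past ξ act θ ε ρ) := monotone_nat_of_le_succ fun _ => le_sup_left

theorem measurable_source_past (s : Fin Ns) (k t : ℕ) :
    Measurable[past ξ act θ ε ρ t] (ρ s k) := by
  rw [measurable_iff_comap_le]
  refine le_trans ?_ (past_mono (Nat.zero_le t))
  exact le_sup_of_le_right
    (le_iSup (fun i : Fin Ns × ℕ => MeasurableSpace.comap (ρ i.1 i.2) inferInstance) (s, k))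

theorem measurable_simObs_past (t : ℕ) :
    Measurable[past ξ act θ ε ρ (t + 1)] (simObs act θ ε t) := by
  rw [measurable_iff_comap_le]
  exact le_sup_right

omit [MeasurableSpace ℛ] in
theorem measurable_countP_srcData {m : MeasurableSpace Ω} (s : Fin Ns) (t : ℕ)
    (h : ∀ i < t, Measurable (act i)) :
    Measurable fun ω => (srcData act ρ t ω).countP fun d => d.1 = s := by
  induction t with
  | zero => exact measurable_const
  | succ t ih =>
    have hs : MeasurableSet {ω | act t ω = Sum.inr s} := by
      have : MeasurableSet (Sum.inr '' {s} : Set (Action X A Ns)) :=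
        (MeasurableSet.singleton s).inr_image
      have := h t (Nat.lt_succ_self t) this
      simpa [Set.preimage, eq_comm] using this
    have h1 : (fun ω => (srcData act ρ (t + 1) ω).countP fun d => d.1 = s) = fun ω =>
        ({ω | act t ω = Sum.inr s}.indicator (fun _ => 1) ω) +
          (srcData act ρ t ω).countP fun d => d.1 = s := by
      ext ω
      rw [srcData]
      cases hω : act t ω with
      | inl z => simp [Set.indicator, hω]
      | inr s' =>
        by_cases hs' : s' = s
        · simp [Set.indicator, hω, hs', add_comm]
        · simp [Set.indicator, hω, hs']
    rw [h1]
    exact (measurable_const.indicator hs).add (ih fun i hi => h i (hi.trans (Nat.lt_succ_self t)))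

/-- Partition according to the action and the number of earlier queries of the chosen source: on
each piece the observation is a fixed answer or agrees with `simObs`. -/
theorem measurable_obs {m : MeasurableSpace Ω} (t : ℕ) (h : ∀ i ≤ t, Measurable (act i))
    (hρ : ∀ s k, Measurable (ρ s k)) (hs : Measurable (simObs act θ ε t)) :
    Measurable (obs act θ ε ρ t) := by
  intro S hS
  rw [measurableSet_sum_iff] at hS
  have h1 : obs act θ ε ρ t ⁻¹' S =
      (act t ⁻¹' Set.range Sum.inl ∩ simObs act θ ε t ⁻¹' (Sum.inl ⁻¹' S)) ∪
        ⋃ (s : Fin Ns) (k : ℕ), act t ⁻¹' (Sum.inr '' {s}) ∩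
          ((fun ω => (srcData act ρ t ω).countP fun d => d.1 = s) ⁻¹' {k} ∩
            ρ s k ⁻¹' (Sum.inr ⁻¹' S)) := by
    ext ω
    simp only [Set.mem_preimage, obs]
    cases hω : act t ω with
    | inl z => simp [hω, simObs]
    | inr s => simp [hω]
  rw [h1]
  refine MeasurableSet.union ((h t le_rfl measurableSet_range_inl).inter (hs hS.1))
    (MeasurableSet.iUnion fun s => MeasurableSet.iUnion fun k => ?_)
  refine (h t le_rfl (MeasurableSet.singleton s).inr_image).inter (MeasurableSet.inter ?_
    (hρ s k hS.2))
  exact measurable_countP_srcData s t (fun i hi => h i hi.le) (MeasurableSet.singleton k)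

variable {mΩ : MeasurableSpace Ω} {M : Setup X A Ns ℛ} {astar : A} {P : Measure Ω}

namespace IsRun

/-- The path of the target function. -/
def path (hrun : IsRun M astar P ξ θ ε ρ act) (ω : Ω) : C(X × A, ℝ) :=
  ⟨fun z => θ z ω, hrun.theta_continuous ω⟩

/-- Strong induction: an observation before t is a function of actions up to that time, which are
adapted to shorter histories. -/
theorem history_le_past (hrun : IsRun M astar P ξ θ ε ρ act) (t : ℕ) :
    history ξ act θ ε ρ t ≤ past ξ act θ ε ρ t := by
  induction t using Nat.strong_induction_on with
  | _ t ih =>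
    refine sup_le (le_trans le_sup_left (past_mono (Nat.zero_le t))) (iSup_le fun i => ?_)
    refine le_trans ?_ (past_mono (Nat.succ_le_of_lt i.2))
    rw [← measurable_iff_comap_le]
    refine measurable_obs _ (fun j hj => ?_) (fun s k => measurable_source_past s k _)
      (measurable_simObs_past _)
    exact (hrun.act_adapted j).mono ((ih j (hj.trans_lt i.2)).trans
      (past_mono (hj.trans (Nat.le_succ _)))) le_rfl

theorem measurable_act_past (hrun : IsRun M astar P ξ θ ε ρ act) (t : ℕ) :
    Measurable[past ξ act θ ε ρ t] (act t) :=
  (hrun.act_adapted t).mono (hrun.history_le_past t) le_rfl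

theorem measurable_path [CompactSpace A] (hrun : IsRun M astar P ξ θ ε ρ act)
    {m : MeasurableSpace Ω} (h : ∀ z, Measurable[m] (θ z)) : Measurable[m] hrun.path :=
  measurable_continuousMap_of_eval h

theorem measurable_simObs [CompactSpace A] (hrun : IsRun M astar P ξ θ ε ρ act)
    {m : MeasurableSpace Ω} (h : ∀ z, Measurable[m] (θ z)) {t : ℕ} (ha : Measurable[m] (act t))
    (hε : Measurable[m] (ε t)) : Measurable[m] (simObs act θ ε t) :=
  have h1 : Measurable fun ω => noiseFree (hrun.path ω, act t ω) :=
    measurable_noiseFree.comp ((hrun.measurable_path h).prodMk ha)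
  h1.add hε

/-- Stated for an arbitrary σ-algebra because it serves twice: with the ambient one, and with the
one that excludes the current and later noises. -/
theorem past_le_of [CompactSpace A] (hrun : IsRun M astar P ξ θ ε ρ act)
    {m : MeasurableSpace Ω} (h : ∀ z, Measurable[m] (θ z)) (hξ : Measurable[m] ξ)
    (hρ : ∀ s k, Measurable[m] (ρ s k)) (t : ℕ) (hε : ∀ i < t, Measurable[m] (ε i)) :
    past ξ act θ ε ρ t ≤ m := by
  induction t with
  | zero => exact sup_le hξ.comap_le (iSup_le fun i => (hρ i.1 i.2).comap_le)
  | succ t ih =>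
    have h1 := ih fun i hi => hε i (hi.trans (Nat.lt_succ_self t))
    refine sup_le h1 (Measurable.comap_le ?_)
    exact hrun.measurable_simObs h ((hrun.measurable_act_past t).mono h1 le_rfl)
      (hε t (Nat.lt_succ_self t))

theorem past_le [CompactSpace A] (hrun : IsRun M astar P ξ θ ε ρ act) (t : ℕ) :
    past ξ act θ ε ρ t ≤ mΩ :=
  hrun.past_le_of hrun.theta_measurable hrun.rand_measurable hrun.src_measurable t
    fun i _ => hrun.noise_measurable i

/-- The target function and the past are functions of the target function, the source answers, the
randomisation and the earlier noises, all independent of the current noise. -/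
theorem indep_path_past_noise [CompactSpace A] [IsProbabilityMeasure P]
    (hrun : IsRun M astar P ξ θ ε ρ act) (t : ℕ) :
    Indep (MeasurableSpace.comap hrun.path inferInstance ⊔ past ξ act θ ε ρ t)
      (MeasurableSpace.comap (ε t) inferInstance) P := by
  set mm : Fin 4 → MeasurableSpace Ω := ![⨆ z, MeasurableSpace.comap (θ z) inferInstance,
    ⨆ t, MeasurableSpace.comap (ε t) inferInstance,
    ⨆ i : Fin Ns × ℕ, MeasurableSpace.comap (ρ i.1 i.2) inferInstance,
    MeasurableSpace.comap ξ inferInstance] with hmm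
  have hle : ∀ i, mm i ≤ mΩ := by
    intro i
    fin_cases i
    · exact iSup_le fun z => (hrun.theta_measurable z).comap_le
    · exact iSup_le fun t => (hrun.noise_measurable t).comap_le
    · exact iSup_le fun i => (hrun.src_measurable i.1 i.2).comap_le
    · exact hrun.rand_measurable.comap_le
  -- Block 1 consists of all noises; the other three are the target function, the source answers and
  -- the randomisation.
  have h1 : Indep (⨆ i ∈ ({0, 2, 3} : Set (Fin 4)), mm i) (⨆ i ∈ ({1} : Set (Fin 4)), mm i) P :=
    indep_iSup_of_disjoint hle hrun.indep (by simp)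
  have h2 : Indep (⨆ i ∈ Set.Iio t, MeasurableSpace.comap (ε i) inferInstance)
      (⨆ i ∈ ({t} : Set ℕ), MeasurableSpace.comap (ε i) inferInstance) P :=
    indep_iSup_of_disjoint (fun i => (hrun.noise_measurable i).comap_le) hrun.noise_indep.iIndep
      (by simp)
  simp only [Set.mem_singleton_iff, iSup_iSup_eq_left] at h1 h2
  have h3 := indep_sup_of_indep (iSup₂_le fun i _ => hle i) (hle 1) h1
    (m₂ := ⨆ i ∈ Set.Iio t, MeasurableSpace.comap (ε i) inferInstance)
    (m₃ := MeasurableSpace.comap (ε t) inferInstance)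
    (iSup₂_le fun i _ => le_iSup (fun t => MeasurableSpace.comap (ε t) inferInstance) i)
    (le_iSup (fun t => MeasurableSpace.comap (ε t) inferInstance) t) h2
  refine indep_of_indep_of_le_left h3 ?_
  set m' := (⨆ i ∈ ({0, 2, 3} : Set (Fin 4)), mm i) ⊔
    ⨆ i ∈ Set.Iio t, MeasurableSpace.comap (ε i) inferInstance with hm'
  have hmem : ∀ i ∈ ({0, 2, 3} : Set (Fin 4)), mm i ≤ m' := fun i hi =>
    le_sup_of_le_left (le_iSup₂_of_le i hi le_rfl)
  have hθ : ∀ z, Measurable[m'] (θ z) := fun z => by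
    rw [measurable_iff_comap_le]
    exact (le_iSup (fun z => MeasurableSpace.comap (θ z) inferInstance) z).trans
      (hmem 0 (by simp))
  refine sup_le (hrun.measurable_path hθ).comap_le (hrun.past_le_of hθ ?_ (fun s k => ?_) t ?_)
  · rw [measurable_iff_comap_le]
    exact hmem 3 (by simp)
  · rw [measurable_iff_comap_le]
    exact (le_iSup (fun i : Fin Ns × ℕ => MeasurableSpace.comap (ρ i.1 i.2) inferInstance)
      (s, k)).trans (hmem 2 (by simp))
  · intro i hi
    rw [measurable_iff_comap_le]
    exact le_sup_of_le_right (le_iSup₂_of_le i hi le_rfl)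

theorem indep_path_past_zero [CompactSpace A] [IsProbabilityMeasure P]
    (hrun : IsRun M astar P ξ θ ε ρ act) :
    Indep (MeasurableSpace.comap hrun.path inferInstance) (past ξ act θ ε ρ 0) P := by
  set mm : Fin 4 → MeasurableSpace Ω := ![⨆ z, MeasurableSpace.comap (θ z) inferInstance,
    ⨆ t, MeasurableSpace.comap (ε t) inferInstance,
    ⨆ i : Fin Ns × ℕ, MeasurableSpace.comap (ρ i.1 i.2) inferInstance,
    MeasurableSpace.comap ξ inferInstance] with hmm
  have hle : ∀ i, mm i ≤ mΩ := by
    intro i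
    fin_cases i
    · exact iSup_le fun z => (hrun.theta_measurable z).comap_le
    · exact iSup_le fun t => (hrun.noise_measurable t).comap_le
    · exact iSup_le fun i => (hrun.src_measurable i.1 i.2).comap_le
    · exact hrun.rand_measurable.comap_le
  have h1 : Indep (⨆ i ∈ ({0} : Set (Fin 4)), mm i) (⨆ i ∈ ({2, 3} : Set (Fin 4)), mm i) P :=
    indep_iSup_of_disjoint hle hrun.indep (by simp)
  refine indep_of_indep_of_le_left (indep_of_indep_of_le_right h1 ?_) ?_
  · exact sup_le (le_iSup₂_of_le (f := fun i _ => mm i) 3 (by simp) le_rfl)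
      (le_iSup₂_of_le (f := fun i _ => mm i) 2 (by simp) le_rfl)
  · refine (hrun.measurable_path fun z => ?_).comap_le
    rw [measurable_iff_comap_le]
    exact (le_iSup (fun z => MeasurableSpace.comap (θ z) inferInstance) z).trans
      (le_iSup₂_of_le (f := fun i _ => mm i) 0 (by simp) le_rfl)

/-- The conditional law of the target function given the past is the Gaussian process posterior,
although the simulation points are chosen adaptively. -/
theorem isPosterior_gpMeasure [CompactSpace A] [IsProbabilityMeasure P]
    (hrun : IsRun M astar P ξ θ ε ρ act) (t : ℕ) :
    IsPosterior (mℋ := past ξ act θ ε ρ t) P hrun.path id fun ω =>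
      M.gpMeasure (fun z c => c z) (P.map hrun.path) (simData act θ ε t ω) := by
  have hpath : Measurable hrun.path := hrun.measurable_path hrun.theta_measurable
  induction t with
  | zero =>
    refine isPosterior_of_indepFun hpath (measurable_id.mono (hrun.past_le 0) le_rfl) ?_
    have := hrun.indep_path_past_zero
    rw [← MeasurableSpace.comap_id (m := past ξ act θ ε ρ 0)] at this
    exact this
  | succ t ih =>
    have hle := hrun.past_le t
    have hid : @Measurable _ _ _ (past ξ act θ ε ρ t) (id : Ω → Ω) := measurable_id.mono hle le_rfl
    let q : C(X × A, ℝ) × Ω → ℝ := fun p => noiseFree (p.1, act t p.2)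
    have hq : @Measurable _ _ (@Prod.instMeasurableSpace _ _ _ (past ξ act θ ε ρ t)) _ q := by
      exact measurable_noiseFree_comp (hrun.measurable_act_past t)
    have hind : @IndepFun _ _ _ _ (@Prod.instMeasurableSpace _ _ _ (past ξ act θ ε ρ t)) _
        (fun ω => (hrun.path ω, id ω)) (ε t) P := by
      refine indepFun_prodMk_of_indep_sup ?_
      rw [MeasurableSpace.comap_id]
      exact hrun.indep_path_past_noise t
    have h1 := (@IsPosterior.isPosterior_update Ω Ω _ _ (past ξ act θ ε ρ t) _ P _ _ _ _ hpath hid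
      ih q hq M.noiseVar M.noiseVar_pos.ne' (ε t) (hrun.noise_measurable t) (hrun.noise_law t)
      hind).comap
    have h2 := MeasurableSpace.comap_prodMk (mβ := past ξ act θ ε ρ t)
      (mγ := Real.measurableSpace) id (simObs act θ ε t)
    rw [MeasurableSpace.comap_id] at h2
    have h3 : ∀ ω, q (hrun.path ω, id ω) + ε t ω = simObs act θ ε t ω := fun ω => rfl
    simp only [h3] at h1
    have h4 : past ξ act θ ε ρ (t + 1) = _ := h2.symm
    suffices hQ : (fun ω => M.gpMeasure (fun z c => c z) (P.map hrun.path)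
        (simData act θ ε (t + 1) ω)) = fun ω => IsPosterior.update
        (fun ω => M.gpMeasure (fun z c => c z) (P.map hrun.path) (simData act θ ε t ω)) q M.noiseVar
        (id ω, simObs act θ ε t ω) by
      rw [hQ, h4]
      exact h1
    ext1 ω
    simp only [IsPosterior.update, simData, simObs, q, noiseFree, id]
    cases hω : act t ω with
    | inl z => rfl
    -- In a source iteration the recorded value is pure noise. Its density is constant in the path
    -- and normalises away, so the law is unchanged, as are the simulation data.
    | inr s =>
      have := @IsPosterior.prob _ _ _ _ (past ξ act θ ε ρ t) _ _ _ _ _ ih ω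
      have hp := gaussianPDF_pos 0 M.noiseVar_pos.ne' (0 + ε t ω)
      simp only [Sum.elim_inr]
      rw [lintegral_const, measure_univ, mul_one, withDensity_const, smul_smul,
        ENNReal.inv_mul_cancel hp.ne' gaussianPDF_ne_top, one_smul]

theorem isGP_path [CompactSpace A] (hrun : IsRun M astar P ξ θ ε ρ act) :
    IsGP (fun z (c : C(X × A, ℝ)) => c z) (P.map hrun.path) M.mu0 M.k0 :=
  IsGP.map (hrun.measurable_path hrun.theta_measurable) measurable_eval_continuousMap
    (isGP_of_isGaussianProcess hrun.theta_gaussian hrun.theta_mean hrun.theta_cov)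

end IsRun

end Run

/-! ### Conditional expectations from conditional laws. -/

section ConditionalExpectation

variable {Ω ℋ 𝒞 : Type*} {mΩ : MeasurableSpace Ω} {mℋ : MeasurableSpace ℋ}
  {m𝒞 : MeasurableSpace 𝒞}

theorem stronglyMeasurable_integral_of_prob {Q : ℋ → Measure 𝒞} (hQ : Measurable Q)
    (hp : ∀ a, IsProbabilityMeasure (Q a)) {f : 𝒞 × ℋ → ℝ} (hf : Measurable f) :
    StronglyMeasurable fun a => ∫ c, f (c, a) ∂Q a := by
  let κ : Kernel ℋ 𝒞 := ⟨Q, hQ⟩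
  have : IsMarkovKernel κ := ⟨hp⟩
  exact (hf.comp measurable_swap).stronglyMeasurable.integral_kernel_prod_right' (κ := κ)

namespace IsPosterior

variable {P : Measure Ω} {T : Ω → 𝒞} {h : Ω → ℋ} {Q : ℋ → Measure 𝒞}

theorem lintegral_enorm_ne_top (hQ : IsPosterior P T h Q) {f : 𝒞 × ℋ → ℝ} (hf : Measurable f)
    (hfi : Integrable (fun ω => f (T ω, h ω)) P) :
    ∫⁻ ω, ∫⁻ c, ‖f (c, h ω)‖ₑ ∂Q (h ω) ∂P ≠ ∞ := by
  rw [← hQ.lintegral_eq (fun p => ‖f p‖ₑ) hf.enorm]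
  exact hfi.2.ne

/-- Positive and negative parts are treated separately, where the identity for nonnegative functions
applies; the inner integrals are known to be finite only almost everywhere. -/
theorem integral_eq_and_integrable (hh : Measurable h) (hQ : IsPosterior P T h Q)
    {f : 𝒞 × ℋ → ℝ} (hf : Measurable f) (hfi : Integrable (fun ω => f (T ω, h ω)) P) :
    ∫ ω, f (T ω, h ω) ∂P = ∫ ω, ∫ c, f (c, h ω) ∂Q (h ω) ∂P ∧
      Integrable (fun ω => ∫ c, f (c, h ω) ∂Q (h ω)) P := by
  have hM : ∀ Φ : 𝒞 × ℋ → ℝ≥0∞, Measurable Φ →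
      Measurable fun ω => ∫⁻ c, Φ (c, h ω) ∂Q (h ω) := fun Φ hΦ =>
    (measurable_lintegral_of_prob hQ.measurable hQ.prob (Φ := fun c a => Φ (c, a)) hΦ).comp hh
  have hfin := hQ.lintegral_enorm_ne_top hf hfi
  have hae : ∀ᵐ ω ∂P, ∫⁻ c, ‖f (c, h ω)‖ₑ ∂Q (h ω) < ∞ := ae_lt_top (hM _ hf.enorm) hfin
  have hint : ∀ᵐ ω ∂P, Integrable (fun c => f (c, h ω)) (Q (h ω)) := by
    filter_upwards [hae] with ω hω
    exact ⟨(hf.comp measurable_prodMk_right).aestronglyMeasurable, hω⟩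
  have hle : ∀ (g : 𝒞 × ℋ → ℝ), (∀ p, |g p| = |f p|) → ∀ ω,
      ∫⁻ c, ENNReal.ofReal (g (c, h ω)) ∂Q (h ω) ≤ ∫⁻ c, ‖f (c, h ω)‖ₑ ∂Q (h ω) := fun g hg ω => by
    refine lintegral_mono fun c => ?_
    rw [← ofReal_norm, Real.norm_eq_abs, ← hg]
    exact ENNReal.ofReal_le_ofReal (le_abs_self _)
  have hpos := hle f fun _ => rfl
  have hneg := hle (fun p => -f p) fun p => abs_neg _
  have hfin' : ∀ g : 𝒞 × ℋ → ℝ, Measurable g → (∀ p, |g p| = |f p|) →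
      Integrable (fun ω => (∫⁻ c, ENNReal.ofReal (g (c, h ω)) ∂Q (h ω)).toReal) P := fun g hg hgf =>
    integrable_toReal_of_lintegral_ne_top (hM _ hg.ennreal_ofReal).aemeasurable
      (ne_top_of_le_ne_top hfin (lintegral_mono (hle g hgf)))
  have hi1 := hfin' f hf fun _ => rfl
  have hi2 := hfin' (fun p => -f p) hf.neg fun p => abs_neg _
  have heq : (fun ω => ∫ c, f (c, h ω) ∂Q (h ω)) =ᵐ[P] fun ω =>
      (∫⁻ c, ENNReal.ofReal (f (c, h ω)) ∂Q (h ω)).toReal -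
        (∫⁻ c, ENNReal.ofReal (-f (c, h ω)) ∂Q (h ω)).toReal := by
    filter_upwards [hint] with ω hω
    exact integral_eq_lintegral_pos_part_sub_lintegral_neg_part hω
  have hMneg := hM (fun p => ENNReal.ofReal (-f p)) hf.neg.ennreal_ofReal
  refine ⟨?_, (hi1.sub hi2).congr heq.symm⟩
  rw [integral_congr_ae heq, integral_sub hi1 hi2,
    integral_toReal (hM _ hf.ennreal_ofReal).aemeasurable
      (hae.mono fun ω hω => (hpos ω).trans_lt hω),
    integral_toReal hMneg.aemeasurable (hae.mono fun ω hω => (hneg ω).trans_lt hω),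
    ← hQ.lintegral_eq _ hf.ennreal_ofReal,
    ← hQ.lintegral_eq (fun p => ENNReal.ofReal (-f p)) hf.neg.ennreal_ofReal]
  exact integral_eq_lintegral_pos_part_sub_lintegral_neg_part hfi

/-- An event of the conditioning σ-algebra is a preimage h⁻¹(S); multiplying f by the indicator of S
reduces the defining identity to the disintegration. -/
theorem integral_ae_eq_condExp [IsProbabilityMeasure P] (hh : Measurable h)
    (hQ : IsPosterior P T h Q) {f : 𝒞 × ℋ → ℝ} (hf : Measurable f)
    (hfi : Integrable (fun ω => f (T ω, h ω)) P) :
    (fun ω => ∫ c, f (c, h ω) ∂Q (h ω)) =ᵐ[P] P[fun ω => f (T ω, h ω) | mℋ.comap h] := by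
  refine ae_eq_condExp_of_forall_setIntegral_eq hh.comap_le hfi
    (fun s _ _ => (hQ.integral_eq_and_integrable hh hf hfi).2.integrableOn) ?_ ?_
  · rintro _ ⟨S, hS, rfl⟩ _
    have hS' := hh hS
    have hg : Measurable ((Prod.snd ⁻¹' S : Set (𝒞 × ℋ)).indicator f) :=
      hf.indicator (measurable_snd hS)
    have hind : (fun ω => (Prod.snd ⁻¹' S : Set (𝒞 × ℋ)).indicator f (T ω, h ω)) =
        (h ⁻¹' S).indicator fun ω => f (T ω, h ω) := by
      ext ω
      by_cases hω : h ω ∈ S <;> simp [Set.indicator, hω]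
    have := (hQ.integral_eq_and_integrable hh hg (by rw [hind]; exact hfi.indicator hS')).1
    rw [hind, integral_indicator hS'] at this
    rw [this, ← integral_indicator hS']
    congr 1
    ext ω
    by_cases hω : h ω ∈ S <;> simp [Set.indicator, hω]
  · exact ((stronglyMeasurable_integral_of_prob hQ.measurable hQ.prob hf).comp_measurable
      (comap_measurable h)).aestronglyMeasurable

end IsPosterior

/-- If the conditional expectations `V t` of nonnegative variables `U t` tend to zero on an event,
then `U t` has a subsequence that tends to zero on this event. -/
theorem ae_liminf_eq_zero_of_tendsto_zero {P : Measure Ω} {U V : ℕ → Ω → ℝ≥0∞}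
    (hU : ∀ t, Measurable (U t)) (hV : ∀ t, Measurable (V t))
    [IsProbabilityMeasure P]
    (hUV : ∀ t, ∀ δ, ∫⁻ ω in {ω | V t ω ≤ δ}, U t ω ∂P = ∫⁻ ω in {ω | V t ω ≤ δ}, V t ω ∂P) :
    ∀ᵐ ω ∂P, Tendsto (fun t => V t ω) atTop (𝓝 0) → liminf (fun t => U t ω) atTop = 0 := by
  -- Truncating to the event where V t is small bounds the mean of U t there, and Fatou's lemma
  -- passes the bound to the liminf; nothing stronger than a liminf is available at this point.
  let W : ℕ → Ω → ℝ≥0∞ := fun n ω =>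
    liminf (fun t => {ω | V t ω ≤ ((n : ℝ≥0∞) + 1)⁻¹}.indicator (U t) ω) atTop
  have hset : ∀ t δ, MeasurableSet {ω | V t ω ≤ δ} := fun t δ =>
    measurableSet_le (hV t) measurable_const
  have hW : ∀ n, ∫⁻ ω, W n ω ∂P ≤ ((n : ℝ≥0∞) + 1)⁻¹ := fun n => by
    refine (lintegral_liminf_le fun t => (hU t).indicator (hset t _)).trans ?_
    refine liminf_le_of_frequently_le' (Eventually.frequently (Eventually.of_forall fun t => ?_))
    rw [lintegral_indicator (hset t _), hUV]
    have hle : ∀ ω ∈ {ω | V t ω ≤ ((n : ℝ≥0∞) + 1)⁻¹}, V t ω ≤ ((n : ℝ≥0∞) + 1)⁻¹ :=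
      fun ω hω => hω
    refine (setLIntegral_mono measurable_const hle).trans ?_
    rw [setLIntegral_const]
    exact mul_le_of_le_one_right' prob_le_one
  have hWm : ∀ n, Measurable (W n) := fun n =>
    Measurable.liminf fun t => (hU t).indicator (hset t _)
  have h0 : ∫⁻ ω, ⨅ n, W n ω ∂P = 0 := by
    refine le_antisymm (ge_of_tendsto' (f := fun n : ℕ => ((n : ℝ≥0∞) + 1)⁻¹) (x := atTop) ?_
      fun n => (lintegral_mono fun ω => iInf_le _ n).trans (hW n)) bot_le
    have := ENNReal.tendsto_inv_nat_nhds_zero.comp (tendsto_add_atTop_nat 1)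
    simpa [Function.comp_def] using this
  rw [lintegral_eq_zero_iff (Measurable.iInf hWm)] at h0
  filter_upwards [h0] with ω hω hV0
  rw [← le_zero_iff, ← show ⨅ n, W n ω = 0 from hω]
  refine le_iInf fun n => ?_
  -- Where V t tends to zero the truncation is eventually inactive, so W n is the liminf of U t
  -- itself.
  have hev : ∀ᶠ t in atTop, V t ω ≤ ((n : ℝ≥0∞) + 1)⁻¹ :=
    hV0.eventually_le_const (by simp)
  refine (liminf_congr ?_).le
  filter_upwards [hev] with t ht
  exact (Set.indicator_of_mem (s := {ω | V t ω ≤ ((n : ℝ≥0∞) + 1)⁻¹}) ht (U t)).symm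

end ConditionalExpectation

/-! ### Integrals of a Gaussian process against probability measures, and their conditional
variances. -/

section GaussianIntegral

variable {Z 𝒞 : Type*} [MeasurableSpace Z] [MeasurableSpace 𝒞] {Q : Measure 𝒞}

theorem memLp_two_prod [IsProbabilityMeasure Q] {π : Measure Z} [IsProbabilityMeasure π]
    {φ : 𝒞 → Z → ℝ}
    (hφ : Measurable (Function.uncurry φ)) (hφ2 : ∀ z, MemLp (fun c => φ c z) 2 Q) {C : ℝ}
    (hC : ∀ z, ∫ c, φ c z ^ 2 ∂Q ≤ C) : MemLp (Function.uncurry φ) 2 (Q.prod π) := by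
  rw [memLp_two_iff_integrable_sq hφ.aestronglyMeasurable]
  have h2 : Measurable fun p : 𝒞 × Z => Function.uncurry φ p ^ 2 := hφ.pow_const 2
  refine (integrable_prod_iff' h2.aestronglyMeasurable).2 ⟨ae_of_all _ fun z =>
    (hφ2 z).integrable_sq, ?_⟩
  refine Integrable.of_bound (C := C)
    (h2.norm.stronglyMeasurable.integral_prod_left').aestronglyMeasurable (ae_of_all _ fun z => ?_)
  rw [Real.norm_of_nonneg (integral_nonneg fun _ => norm_nonneg _)]
  simpa [Function.uncurry] using hC z

/-- Nonnegativity of the variance under π bounds the square of the inner integral by the integral of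
the square. -/
theorem memLp_two_integral {π : Measure Z} [IsProbabilityMeasure π]
    {φ : 𝒞 → Z → ℝ}
    (hφ : Measurable (Function.uncurry φ)) (hφ2 : MemLp (Function.uncurry φ) 2 (Q.prod π)) :
    MemLp (fun c => ∫ z, φ c z ∂π) 2 Q := by
  have hm : StronglyMeasurable fun c => ∫ z, φ c z ∂π := hφ.stronglyMeasurable.integral_prod_right'
  rw [memLp_two_iff_integrable_sq hm.aestronglyMeasurable]
  have hi := hφ2.integrable_sq
  have hi' := (integrable_prod_iff hi.1).1 hi
  refine hi'.2.mono' (hm.pow 2).aestronglyMeasurable ?_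
  filter_upwards [hi'.1] with c hc
  have h1 : MemLp (fun z => φ c z) 2 π := (memLp_two_iff_integrable_sq
    (hφ.comp measurable_prodMk_left).aestronglyMeasurable).2 hc
  have h2 := variance_nonneg (fun z => φ c z) π
  rw [variance_eq_sub h1] at h2
  simp only [norm_pow, Real.norm_eq_abs, sq_abs, Function.uncurry]
  simpa using h2

theorem integral_mul_integral [IsProbabilityMeasure Q] {π : Measure Z} [IsProbabilityMeasure π]
    {φ : 𝒞 → Z → ℝ}
    (hφ2 : MemLp (Function.uncurry φ) 2 (Q.prod π)) {Y : 𝒞 → ℝ} (hY : MemLp Y 2 Q) :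
    ∫ c, Y c * ∫ z, φ c z ∂π ∂Q = ∫ z, ∫ c, Y c * φ c z ∂Q ∂π := by
  have hY' : MemLp (fun p : 𝒞 × Z => Y p.1) 2 (Q.prod π) := hY.comp_fst π
  have hi : Integrable (Function.uncurry fun c z => Y c * φ c z) (Q.prod π) :=
    hY'.integrable_mul hφ2
  rw [← integral_integral_swap hi]
  simp only [integral_const_mul]

end GaussianIntegral

namespace IsGP

variable {Z 𝒞 : Type*} [MeasurableSpace 𝒞] {Q : Measure 𝒞} {ev : Z → 𝒞 → ℝ}
  {m : Z → ℝ} {k : Z → Z → ℝ}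

theorem memLp_two_centered (hev : ∀ z, Measurable (ev z)) (h : IsGP ev Q m k) (z : Z) :
    MemLp (fun c => ev z c - m z) 2 Q := by
  have := h.isProbabilityMeasure
  exact (h.memLp_two hev z).sub (memLp_const (m z))

theorem integral_centered_mul (hev : ∀ z, Measurable (ev z)) (h : IsGP ev Q m k) (z z' : Z) :
    ∫ c, (ev z c - m z) * (ev z' c - m z') ∂Q = k z z' := by
  rw [← h.covariance_eval hev, covariance, h.integral_eval hev, h.integral_eval hev]

variable [MeasurableSpace Z]

/-- The variance of an integral of a Gaussian process against a difference of probability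
measures. -/
theorem lintegral_sq_integral_sub (hev : Measurable fun p : 𝒞 × Z => ev p.2 p.1)
    (h : IsGP ev Q m k) {C : ℝ} (hC : ∀ z, k z z ≤ C) (hm : Measurable m)
    (π₁ π₂ : Measure Z) [IsProbabilityMeasure π₁] [IsProbabilityMeasure π₂]
    (hm₁ : Integrable m π₁) (hm₂ : Integrable m π₂) :
    ∫⁻ c, ENNReal.ofReal (((∫ z, ev z c ∂π₁ - ∫ z, ev z c ∂π₂) -
        (∫ z, m z ∂π₁ - ∫ z, m z ∂π₂)) ^ 2) ∂Q =
      ENNReal.ofReal (∫ z', (∫ z, k z' z ∂π₁ - ∫ z, k z' z ∂π₂) ∂π₁ -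
        ∫ z', (∫ z, k z' z ∂π₁ - ∫ z, k z' z ∂π₂) ∂π₂) := by
  have := h.isProbabilityMeasure
  have hev' : ∀ z, Measurable (ev z) := fun z => hev.comp measurable_prodMk_right
  set φ : 𝒞 → Z → ℝ := fun c z => ev z c - m z with hφ
  have hφm : Measurable (Function.uncurry φ) := hev.sub (hm.comp measurable_snd)
  have hb : ∀ z, ∫ c, φ c z ^ 2 ∂Q ≤ C := fun z => by
    simp only [hφ, sq, h.integral_centered_mul hev']
    exact hC z
  have h2 : ∀ (π : Measure Z) [IsProbabilityMeasure π],
      MemLp (Function.uncurry φ) 2 (Q.prod π) := fun π _ =>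
    memLp_two_prod hφm (h.memLp_two_centered hev') hb
  set Y : 𝒞 → ℝ := fun c => ∫ z, φ c z ∂π₁ - ∫ z, φ c z ∂π₂ with hY
  have hY₁ := memLp_two_integral hφm (h2 π₁)
  have hY₂ := memLp_two_integral hφm (h2 π₂)
  have hY2 : MemLp Y 2 Q := hY₁.sub hY₂
  -- Bilinearity in two steps: the covariance of Y with one value first, then its integral over z',
  -- which is the variance of Y.
  have hcov : ∀ z', ∫ c, Y c * φ c z' ∂Q = ∫ z, k z' z ∂π₁ - ∫ z, k z' z ∂π₂ := fun z' => by
    have hz := h.memLp_two_centered hev' z'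
    have h3 : ∀ (π : Measure Z) [IsProbabilityMeasure π],
        ∫ c, φ c z' * ∫ z, φ c z ∂π ∂Q = ∫ z, k z' z ∂π := fun π _ => by
      rw [integral_mul_integral (h2 π) hz]
      simp only [hφ, h.integral_centered_mul hev']
    have hi₁ : Integrable (fun c => φ c z' * ∫ z, φ c z ∂π₁) Q := hz.integrable_mul hY₁
    have hi₂ : Integrable (fun c => φ c z' * ∫ z, φ c z ∂π₂) Q := hz.integrable_mul hY₂
    rw [← h3 π₁, ← h3 π₂, ← integral_sub hi₁ hi₂]
    congr 1
    ext c
    simp only [hY]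
    ring
  have hvar : ∫ c, Y c ^ 2 ∂Q = ∫ z', (∫ z, k z' z ∂π₁ - ∫ z, k z' z ∂π₂) ∂π₁ -
      ∫ z', (∫ z, k z' z ∂π₁ - ∫ z, k z' z ∂π₂) ∂π₂ := by
    simp only [← hcov]
    have hi₁ : Integrable (fun c => Y c * ∫ z, φ c z ∂π₁) Q := hY2.integrable_mul hY₁
    have hi₂ : Integrable (fun c => Y c * ∫ z, φ c z ∂π₂) Q := hY2.integrable_mul hY₂
    rw [← integral_mul_integral (h2 π₁) hY2, ← integral_mul_integral (h2 π₂) hY2,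
      ← integral_sub hi₁ hi₂]
    congr 1
    ext c
    simp only [hY]
    ring
  rw [← hvar, ofReal_integral_eq_lintegral_ofReal hY2.integrable_sq
    (ae_of_all _ fun _ => sq_nonneg _)]
  have hsec : ∀ (π : Measure Z) [IsProbabilityMeasure π],
      ∀ᵐ c ∂Q, Integrable (fun z => φ c z) π := fun π _ =>
    ((integrable_prod_iff ((h2 π).integrable one_le_two).1).1 ((h2 π).integrable one_le_two)).1
  -- Splitting off the mean requires integrable sections, which Fubini provides for almost every
  -- path only.
  refine lintegral_congr_ae ?_
  filter_upwards [hsec π₁, hsec π₂] with c h1 h2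
  have h3 : ∀ π : Measure Z, Integrable m π → Integrable (fun z => φ c z) π →
      ∫ z, φ c z ∂π = ∫ z, ev z c ∂π - ∫ z, m z ∂π := fun π hm hi => by
    have : Integrable (fun z => ev z c) π := 
      (hi.add hm).congr (ae_of_all _ fun z => by simp [hφ])
    exact integral_sub this hm
  simp only [hY]
  rw [h3 π₁ hm₁ h1, h3 π₂ hm₂ h2]
  congr 2
  ring

theorem integral_integral_eval (hev : Measurable fun p : 𝒞 × Z => ev p.2 p.1)
    (h : IsGP ev Q m k) {C : ℝ} (hC : ∀ z, k z z ≤ C) (hm : Measurable m)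
    (π : Measure Z) [IsProbabilityMeasure π] (hmi : Integrable m π) :
    ∫ c, ∫ z, ev z c ∂π ∂Q = ∫ z, m z ∂π := by
  have := h.isProbabilityMeasure
  have hev' : ∀ z, Measurable (ev z) := fun z => hev.comp measurable_prodMk_right
  have hi : Integrable (Function.uncurry fun c z => ev z c - m z) (Q.prod π) :=
    (memLp_two_prod (C := C) (hev.sub (hm.comp measurable_snd)) (h.memLp_two_centered hev')
      fun z => by simpa only [sq, h.integral_centered_mul hev'] using hC z).integrable one_le_two
  have hi' : Integrable (Function.uncurry fun c z => ev z c) (Q.prod π) := by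
    have := hi.add (hmi.comp_snd Q)
    refine this.congr (ae_of_all _ fun p => ?_)
    simp [Function.uncurry]
  rw [integral_integral_swap hi']
  simp only [h.integral_eval hev']

end IsGP

namespace IsPosterior

variable {Ω ℋ 𝒞 Z : Type*} {mΩ : MeasurableSpace Ω} {mℋ : MeasurableSpace ℋ}
  {m𝒞 : MeasurableSpace 𝒞} [MeasurableSpace Z] {P : Measure Ω} {T : Ω → 𝒞} {h : Ω → ℋ}
  {Q : ℋ → Measure 𝒞} {ev : Z → 𝒞 → ℝ} {m : ℋ → Z → ℝ} {k : ℋ → Z → Z → ℝ}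

theorem measurable_integral_eval (hev : Measurable fun p : 𝒞 × Z => ev p.2 p.1)
    {π : ℋ → Measure Z} (hπ : Measurable π) (hπp : ∀ a, IsProbabilityMeasure (π a)) :
    Measurable fun p : 𝒞 × ℋ => ∫ z, ev z p.1 ∂π p.2 :=
  (stronglyMeasurable_integral_of_prob (Q := fun p : 𝒞 × ℋ => π p.2) (hπ.comp measurable_snd)
    (fun p => hπp p.2) (f := fun q : Z × 𝒞 × ℋ => ev q.1 q.2.1)
    (hev.comp (measurable_snd.fst.prodMk measurable_fst))).measurable

/-- The bound |x| ≤ 1 + x² reduces the claim to conditional second moments, which are at most B + C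
uniformly in the point and the past. -/
theorem integrable_integral_eval [IsProbabilityMeasure P] (hT : Measurable T) (hh : Measurable h)
    (hQ : IsPosterior P T h Q) (hev : Measurable fun p : 𝒞 × Z => ev p.2 p.1)
    (hgp : ∀ a, IsGP ev (Q a) (m a) (k a)) {B C : ℝ} (hB : ∀ a z, m a z ^ 2 ≤ B)
    (hC : ∀ a z, k a z z ≤ C) {π : ℋ → Measure Z} (hπ : Measurable π)
    (hπp : ∀ a, IsProbabilityMeasure (π a)) :
    Integrable (fun ω => ∫ z, ev z (T ω) ∂π (h ω)) P := by
  have hev' : ∀ z, Measurable (ev z) := fun z => hev.comp measurable_prodMk_right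
  refine ⟨((measurable_integral_eval hev hπ hπp).comp (hT.prodMk hh)).aestronglyMeasurable, ?_⟩
  have h1 : ∀ a z, ∫⁻ c, ‖ev z c‖ₑ ∂Q a ≤ ENNReal.ofReal (1 + (C + B)) := fun a z => by
    have := hQ.prob a
    have h2 := (hgp a).memLp_two hev' z
    have h3 := (hgp a).covariance_eval hev' z z
    rw [covariance_self (hev' z).aemeasurable, variance_eq_sub h2, (hgp a).integral_eval hev'] at h3
    have h4 : ∫ c, (1 + ev z c ^ 2) ∂Q a ≤ 1 + (C + B) := by
      rw [integral_add (integrable_const _) h2.integrable_sq]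
      have := hB a z
      have := hC a z
      simp only [Pi.pow_apply] at h3
      simp
      linarith
    refine le_trans ?_ (ENNReal.ofReal_le_ofReal h4)
    have h5 : Integrable (fun c => 1 + ev z c ^ 2) (Q a) :=
      (integrable_const _).add h2.integrable_sq
    rw [ofReal_integral_eq_lintegral_ofReal h5 (ae_of_all _ fun c => by positivity)]
    refine lintegral_mono fun c => ?_
    rw [← ofReal_norm, Real.norm_eq_abs]
    refine ENNReal.ofReal_le_ofReal ?_
    nlinarith [sq_nonneg (|ev z c| - 1), sq_abs (ev z c)]
  have hm : Measurable fun p : 𝒞 × ℋ => ∫⁻ z, ‖ev z p.1‖ₑ ∂π p.2 :=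
    measurable_lintegral_of_prob (Q := fun p : 𝒞 × ℋ => π p.2) (hπ.comp measurable_snd)
      (fun p => hπp p.2) (Φ := fun z p => ‖ev z p.1‖ₑ)
      (hev.comp (measurable_snd.fst.prodMk measurable_fst)).enorm
  calc ∫⁻ ω, ‖∫ z, ev z (T ω) ∂π (h ω)‖ₑ ∂P
      ≤ ∫⁻ ω, ∫⁻ z, ‖ev z (T ω)‖ₑ ∂π (h ω) ∂P :=
        lintegral_mono fun ω => enorm_integral_le_lintegral_enorm _
    _ = ∫⁻ ω, ∫⁻ c, ∫⁻ z, ‖ev z c‖ₑ ∂π (h ω) ∂Q (h ω) ∂P := hQ.lintegral_eq _ hm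
    _ ≤ ∫⁻ ω, ENNReal.ofReal (1 + (C + B)) ∂P := lintegral_mono fun ω => by
        have := hQ.prob (h ω)
        have := hπp (h ω)
        rw [lintegral_lintegral_swap hev.enorm.aemeasurable]
        refine (lintegral_mono fun z => h1 (h ω) z).trans ?_
        simp
    _ < ∞ := by simp

theorem integral_mean_ae_eq_condExp [IsProbabilityMeasure P] (hh : Measurable h)
    (hQ : IsPosterior P T h Q) (hev : Measurable fun p : 𝒞 × Z => ev p.2 p.1)
    (hgp : ∀ a, IsGP ev (Q a) (m a) (k a)) {C : ℝ} (hC : ∀ a z, k a z z ≤ C)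
    (hm : ∀ a, Measurable (m a)) {π : ℋ → Measure Z} (hπ : Measurable π)
    (hπp : ∀ a, IsProbabilityMeasure (π a)) (hmi : ∀ a, Integrable (m a) (π a))
    (hi : Integrable (fun ω => ∫ z, ev z (T ω) ∂π (h ω)) P) :
    (fun ω => ∫ z, m (h ω) z ∂π (h ω)) =ᵐ[P]
      P[fun ω => ∫ z, ev z (T ω) ∂π (h ω) | mℋ.comap h] := by
  have h1 := hQ.integral_ae_eq_condExp hh (measurable_integral_eval hev hπ hπp) hi
  refine Eq.eventuallyEq ?_ |>.trans h1
  ext ω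
  exact ((hgp (h ω)).integral_integral_eval hev (hC _) (hm _) (π (h ω)) (hmi _)).symm

/-- The conditional variance of a difference of integrals of the Gaussian process. -/
def varIntegralSub (k : Z → Z → ℝ) (π₁ π₂ : Measure Z) : ℝ :=
  ∫ z', (∫ z, k z' z ∂π₁ - ∫ z, k z' z ∂π₂) ∂π₁ - ∫ z', (∫ z, k z' z ∂π₁ - ∫ z, k z' z ∂π₂) ∂π₂

variable {π₁ π₂ : ℋ → Measure Z}

/-- No measurability of m in the past is assumed; it is gained by writing the integrated mean as a
conditional integral of the path. -/
theorem measurable_integral_mean (hQ : IsPosterior P T h Q)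
    (hev : Measurable fun p : 𝒞 × Z => ev p.2 p.1)
    (hgp : ∀ a, IsGP ev (Q a) (m a) (k a)) {C : ℝ} (hC : ∀ a z, k a z z ≤ C)
    (hm : ∀ a, Measurable (m a)) {π : ℋ → Measure Z} (hπ : Measurable π)
    (hπp : ∀ a, IsProbabilityMeasure (π a)) (hmi : ∀ a, Integrable (m a) (π a)) :
    Measurable fun a => ∫ z, m a z ∂π a := by
  have h1 := stronglyMeasurable_integral_of_prob hQ.measurable hQ.prob
    (measurable_integral_eval hev hπ hπp)
  convert h1.measurable using 2 with a
  exact ((hgp a).integral_integral_eval hev (hC _) (hm _) (π a) (hmi _)).symm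

theorem measurable_sq_deviation (hQ : IsPosterior P T h Q)
    (hev : Measurable fun p : 𝒞 × Z => ev p.2 p.1)
    (hgp : ∀ a, IsGP ev (Q a) (m a) (k a)) {C : ℝ} (hC : ∀ a z, k a z z ≤ C)
    (hm : ∀ a, Measurable (m a)) (hπ₁ : Measurable π₁) (hπ₂ : Measurable π₂)
    (hp₁ : ∀ a, IsProbabilityMeasure (π₁ a)) (hp₂ : ∀ a, IsProbabilityMeasure (π₂ a))
    (hi₁ : ∀ a, Integrable (m a) (π₁ a)) (hi₂ : ∀ a, Integrable (m a) (π₂ a)) :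
    Measurable fun p : 𝒞 × ℋ => ENNReal.ofReal
      (((∫ z, ev z p.1 ∂π₁ p.2 - ∫ z, ev z p.1 ∂π₂ p.2) -
        (∫ z, m p.2 z ∂π₁ p.2 - ∫ z, m p.2 z ∂π₂ p.2)) ^ 2) := by
  have h1 := measurable_integral_eval hev hπ₁ hp₁
  have h2 := measurable_integral_eval hev hπ₂ hp₂
  have h3 := hQ.measurable_integral_mean hev hgp hC hm hπ₁ hp₁ hi₁
  have h4 := hQ.measurable_integral_mean hev hgp hC hm hπ₂ hp₂ hi₂
  exact (((h1.sub h2).sub ((h3.comp measurable_snd).sub (h4.comp measurable_snd))).pow_const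
    2).ennreal_ofReal

theorem measurable_varIntegralSub (hQ : IsPosterior P T h Q)
    (hev : Measurable fun p : 𝒞 × Z => ev p.2 p.1)
    (hgp : ∀ a, IsGP ev (Q a) (m a) (k a)) {C : ℝ} (hC : ∀ a z, k a z z ≤ C)
    (hm : ∀ a, Measurable (m a)) (hπ₁ : Measurable π₁) (hπ₂ : Measurable π₂)
    (hp₁ : ∀ a, IsProbabilityMeasure (π₁ a)) (hp₂ : ∀ a, IsProbabilityMeasure (π₂ a))
    (hi₁ : ∀ a, Integrable (m a) (π₁ a)) (hi₂ : ∀ a, Integrable (m a) (π₂ a)) :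
    Measurable fun a => ENNReal.ofReal (varIntegralSub (k a) (π₁ a) (π₂ a)) := by
  have h1 := measurable_lintegral_of_prob hQ.measurable hQ.prob
    (Φ := fun c a => ENNReal.ofReal (((∫ z, ev z c ∂π₁ a - ∫ z, ev z c ∂π₂ a) -
        (∫ z, m a z ∂π₁ a - ∫ z, m a z ∂π₂ a)) ^ 2))
    (hQ.measurable_sq_deviation hev hgp hC hm hπ₁ hπ₂ hp₁ hp₂ hi₁ hi₂)
  convert h1 using 2 with a
  exact ((hgp a).lintegral_sq_integral_sub hev (hC a) (hm a) _ _ (hi₁ a) (hi₂ a)).symm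

/-- The disintegration is tested with the indicator of S. This says that the variance is the
conditional expectation of the squared error, in the form required by
`ae_liminf_eq_zero_of_tendsto_zero`. -/
theorem setLIntegral_sq_deviation (hh : Measurable h) (hQ : IsPosterior P T h Q)
    (hev : Measurable fun p : 𝒞 × Z => ev p.2 p.1)
    (hgp : ∀ a, IsGP ev (Q a) (m a) (k a)) {C : ℝ} (hC : ∀ a z, k a z z ≤ C)
    (hm : ∀ a, Measurable (m a)) (hπ₁ : Measurable π₁) (hπ₂ : Measurable π₂)
    (hp₁ : ∀ a, IsProbabilityMeasure (π₁ a)) (hp₂ : ∀ a, IsProbabilityMeasure (π₂ a))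
    (hi₁ : ∀ a, Integrable (m a) (π₁ a)) (hi₂ : ∀ a, Integrable (m a) (π₂ a))
    {S : Set ℋ} (hS : MeasurableSet S) :
    ∫⁻ ω in h ⁻¹' S, ENNReal.ofReal
        (((∫ z, ev z (T ω) ∂π₁ (h ω) - ∫ z, ev z (T ω) ∂π₂ (h ω)) -
          (∫ z, m (h ω) z ∂π₁ (h ω) - ∫ z, m (h ω) z ∂π₂ (h ω))) ^ 2) ∂P =
      ∫⁻ ω in h ⁻¹' S, ENNReal.ofReal (varIntegralSub (k (h ω)) (π₁ (h ω)) (π₂ (h ω))) ∂P := by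
  set Φ : 𝒞 × ℋ → ℝ≥0∞ := fun p => ENNReal.ofReal
      (((∫ z, ev z p.1 ∂π₁ p.2 - ∫ z, ev z p.1 ∂π₂ p.2) -
        (∫ z, m p.2 z ∂π₁ p.2 - ∫ z, m p.2 z ∂π₂ p.2)) ^ 2) with hΦdef
  have hΦ : Measurable Φ := hQ.measurable_sq_deviation hev hgp hC hm hπ₁ hπ₂ hp₁ hp₂ hi₁ hi₂
  have h1 := hQ.lintegral_eq ((Prod.snd ⁻¹' S : Set (𝒞 × ℋ)).indicator Φ)
    (hΦ.indicator (measurable_snd hS))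
  rw [← lintegral_indicator (hh hS), ← lintegral_indicator (hh hS)]
  convert h1 using 2 with ω ω
  · ext ω
    by_cases hω : h ω ∈ S <;> simp [Set.indicator, hω, hΦdef]
  · ext ω
    by_cases hω : h ω ∈ S
    · simp only [Set.indicator, Set.mem_preimage, hω, if_true]
      exact ((hgp (h ω)).lintegral_sq_integral_sub hev (hC _) (hm _) _ _ (hi₁ _) (hi₂ _)).symm
    · simp [Set.indicator, hω]

end IsPosterior

/-! ### Continuity, bounds and measurability of the two posteriors. -/

section Posterior

variable {D J Ns : ℕ} {X : Finset (EuclideanSpace ℝ (Fin D))}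
  {A : Set (EuclideanSpace ℝ (Fin J))} {ℛ : Type*} [MeasurableSpace ℛ]

namespace Setup

variable (M : Setup X A Ns ℛ)

theorem continuous_kvec (F : SimData X A) : Continuous (M.kvec F) :=
  continuous_pi fun _ => M.k0_continuous.comp (continuous_id.prodMk continuous_const)

theorem continuous_postMean (F : SimData X A) : Continuous (M.postMean F) :=
  M.mu0_continuous.add ((M.continuous_kvec F).dotProduct continuous_const)

theorem continuous_postCov (F : SimData X A) : Continuous (Function.uncurry (M.postCov F)) :=
  M.k0_continuous.sub (((M.continuous_kvec F).comp continuous_fst).dotProduct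
    (continuous_const.matrix_mulVec ((M.continuous_kvec F).comp continuous_snd)))

theorem continuous_postCov_left (F : SimData X A) (z : X × A) :
    Continuous fun z' => M.postCov F z' z :=
  (M.continuous_postCov F).comp (continuous_id.prodMk continuous_const)

theorem postMean_nil : M.postMean [] = M.mu0 := by ext; simp [postMean, dotProduct, kvec]

theorem postCov_nil : M.postCov [] = M.k0 := by ext; simp [postCov, dotProduct, kvec]

variable {M}

/-- Each observation subtracts a square over a positive number from the variance. -/
theorem postCov_diag_le {𝒞 : Type*} [MeasurableSpace 𝒞] {ev : X × A → 𝒞 → ℝ}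
    (hev : ∀ z, Measurable (ev z)) {ν : Measure 𝒞} (h : IsGP ev ν M.mu0 M.k0) (F : SimData X A)
    (w : X × A) : M.postCov F w w ≤ M.k0 w w := by
  induction F with
  | nil => rw [postCov_nil]
  | cons d F ih =>
    have hF := M.isGP_gpMeasure hev h F
    have hz : 0 < M.postCov F d.1 d.1 + M.noiseVar :=
      add_pos_of_nonneg_of_pos (hF.diag_nonneg d.1) M.noiseVar_pos
    have h1 := M.postCov_cons h.symm h.psd F d.1 w w d.2 hz.ne'
    rw [hF.symm d.1 w] at h1
    have h2 : 0 ≤ M.postCov F w d.1 / (M.postCov F d.1 d.1 + M.noiseVar) * M.postCov F w d.1 := by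
      rw [div_mul_eq_mul_div]
      exact div_nonneg (mul_self_nonneg _) hz.le
    change M.postCov ((d.1, d.2) :: F) w w ≤ _
    linarith

variable (M)

theorem exists_k0_diag_le [CompactSpace A] : ∃ C, ∀ z, M.k0 z z ≤ C := by
  have hc : Continuous fun z => M.k0 z z :=
    M.k0_continuous.comp (continuous_id.prodMk continuous_id)
  obtain ⟨C, hC⟩ := isCompact_univ.bddAbove_image hc.continuousOn
  exact ⟨C, fun z => hC ⟨z, trivial, rfl⟩⟩

theorem exists_mu0_sq_le [CompactSpace A] : ∃ B, ∀ z, M.mu0 z ^ 2 ≤ B := by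
  obtain ⟨C, hC⟩ := isCompact_univ.bddAbove_image (M.mu0_continuous.pow 2).continuousOn
  exact ⟨C, fun z => hC ⟨z, trivial, rfl⟩⟩

theorem likelihood_cons (d : Fin Ns × ℛ) (R : SrcData Ns ℛ) (a : A) :
    M.likelihood (d :: R) a = M.dens d.1 a d.2 * M.likelihood R a := by
  simp [likelihood]

theorem likelihood_pos (R : SrcData Ns ℛ) (a : A) : 0 < M.likelihood R a := by
  induction R with
  | nil => simp [likelihood]
  | cons d R ih =>
    rw [likelihood_cons]
    exact mul_pos (M.dens_pos _ _ _) ih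

theorem continuous_likelihood (R : SrcData Ns ℛ) : Continuous (M.likelihood R) := by
  induction R with
  | nil =>
    have : M.likelihood [] = fun _ => 1 := by ext; simp [likelihood]
    rw [this]
    exact continuous_const
  | cons d R ih =>
    have : M.likelihood (d :: R) = fun a => M.dens d.1 a d.2 * M.likelihood R a :=
      funext fun a => M.likelihood_cons d R a
    rw [this]
    exact (M.dens_continuous _ _).mul ih

theorem lintegral_likelihood_ne_zero (R : SrcData Ns ℛ) :
    ∫⁻ a, ENNReal.ofReal (M.likelihood R a) ∂M.prior ≠ 0 := by
  have := M.prior_prob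
  rw [Ne, lintegral_eq_zero_iff (M.continuous_likelihood R).measurable.ennreal_ofReal]
  intro h
  obtain ⟨a, ha⟩ := h.exists
  exact (ENNReal.ofReal_pos.2 (M.likelihood_pos R a)).ne' ha

theorem lintegral_likelihood_ne_top [CompactSpace A] (R : SrcData Ns ℛ) :
    ∫⁻ a, ENNReal.ofReal (M.likelihood R a) ∂M.prior ≠ ∞ := by
  have := M.prior_prob
  obtain ⟨C, hC⟩ := isCompact_univ.bddAbove_image (M.continuous_likelihood R).continuousOn
  have h1 : ∀ a, ENNReal.ofReal (M.likelihood R a) ≤ ENNReal.ofReal C := fun a =>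
    ENNReal.ofReal_le_ofReal (hC ⟨a, trivial, rfl⟩)
  refine ne_top_of_le_ne_top ?_ (lintegral_mono h1)
  simp

theorem posterior_apply (R : SrcData Ns ℛ) {S : Set A} (hS : MeasurableSet S) :
    M.posterior R S = (∫⁻ a, ENNReal.ofReal (M.likelihood R a) ∂M.prior)⁻¹ *
      ∫⁻ a in S, ENNReal.ofReal (M.likelihood R a) ∂M.prior := by
  rw [posterior, Measure.smul_apply, withDensity_apply _ hS, smul_eq_mul]

theorem isProbabilityMeasure_posterior [CompactSpace A] (R : SrcData Ns ℛ) :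
    IsProbabilityMeasure (M.posterior R) := by
  refine ⟨?_⟩
  rw [posterior_apply _ _ MeasurableSet.univ, setLIntegral_univ]
  exact ENNReal.inv_mul_cancel (M.lintegral_likelihood_ne_zero R) (M.lintegral_likelihood_ne_top R)

end Setup

variable {Ω : Type*}

/-- The source data in which the sources `l` are queried, the last one first. -/
def srcList (ρ : Fin Ns → ℕ → Ω → ℛ) : List (Fin Ns) → Ω → SrcData Ns ℛ
  | [], _ => []
  | s :: l, ω => (s, ρ s (l.countP fun s' => s' = s) ω) :: srcList ρ l ω

-- The adaptive choices enter the source data only through the list of queried sources. Such lists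
-- are countable, and for a fixed list the data are a function of the answers alone.
omit [MeasurableSpace ℛ] in
theorem srcData_eq_srcList (act : ℕ → Ω → Action X A Ns) (ρ : Fin Ns → ℕ → Ω → ℛ) (t : ℕ) (ω : Ω) :
    srcData act ρ t ω = srcList ρ ((srcData act ρ t ω).map Prod.fst) ω := by
  induction t with
  | zero => rfl
  | succ t ih =>
    rw [srcData]
    cases act t ω with
    | inl z => exact ih
    | inr s =>
      simp only [List.map_cons, srcList, ← ih, List.countP_map]
      rfl

variable (M : Setup X A Ns ℛ)

/-- Continuity in the parameter and measurability in the observation give joint measurability. -/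
theorem measurable_likelihood_srcList {m : MeasurableSpace Ω} {ρ : Fin Ns → ℕ → Ω → ℛ}
    (hρ : ∀ s k, Measurable (ρ s k)) (l : List (Fin Ns)) :
    Measurable fun p : A × Ω => M.likelihood (srcList ρ l p.2) p.1 := by
  induction l with
  | nil => simp only [srcList, Setup.likelihood, List.map_nil, List.prod_nil, measurable_const]
  | cons s l ih =>
    simp only [srcList, Setup.likelihood_cons]
    refine Measurable.mul ?_ ih
    have h1 : Measurable (Function.uncurry (M.dens s)) :=
      measurable_uncurry_of_continuous_of_measurable (M.dens_continuous s) (M.dens_measurable s)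
    exact h1.comp (measurable_fst.prodMk ((hρ _ _).comp measurable_snd))

theorem measurable_posterior_srcList {m : MeasurableSpace Ω} {ρ : Fin Ns → ℕ → Ω → ℛ}
    (hρ : ∀ s k, Measurable (ρ s k)) (l : List (Fin Ns)) :
    Measurable fun ω => M.posterior (srcList ρ l ω) := by
  have := M.prior_prob
  have h1 := (measurable_likelihood_srcList M hρ l).ennreal_ofReal
  refine Measure.measurable_of_measurable_coe _ fun S hS => ?_
  simp only [Setup.posterior_apply _ _ hS]
  exact h1.lintegral_prod_left'.inv.mul (h1.lintegral_prod_left' (μ := M.prior.restrict S))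

end Posterior

/-! ### Convergence of the predicted performance. -/

section Limits

variable {D J Ns : ℕ} {X : Finset (EuclideanSpace ℝ (Fin D))}
  {A : Set (EuclideanSpace ℝ (Fin J))} {ℛ : Type*} [MeasurableSpace ℛ]
  {Ω : Type*} {Ξ : Type*} [MeasurableSpace Ξ] {mΩ : MeasurableSpace Ω}
  {ξ : Ω → Ξ} {act : ℕ → Ω → Action X A Ns} {θ : X × A → Ω → ℝ} {ε : ℕ → Ω → ℝ}
  {ρ : Fin Ns → ℕ → Ω → ℛ} {M : Setup X A Ns ℛ} {astar : A} {P : Measure Ω}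

namespace IsRun

theorem measurable_eval_path [CompactSpace A] :
    Measurable fun p : C(X × A, ℝ) × (X × A) => p.1 p.2 :=
  ContinuousEval.continuous_eval.measurable

theorem isGP_gpMeasure_path [CompactSpace A] (hrun : IsRun M astar P ξ θ ε ρ act)
    (F : SimData X A) :
    IsGP (fun z (c : C(X × A, ℝ)) => c z) (M.gpMeasure (fun z c => c z) (P.map hrun.path) F)
      (M.postMean F) (M.postCov F) :=
  M.isGP_gpMeasure measurable_eval_continuousMap hrun.isGP_path F

theorem postCov_diag_le [CompactSpace A] (hrun : IsRun M astar P ξ θ ε ρ act)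
    (F : SimData X A) (z : X × A) : M.postCov F z z ≤ M.k0 z z :=
  Setup.postCov_diag_le measurable_eval_continuousMap hrun.isGP_path F z

theorem integrable_postMean [CompactSpace A] (F : SimData X A) (π : Measure (X × A))
    [IsProbabilityMeasure π] : Integrable (M.postMean F) π :=
  (M.continuous_postMean F).integrable_of_hasCompactSupport (HasCompactSupport.of_compactSpace _)

theorem integrable_integral_path [CompactSpace A] [IsProbabilityMeasure P]
    (hrun : IsRun M astar P ξ θ ε ρ act) {π : Ω → Measure (X × A)}
    (hπ : Measurable[past ξ act θ ε ρ 0] π) (hπp : ∀ ω, IsProbabilityMeasure (π ω)) :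
    Integrable (fun ω => ∫ z, hrun.path ω z ∂π ω) P := by
  obtain ⟨B, hB⟩ := M.exists_mu0_sq_le
  obtain ⟨C, hC⟩ := M.exists_k0_diag_le
  exact IsPosterior.integrable_integral_eval (mℋ := past ξ act θ ε ρ 0) (h := id)
    (hrun.measurable_path hrun.theta_measurable) (measurable_id.mono (hrun.past_le 0) le_rfl)
    (hrun.isPosterior_gpMeasure 0) measurable_eval_path (fun ω => hrun.isGP_gpMeasure_path _)
    (fun ω z => by simpa only [simData, M.postMean_nil] using hB z)
    (fun ω z => (hrun.postCov_diag_le _ z).trans (hC z)) hπ hπp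

/-- The weights π are already known at time 0, so one and the same random variable is conditioned
for every t: the integrated posterior means form a closed martingale. -/
theorem integral_postMean_ae_eq_condExp [CompactSpace A] [IsProbabilityMeasure P]
    (hrun : IsRun M astar P ξ θ ε ρ act) {π : Ω → Measure (X × A)}
    (hπ : Measurable[past ξ act θ ε ρ 0] π) (hπp : ∀ ω, IsProbabilityMeasure (π ω)) (t : ℕ) :
    (fun ω => ∫ z, M.postMean (simData act θ ε t ω) z ∂π ω) =ᵐ[P]
      P[fun ω => ∫ z, hrun.path ω z ∂π ω | past ξ act θ ε ρ t] := by
  obtain ⟨C, hC⟩ := M.exists_k0_diag_le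
  have h1 := IsPosterior.integral_mean_ae_eq_condExp (mℋ := past ξ act θ ε ρ t) (h := id)
    (measurable_id.mono (hrun.past_le t) le_rfl)
    (hrun.isPosterior_gpMeasure t) measurable_eval_path (fun ω => hrun.isGP_gpMeasure_path _)
    (fun ω z => (hrun.postCov_diag_le _ z).trans (hC z))
    (fun ω => (M.continuous_postMean _).measurable)
    (hπ.mono (past_mono (Nat.zero_le t)) le_rfl) hπp
    (fun ω => integrable_postMean _ _) (hrun.integrable_integral_path hπ hπp)
  rwa [MeasurableSpace.comap_id] at h1

theorem ae_exists_tendsto_integral_postMean [CompactSpace A] [IsProbabilityMeasure P]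
    (hrun : IsRun M astar P ξ θ ε ρ act) {π : Ω → Measure (X × A)}
    (hπ : Measurable[past ξ act θ ε ρ 0] π) (hπp : ∀ ω, IsProbabilityMeasure (π ω)) :
    ∀ᵐ ω ∂P, ∃ g, Tendsto (fun t => ∫ z, M.postMean (simData act θ ε t ω) z ∂π ω) atTop (𝓝 g) := by
  let ℱ : Filtration ℕ mΩ := ⟨past ξ act θ ε ρ, past_mono, hrun.past_le⟩
  have h1 := tendsto_ae_condExp (μ := P) (ℱ := ℱ) fun ω => ∫ z, hrun.path ω z ∂π ω
  have h2 := ae_all_iff.2 fun t => hrun.integral_postMean_ae_eq_condExp hπ hπp t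
  filter_upwards [h1, h2] with ω h3 h4
  exact ⟨_, h3.congr fun t => (h4 t).symm⟩

/-- Vanishing conditional variance only yields a subsequence of small errors; martingale convergence
of the posterior means upgrades it to the whole sequence. -/
theorem ae_tendsto_integral_postMean_sub [CompactSpace A] [IsProbabilityMeasure P]
    (hrun : IsRun M astar P ξ θ ε ρ act) {π₁ π₂ : Ω → Measure (X × A)}
    (hπ₁ : Measurable[past ξ act θ ε ρ 0] π₁) (hπ₂ : Measurable[past ξ act θ ε ρ 0] π₂)
    (hp₁ : ∀ ω, IsProbabilityMeasure (π₁ ω)) (hp₂ : ∀ ω, IsProbabilityMeasure (π₂ ω)) :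
    ∀ᵐ ω ∂P, Tendsto (fun t => IsPosterior.varIntegralSub (M.postCov (simData act θ ε t ω))
        (π₁ ω) (π₂ ω)) atTop (𝓝 0) →
      Tendsto (fun t => ∫ z, M.postMean (simData act θ ε t ω) z ∂π₁ ω -
        ∫ z, M.postMean (simData act θ ε t ω) z ∂π₂ ω) atTop
        (𝓝 (∫ z, θ z ω ∂π₁ ω - ∫ z, θ z ω ∂π₂ ω)) := by
  obtain ⟨C, hC⟩ := M.exists_k0_diag_le
  have hpath := hrun.measurable_path hrun.theta_measurable
  have hm₁ : ∀ t, Measurable[past ξ act θ ε ρ t] π₁ := fun t =>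
    hπ₁.mono (past_mono (Nat.zero_le t)) le_rfl
  have hm₂ : ∀ t, Measurable[past ξ act θ ε ρ t] π₂ := fun t =>
    hπ₂.mono (past_mono (Nat.zero_le t)) le_rfl
  have hU := fun t => IsPosterior.measurable_sq_deviation (mℋ := past ξ act θ ε ρ t)
    (hrun.isPosterior_gpMeasure t) measurable_eval_path (fun ω => hrun.isGP_gpMeasure_path _)
    (fun ω z => (hrun.postCov_diag_le _ z).trans (hC z))
    (fun ω => (M.continuous_postMean _).measurable) (hm₁ t) (hm₂ t) hp₁ hp₂
    (fun ω => integrable_postMean _ _) (fun ω => integrable_postMean _ _)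
  have hV := fun t => IsPosterior.measurable_varIntegralSub (mℋ := past ξ act θ ε ρ t)
    (hrun.isPosterior_gpMeasure t) measurable_eval_path (fun ω => hrun.isGP_gpMeasure_path _)
    (fun ω z => (hrun.postCov_diag_le _ z).trans (hC z))
    (fun ω => (M.continuous_postMean _).measurable) (hm₁ t) (hm₂ t) hp₁ hp₂
    (fun ω => integrable_postMean _ _) (fun ω => integrable_postMean _ _)
  have hUV := fun t (S : Set Ω) (hS : MeasurableSet[past ξ act θ ε ρ t] S) =>
    IsPosterior.setLIntegral_sq_deviation (mℋ := past ξ act θ ε ρ t) (h := id)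
    (measurable_id.mono (hrun.past_le t) le_rfl)
    (hrun.isPosterior_gpMeasure t) measurable_eval_path (fun ω => hrun.isGP_gpMeasure_path _)
    (fun ω z => (hrun.postCov_diag_le _ z).trans (hC z))
    (fun ω => (M.continuous_postMean _).measurable) (hm₁ t) (hm₂ t) hp₁ hp₂
    (fun ω => integrable_postMean _ _) (fun ω => integrable_postMean _ _) hS
  have h1 := ae_liminf_eq_zero_of_tendsto_zero (P := P)
    (U := fun t ω => ENNReal.ofReal
      (((∫ z, hrun.path ω z ∂π₁ ω - ∫ z, hrun.path ω z ∂π₂ ω) -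
        (∫ z, M.postMean (simData act θ ε t ω) z ∂π₁ ω -
          ∫ z, M.postMean (simData act θ ε t ω) z ∂π₂ ω)) ^ 2))
    (V := fun t ω => ENNReal.ofReal (IsPosterior.varIntegralSub
      (M.postCov (simData act θ ε t ω)) (π₁ ω) (π₂ ω)))
    (fun t => (hU t).comp (hpath.prodMk (measurable_id.mono (hrun.past_le t) le_rfl)))
    (fun t => (hV t).mono (hrun.past_le t) le_rfl)
    (fun t δ => hUV t _ (hV t (measurableSet_Iic (a := δ))))
  filter_upwards [h1, hrun.ae_exists_tendsto_integral_postMean hπ₁ hp₁,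
    hrun.ae_exists_tendsto_integral_postMean hπ₂ hp₂] with ω h2 ⟨g₁, hg₁⟩ ⟨g₂, hg₂⟩ hv
  have h3 := h2 (by simpa using ENNReal.tendsto_ofReal hv)
  have h4 := hg₁.sub hg₂
  set d := ∫ z, hrun.path ω z ∂π₁ ω - ∫ z, hrun.path ω z ∂π₂ ω with hd
  have h5 := ENNReal.tendsto_ofReal (((tendsto_const_nhds (x := d)).sub h4).pow 2)
  rw [h5.liminf_eq, ENNReal.ofReal_eq_zero] at h3
  have h6 : d = g₁ - g₂ :=
    sub_eq_zero.1 ((pow_eq_zero_iff two_ne_zero).1 (le_antisymm h3 (sq_nonneg _)))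
  rw [← h6] at h4
  exact h4

end IsRun

/-- The law of `(x, a)` if `a` has law `π`. -/
def atPoint (x : X) (π : Measure A) : Measure (X × A) := π.map fun a => (x, a)

theorem measurable_atPoint (x : X) : Measurable (atPoint x : Measure A → Measure (X × A)) :=
  Measure.measurable_map _ measurable_prodMk_left

theorem isProbabilityMeasure_atPoint (x : X) (π : Measure A) [IsProbabilityMeasure π] :
    IsProbabilityMeasure (atPoint x π) :=
  Measure.isProbabilityMeasure_map measurable_prodMk_left.aemeasurable

theorem integral_atPoint (x : X) (π : Measure A) {f : X × A → ℝ} (hf : Measurable f) :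
    ∫ z, f z ∂atPoint x π = ∫ a, f (x, a) ∂π :=
  integral_map measurable_prodMk_left.aemeasurable hf.aestronglyMeasurable

/-- Almost surely, for all source data and solutions, the predicted performance converges, and
differences converge to differences of the true performance once the conditional variance of the
difference vanishes. -/
theorem IsRun.ae_tendsto_G [CompactSpace A] [IsProbabilityMeasure P]
    (hrun : IsRun M astar P ξ θ ε ρ act) :
    ∀ᵐ ω ∂P, ∀ T : ℕ,
      (∀ x, ∃ g, Tendsto (fun t => M.G (srcData act ρ T ω) (simData act θ ε t ω) x) atTop (𝓝 g)) ∧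
      ∀ x x', Tendsto (fun t => IsPosterior.varIntegralSub (M.postCov (simData act θ ε t ω))
          (atPoint x (M.posterior (srcData act ρ T ω)))
          (atPoint x' (M.posterior (srcData act ρ T ω)))) atTop (𝓝 0) →
        Tendsto (fun t => M.G (srcData act ρ T ω) (simData act θ ε t ω) x -
            M.G (srcData act ρ T ω) (simData act θ ε t ω) x') atTop
          (𝓝 (∫ a, θ (x, a) ω ∂M.posterior (srcData act ρ T ω) -
            ∫ a, θ (x', a) ω ∂M.posterior (srcData act ρ T ω))) := by
  have hm : ∀ (l : List (Fin Ns)) (x : X), Measurable[past ξ act θ ε ρ 0] fun ω =>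
      atPoint x (M.posterior (srcList ρ l ω)) := fun l x =>
    (measurable_atPoint x).comp (measurable_posterior_srcList M
      (fun s k => measurable_source_past s k 0) l)
  have hp : ∀ (l : List (Fin Ns)) (x : X) (ω : Ω),
      IsProbabilityMeasure (atPoint x (M.posterior (srcList ρ l ω))) := fun l x ω => by
    have := M.isProbabilityMeasure_posterior (srcList ρ l ω)
    exact isProbabilityMeasure_atPoint x _
  -- The null sets are united over the countably many lists before specialising to the random list
  -- of the run.
  have h1 : ∀ᵐ ω ∂P, ∀ l x, _ := ae_all_iff.2 fun l => ae_all_iff.2 fun x =>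
    hrun.ae_exists_tendsto_integral_postMean (hm l x) (hp l x)
  have h2 : ∀ᵐ ω ∂P, ∀ l x x', _ := ae_all_iff.2 fun l => ae_all_iff.2 fun x => ae_all_iff.2
    fun x' => hrun.ae_tendsto_integral_postMean_sub (hm l x) (hm l x') (hp l x) (hp l x')
  filter_upwards [h1, h2] with ω h1 h2 T
  have h3 := h1 ((srcData act ρ T ω).map Prod.fst)
  have h4 := h2 ((srcData act ρ T ω).map Prod.fst)
  simp only [← srcData_eq_srcList] at h3 h4
  simp only [integral_atPoint _ _ (M.continuous_postMean _).measurable,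
    integral_atPoint _ _ (hrun.theta_continuous ω).measurable] at h3 h4
  exact ⟨h3, h4⟩

end Limits

/-! ### Expected gain of a maximum of affine functions of a Gaussian variable. -/

section ExpectedMaximum

/-- The expected positive part of a centered Gaussian variable with standard deviation `τ`, shifted
down by `B`. -/
def expectedExcess (B τ : ℝ) : ℝ := ∫ u, max (τ * u - B) 0 ∂gaussianReal 0 1

theorem integrable_excess (B τ : ℝ) :
    Integrable (fun u => max (τ * u - B) 0) (gaussianReal 0 1) := by
  have h1 : Integrable (fun u : ℝ => u) (gaussianReal 0 1) :=
    (memLp_id_gaussianReal 1).integrable le_rfl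
  exact ((h1.const_mul τ).sub (integrable_const B)).pos_part

theorem expectedExcess_neg (B τ : ℝ) : expectedExcess B (-τ) = expectedExcess B τ := by
  have h : (gaussianReal 0 1).map (fun u => -u) = gaussianReal 0 1 := by
    rw [gaussianReal_map_neg, neg_zero]
  have hc : Continuous fun u : ℝ => max (-τ * u - B) 0 := by fun_prop
  unfold expectedExcess
  conv_lhs => rw [← h]
  rw [integral_map measurable_neg.aemeasurable hc.aestronglyMeasurable]
  simp

theorem expectedExcess_abs (B τ : ℝ) : expectedExcess B |τ| = expectedExcess B τ := by
  rcases abs_choice τ with h | h <;> rw [h]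
  exact expectedExcess_neg B τ

/-- Monotone pointwise: for u < 0 and B ≥ 0 the excess vanishes for all nonnegative slopes, and for
u ≥ 0 it grows with the slope. -/
theorem expectedExcess_mono {B δ τ : ℝ} (hB : 0 ≤ B) (hδ : 0 ≤ δ) (h : δ ≤ τ) :
    expectedExcess B δ ≤ expectedExcess B τ := by
  refine integral_mono (integrable_excess B δ) (integrable_excess B τ) fun u => ?_
  rcases le_or_gt 0 u with hu | hu
  · have := mul_le_mul_of_nonneg_right h hu
    exact max_le_max (by linarith) le_rfl
  · exact (max_le (by nlinarith) le_rfl : max (δ * u - B) 0 ≤ 0).trans (le_max_right _ _)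

theorem expectedExcess_pos (B : ℝ) {δ : ℝ} (hδ : 0 < δ) : 0 < expectedExcess B δ := by
  have hc : Continuous fun u : ℝ => max (δ * u - B) 0 := by fun_prop
  have h1 : (0 : ℝ → ℝ) ≤ fun u => max (δ * u - B) 0 := fun u => le_max_right _ _
  refine (integral_pos_iff_support_of_nonneg h1 (integrable_excess B δ)).2 ?_
  have hsub : Set.Ioi (B / δ) ⊆ Function.support fun u : ℝ => max (δ * u - B) 0 := fun u hu => by
    have : B < δ * u := by
      rw [mul_comm]
      exact (div_lt_iff₀ hδ).1 hu
    exact (lt_max_of_lt_left (by linarith)).ne'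
  refine lt_of_lt_of_le ?_ (measure_mono hsub)
  refine pos_iff_ne_zero.2 fun h => ?_
  have := gaussianReal_absolutelyContinuous' 0 one_ne_zero h
  simp at this

/-- The excess is even and monotone in the slope, so slopes of size at least δ keep it above its
positive value at δ. -/
theorem tendsto_zero_of_tendsto_expectedExcess {B : ℝ} (hB : 0 ≤ B) {τ : ℕ → ℝ}
    (h : Tendsto (fun t => expectedExcess B (τ t)) atTop (𝓝 0)) : Tendsto τ atTop (𝓝 0) := by
  rw [Metric.tendsto_atTop']
  intro δ hδ
  obtain ⟨N, hN⟩ := eventually_atTop.1 (h.eventually_lt_const (expectedExcess_pos B hδ))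
  refine ⟨N, fun n hn => ?_⟩
  rw [dist_zero_right, Real.norm_eq_abs]
  by_contra! hc
  have h1 := expectedExcess_mono hB hδ.le hc
  rw [expectedExcess_abs] at h1
  exact (hN n hn.le).not_ge h1

variable {X : Type*} [Finite X]

theorem measurable_ciSup_affine (g κ : X → ℝ) : Measurable fun u : ℝ => ⨆ x, (g x + κ x * u) :=
  Measurable.iSup fun x => by fun_prop

variable [Nonempty X]

theorem abs_ciSup_add_sub_ciSup_le (g d : X → ℝ) {b : ℝ} (hb : ∀ x, |d x| ≤ b) :
    |(⨆ x, (g x + d x)) - ⨆ x, g x| ≤ b := by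
  rw [abs_sub_le_iff]
  constructor
  · rw [sub_le_iff_le_add]
    refine ciSup_le fun x => ?_
    have := le_ciSup (Finite.bddAbove_range g) x
    have := (abs_le.1 (hb x)).2
    linarith
  · rw [sub_le_iff_le_add]
    refine ciSup_le fun x => ?_
    have := le_ciSup (Finite.bddAbove_range fun x => g x + d x) x
    have := (abs_le.1 (hb x)).1
    linarith

theorem integrable_ciSup_affine (g κ : X → ℝ) :
    Integrable (fun u => (⨆ x, (g x + κ x * u)) - ⨆ x, g x) (gaussianReal 0 1) := by
  obtain ⟨x₀, hx₀⟩ := Finite.exists_max fun x => |κ x|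
  have h1 : Integrable (fun u : ℝ => u) (gaussianReal 0 1) :=
    (memLp_id_gaussianReal 1).integrable le_rfl
  refine (h1.abs.const_mul |κ x₀|).mono'
    ((measurable_ciSup_affine g κ).sub_const _).aestronglyMeasurable (ae_of_all _ fun u => ?_)
  refine abs_ciSup_add_sub_ciSup_le _ _ fun x => ?_
  rw [abs_mul]
  exact mul_le_mul_of_nonneg_right (hx₀ x) (abs_nonneg _)

/-- The expected gain of a maximum of affine functions of a standard Gaussian variable. -/
theorem expectedExcess_le_integral_ciSup (g κ : X → ℝ) {x₀ x₁ : X} (h₀ : ∀ x, g x ≤ g x₀) {B : ℝ}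
    (hB : g x₀ - g x₁ ≤ B) :
    expectedExcess B (κ x₁ - κ x₀) ≤
      ∫ u, ((⨆ x, (g x + κ x * u)) - ⨆ x, g x) ∂gaussianReal 0 1 := by
  have h1 : Integrable (fun u : ℝ => u) (gaussianReal 0 1) :=
    (memLp_id_gaussianReal 1).integrable le_rfl
  -- The maximum is compared with just two of its lines; relative to the line of `x₀` the other
  -- contributes a positive part, and the term linear in u has mean zero.
  have h2 : ∫ u, (κ x₀ * u + max ((κ x₁ - κ x₀) * u - B) 0) ∂gaussianReal 0 1 =
      expectedExcess B (κ x₁ - κ x₀) := by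
    rw [integral_add (h1.const_mul _) (integrable_excess _ _), integral_const_mul]
    simp [expectedExcess]
  rw [← h2]
  refine integral_mono ((h1.const_mul _).add (integrable_excess _ _))
    (integrable_ciSup_affine g κ) fun u => ?_
  have h3 := le_ciSup (Finite.bddAbove_range fun x => g x + κ x * u)
  have h4 : ⨆ x, g x ≤ g x₀ := ciSup_le h₀
  have h5 := h3 x₀
  have h6 := h3 x₁
  simp only at h5 h6 ⊢
  rcases le_total ((κ x₁ - κ x₀) * u - B) 0 with h | h
  · rw [max_eq_right h]
    linarith
  · rw [max_eq_left h]
    linarith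

end ExpectedMaximum

/-! ### From vanishing value of simulations to vanishing variance of differences. -/

section ValueOfInformation

variable {D J Ns : ℕ} {X : Finset (EuclideanSpace ℝ (Fin D))}
  {A : Set (EuclideanSpace ℝ (Fin J))} {ℛ : Type*} [MeasurableSpace ℛ]
  {Ω : Type*} {Ξ : Type*} [MeasurableSpace Ξ] {mΩ : MeasurableSpace Ω}
  {ξ : Ω → Ξ} {act : ℕ → Ω → Action X A Ns} {θ : X × A → Ω → ℝ} {ε : ℕ → Ω → ℝ}
  {ρ : Fin Ns → ℕ → Ω → ℛ} {M : Setup X A Ns ℛ} {astar : A} {P : Measure Ω}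

theorem gaussianReal_eq_map_standard (μ : ℝ) {v : ℝ} (hv : 0 ≤ v) :
    gaussianReal μ v.toNNReal = (gaussianReal 0 1).map fun u => Real.sqrt v * u + μ := by
  have h1 : (fun u => Real.sqrt v * u + μ) = (fun u => u + μ) ∘ fun u => Real.sqrt v * u := rfl
  rw [h1, ← Measure.map_map (measurable_add_const μ) (measurable_const_mul _),
    gaussianReal_map_const_mul, gaussianReal_map_add_const]
  congr 1
  · simp
  · ext
    simp [Real.sq_sqrt hv, hv]

/-- The posterior covariance of the predicted performance of `x` and the target function at `z`. -/
def Setup.crossCov (M : Setup X A Ns ℛ) (R : SrcData Ns ℛ) (F : SimData X A) (x : X) (z : X × A) :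
    ℝ :=
  ∫ a, M.postCov F (x, a) z ∂M.posterior R

namespace IsRun

theorem noise_add_pos [CompactSpace A] (hrun : IsRun M astar P ξ θ ε ρ act) (F : SimData X A)
    (z : X × A) : 0 < M.postCov F z z + M.noiseVar :=
  add_pos_of_nonneg_of_pos ((hrun.isGP_gpMeasure_path F).diag_nonneg z) M.noiseVar_pos

theorem G_cons [CompactSpace A] (hrun : IsRun M astar P ξ θ ε ρ act) (R : SrcData Ns ℛ)
    (F : SimData X A) (z : X × A) (y : ℝ) (x : X) :
    M.G R ((z, y) :: F) x = M.G R F x +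
      M.crossCov R F x z / (M.postCov F z z + M.noiseVar) * (y - M.postMean F z) := by
  have := M.isProbabilityMeasure_posterior R
  have hi : ∀ f : X × A → ℝ, Continuous f → Integrable (fun a => f (x, a)) (M.posterior R) :=
    fun f hf => (hf.comp (by fun_prop)).integrable_of_hasCompactSupport
      (HasCompactSupport.of_compactSpace _)
  have h := hrun.isGP_path
  simp only [Setup.G, Setup.crossCov,
    M.postMean_cons h.symm h.psd F z _ y (hrun.noise_add_pos F z).ne']
  rw [integral_add (hi _ (M.continuous_postMean F))
    (((hi _ (M.continuous_postCov_left F z)).div_const _).mul_const _), integral_mul_const,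
    integral_div]

/-- Standardising the predictive output divides the slope by its variance and multiplies it by its
standard deviation, which leaves `Real.sqrt` in the denominator. -/
theorem voiSim_eq [CompactSpace A] (hrun : IsRun M astar P ξ θ ε ρ act) (R : SrcData Ns ℛ)
    (F : SimData X A) (z : X × A) :
    M.voiSim R F z = (∫ u, ((⨆ x, (M.G R F x +
      M.crossCov R F x z / Real.sqrt (M.postCov F z z + M.noiseVar) * u)) - ⨆ x, M.G R F x)
        ∂gaussianReal 0 1) / M.costSim := by
  set v := M.postCov F z z + M.noiseVar with hv
  have hv0 : 0 < v := hrun.noise_add_pos F z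
  have hsq := Real.mul_self_sqrt hv0.le
  have hs0 := Real.sqrt_pos.2 hv0
  rw [Setup.voiSim, integral_div, ← hv, gaussianReal_eq_map_standard _ hv0.le, integral_map]
  · congr 2
    ext u
    simp only [Setup.Gstar, hrun.G_cons, ← hv]
    congr 2
    ext x
    rw [add_sub_cancel_right]
    congr 1
    field_simp
    rw [Real.sq_sqrt hv0.le]
  · fun_prop
  · simp only [Setup.Gstar, hrun.G_cons, ← hv]
    exact ((Measurable.iSup fun x => by fun_prop).sub_const _).aestronglyMeasurable

theorem abs_postCov_le [CompactSpace A] (hrun : IsRun M astar P ξ θ ε ρ act) {C : ℝ}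
    (hC : ∀ z, M.k0 z z ≤ C) (F : SimData X A) (z z' : X × A) : |M.postCov F z z'| ≤ C := by
  have h := hrun.isGP_gpMeasure_path F
  have h1 := h.sq_le z z'
  have h2 := (hrun.postCov_diag_le F z).trans (hC z)
  have h3 := (hrun.postCov_diag_le F z').trans (hC z')
  have h4 := h.diag_nonneg z
  have h5 := h.diag_nonneg z'
  refine abs_le_of_sq_le_sq (h1.trans ?_) (h4.trans h2)
  rw [sq]
  exact mul_le_mul h2 h3 h5 (h4.trans h2)

/-- Convergence of G bounds all its gaps by a constant, so the value of the simulation dominates, up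
to the cost, the expected excess of a slope difference over a fixed threshold. -/
theorem tendsto_crossCov_sub [CompactSpace A] (hX : X.Nonempty)
    (hrun : IsRun M astar P ξ θ ε ρ act) (R : SrcData Ns ℛ)
    {F : ℕ → SimData X A} {g : X → ℝ} (hg : ∀ x, Tendsto (fun t => M.G R (F t) x) atTop (𝓝 (g x)))
    (z : X × A) (hz : Tendsto (fun t => M.voiSim R (F t) z) atTop (𝓝 0)) (x x' : X) :
    Tendsto (fun t => M.crossCov R (F t) x z - M.crossCov R (F t) x' z) atTop (𝓝 0) := by
  have : Nonempty X := hX.to_subtype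
  obtain ⟨C, hC⟩ := M.exists_k0_diag_le
  have hb : ∀ x, ∃ b, ∀ t, |M.G R (F t) x| ≤ b := fun x => by
    obtain ⟨b, hb⟩ := (Metric.isBounded_range_of_tendsto _ (hg x)).exists_norm_le
    exact ⟨b, fun t => hb _ ⟨t, rfl⟩⟩
  choose b hb using hb
  obtain ⟨xb, hxb⟩ := Finite.exists_max b
  have hbt : ∀ t x, |M.G R (F t) x| ≤ b xb := fun t x => (hb x t).trans (hxb x)
  have hb0 : 0 ≤ b xb := (abs_nonneg _).trans (hbt 0 xb)
  choose x₀ hx₀ using fun t => Finite.exists_max fun x => M.G R (F t) x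
  set v : ℕ → ℝ := fun t => M.postCov (F t) z z + M.noiseVar with hv
  have hv0 : ∀ t, 0 < v t := fun t => hrun.noise_add_pos (F t) z
  have hvC : ∀ t, Real.sqrt (v t) ≤ Real.sqrt (C + M.noiseVar) := fun t =>
    Real.sqrt_le_sqrt (by
      have := (hrun.postCov_diag_le (F t) z).trans (hC z)
      simp only [hv]
      linarith)
  -- The lower bound compares with the current maximiser, which changes with t; it cancels in the
  -- difference of two such limits.
  have key : ∀ x, Tendsto (fun t => M.crossCov R (F t) x z - M.crossCov R (F t) (x₀ t) z) atTop
      (𝓝 0) := fun x => by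
    set τ : ℕ → ℝ := fun t => M.crossCov R (F t) x z / Real.sqrt (v t) -
      M.crossCov R (F t) (x₀ t) z / Real.sqrt (v t) with hτ
    have h1 : ∀ t, expectedExcess (2 * b xb) (τ t) ≤ M.costSim * M.voiSim R (F t) z := fun t => by
      rw [hrun.voiSim_eq, mul_div_cancel₀ _ M.costSim_pos.ne']
      refine expectedExcess_le_integral_ciSup (fun x => M.G R (F t) x)
        (fun x => M.crossCov R (F t) x z / Real.sqrt (v t)) (hx₀ t) ?_
      have h2 := (abs_le.1 (hbt t (x₀ t))).2
      have h3 := (abs_le.1 (hbt t x)).1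
      linarith
    have h2 : Tendsto τ atTop (𝓝 0) := by
      refine tendsto_zero_of_tendsto_expectedExcess (B := 2 * b xb) (by positivity) ?_
      refine squeeze_zero (fun t => integral_nonneg fun u => le_max_right _ _) h1 ?_
      simpa using hz.const_mul M.costSim
    refine squeeze_zero_norm (a := fun t => |τ t| * Real.sqrt (C + M.noiseVar)) (fun t => ?_) ?_
    · have h3 : M.crossCov R (F t) x z - M.crossCov R (F t) (x₀ t) z = τ t * Real.sqrt (v t) := by
        have := Real.sqrt_pos.2 (hv0 t)
        simp only [hτ]
        field_simp
      rw [h3, Real.norm_eq_abs, abs_mul, abs_of_nonneg (Real.sqrt_nonneg _)]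
      exact mul_le_mul_of_nonneg_left (hvC t) (abs_nonneg _)
    · simpa using h2.abs.mul_const (Real.sqrt (C + M.noiseVar))
  simpa using (key x).sub (key x')

/-- The variance is the integral of the slope differences over z against the law at x, minus that at
x'. Posterior covariances are bounded uniformly, so dominated convergence applies. -/
theorem tendsto_varIntegralSub [CompactSpace A] (hX : X.Nonempty)
    (hrun : IsRun M astar P ξ θ ε ρ act) (R : SrcData Ns ℛ)
    {F : ℕ → SimData X A} {g : X → ℝ} (hg : ∀ x, Tendsto (fun t => M.G R (F t) x) atTop (𝓝 (g x)))
    (hvoi : ∀ z, Tendsto (fun t => M.voiSim R (F t) z) atTop (𝓝 0)) (x x' : X) :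
    Tendsto (fun t => IsPosterior.varIntegralSub (M.postCov (F t)) (atPoint x (M.posterior R))
      (atPoint x' (M.posterior R))) atTop (𝓝 0) := by
  have := M.isProbabilityMeasure_posterior R
  have hp := fun x : X => isProbabilityMeasure_atPoint x (M.posterior R)
  obtain ⟨C, hC⟩ := M.exists_k0_diag_le
  have hK : ∀ (t : ℕ) (z : X × A) (y : X),
      ∫ z', M.postCov (F t) z z' ∂atPoint y (M.posterior R) = M.crossCov R (F t) y z :=
    fun t z y => by
      have h1 : Measurable fun z' => M.postCov (F t) z z' :=
        ((M.continuous_postCov (F t)).comp (by fun_prop :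
          Continuous fun z' : X × A => (z, z'))).measurable
      rw [integral_atPoint _ _ h1, Setup.crossCov]
      simp only [(hrun.isGP_gpMeasure_path (F t)).symm z]
  have hKm : ∀ (t : ℕ) (y : X), StronglyMeasurable fun z => M.crossCov R (F t) y z := fun t y => by
    simp only [← hK]
    exact (M.continuous_postCov (F t)).stronglyMeasurable.integral_prod_right
  have hKb : ∀ (t : ℕ) (y : X) z, |M.crossCov R (F t) y z| ≤ C := fun t y z => by
    have := norm_integral_le_of_norm_le_const (μ := M.posterior R)
      (f := fun a => M.postCov (F t) (y, a) z) (C := C)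
      (ae_of_all _ fun a => hrun.abs_postCov_le hC (F t) (y, a) z)
    rw [Setup.crossCov]
    simpa using this
  have hlim : ∀ y : X, Tendsto (fun t => ∫ z, (M.crossCov R (F t) x z - M.crossCov R (F t) x' z)
      ∂atPoint y (M.posterior R)) atTop (𝓝 0) := fun y => by
    have := tendsto_integral_of_dominated_convergence (μ := atPoint y (M.posterior R))
      (F := fun t z => M.crossCov R (F t) x z - M.crossCov R (F t) x' z) (f := fun _ => 0)
      (fun _ => C + C) (fun t => ((hKm t x).sub (hKm t x')).aestronglyMeasurable)
      (integrable_const _)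
      (fun t => ae_of_all _ fun z => (abs_sub _ _).trans (add_le_add (hKb t x z) (hKb t x' z)))
      (ae_of_all _ fun z => hrun.tendsto_crossCov_sub hX R hg z (hvoi z) x x')
    simpa using this
  simp only [IsPosterior.varIntegralSub, hK]
  simpa using (hlim x).sub (hlim x')

end IsRun

end ValueOfInformation

/-! ### Stability of the set of maximisers. -/

section Argmax

variable {D : ℕ} {X : Finset (EuclideanSpace ℝ (Fin D))}

theorem argmax_eq_of_sub_eq {f g : X → ℝ} (h : ∀ x x', f x - f x' = g x - g x') :
    argmax f = argmax g := by
  ext x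
  simp only [argmax, Set.mem_ofPred_eq]
  refine forall_congr' fun x' => ?_
  rw [← sub_nonneg, h, sub_nonneg]

/-- Finitely many strict inequalities between the limits eventually hold along the sequence; ties in
the limit may be broken, hence only an inclusion. -/
theorem eventually_argmax_subset {f : ℕ → X → ℝ} {g : X → ℝ}
    (h : ∀ x, Tendsto (fun t => f t x) atTop (𝓝 (g x))) :
    ∀ᶠ t in atTop, argmax (f t) ⊆ argmax g := by
  have h1 : ∀ᶠ t in atTop, ∀ x x' : X, g x < g x' → f t x < f t x' := by
    refine eventually_all.2 fun x => eventually_all.2 fun x' => ?_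
    by_cases hx : g x < g x'
    · filter_upwards [(h x).eventually_lt (h x') hx] with t ht _
      exact ht
    · exact Eventually.of_forall fun t hx' => absurd hx' hx
  filter_upwards [h1] with t ht x hx x'
  by_contra! hc
  exact (ht x x' hc).not_ge (hx x')

end Argmax

/-- The finitely many early deviations are absorbed into the constant. Thus C does not depend on the
counts, and any allocation is covered, including sources queried only finitely often. -/
theorem exists_forall_norm_sum_sub_le {E ι : Type*} [NormedAddCommGroup E] [NormedSpace ℝ E]
    [Fintype ι] {x : ι → ℕ → E} {κ : ι → E}
    (h : ∀ s, Tendsto (fun n : ℕ => (n : ℝ)⁻¹ • ∑ i ∈ Finset.range n, x s i) atTop (𝓝 (κ s)))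
    {η : ℝ} (hη : 0 < η) :
    ∃ C, ∀ N : ι → ℕ, ‖∑ s, (∑ i ∈ Finset.range (N s), x s i - (N s : ℝ) • κ s)‖ ≤
      η * (∑ s, N s : ℕ) + C := by
  have h1 : ∀ s, ∃ C, ∀ n : ℕ,
      ‖∑ i ∈ Finset.range n, x s i - (n : ℝ) • κ s‖ ≤ η * n + C := fun s => by
    obtain ⟨n₀, hn₀⟩ := eventually_atTop.1
      (((tendsto_iff_norm_sub_tendsto_zero.1 (h s)).eventually_le_const hη).and
        (eventually_gt_atTop 0))
    obtain ⟨C, hC⟩ := ((Finset.range n₀).image fun n : ℕ =>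
      ‖∑ i ∈ Finset.range n, x s i - (n : ℝ) • κ s‖).bddAbove
    refine ⟨max C 0, fun n => ?_⟩
    rcases lt_or_ge n n₀ with hn | hn
    · have h2 := hC (Finset.mem_coe.2 (Finset.mem_image_of_mem _ (Finset.mem_range.2 hn)))
      have h3 : 0 ≤ η * n := by positivity
      exact h2.trans ((le_max_left _ _).trans (by linarith))
    · obtain ⟨h2, h3⟩ := hn₀ n hn
      have h4 : (n : ℝ) ≠ 0 := by exact_mod_cast h3.ne'
      have h5 : ∑ i ∈ Finset.range n, x s i - (n : ℝ) • κ s =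
          (n : ℝ) • ((n : ℝ)⁻¹ • ∑ i ∈ Finset.range n, x s i - κ s) := by
        rw [smul_sub, smul_inv_smul₀ h4]
      rw [h5, norm_smul, Real.norm_natCast, mul_comm η]
      have := mul_le_mul_of_nonneg_left h2 n.cast_nonneg (α := ℝ)
      have := le_max_right C 0
      linarith
  choose C hC using h1
  refine ⟨∑ s, C s, fun N => (norm_sum_le _ _).trans ?_⟩
  push_cast
  rw [Finset.mul_sum, ← Finset.sum_add_distrib]
  exact Finset.sum_le_sum fun s _ => hC s (N s)

/-! ### Uniform strong law for the log-likelihood ratios. -/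

section LogLikelihood

variable {D J Ns : ℕ} {X : Finset (EuclideanSpace ℝ (Fin D))}
  {A : Set (EuclideanSpace ℝ (Fin J))} {ℛ : Type*} [MeasurableSpace ℛ]
  {Ω : Type*} {Ξ : Type*} [MeasurableSpace Ξ] {mΩ : MeasurableSpace Ω}
  {ξ : Ω → Ξ} {act : ℕ → Ω → Action X A Ns} {θ : X × A → Ω → ℝ} {ε : ℕ → Ω → ℝ}
  {ρ : Fin Ns → ℕ → Ω → ℛ} {M : Setup X A Ns ℛ} {astar : A} {P : Measure Ω}

/-- The log-likelihood ratio of an observation, as a continuous function of the parameter. -/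
def Setup.logRatio (M : Setup X A Ns ℛ) (a₀ : A) (s : Fin Ns) (r : ℛ) : C(A, ℝ) :=
  ⟨fun a => Real.log (M.dens s a₀ r / M.dens s a r),
    (continuous_const.div (M.dens_continuous s r) fun a => (M.dens_pos s a r).ne').log
      fun a => (div_pos (M.dens_pos s a₀ r) (M.dens_pos s a r)).ne'⟩

theorem Setup.measurable_logRatio [CompactSpace A] (M : Setup X A Ns ℛ) (a₀ : A) (s : Fin Ns) :
    Measurable (M.logRatio a₀ s) :=
  measurable_continuousMap_of_eval fun a =>
    Real.measurable_log.comp ((M.dens_measurable s a₀).div (M.dens_measurable s a))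

theorem Setup.integrable_logRatio [CompactSpace A] (M : Setup X A Ns ℛ) (a₀ : A) (s : Fin Ns)
    {H : ℛ → ℝ} (hH : Integrable H (M.srcLaw s a₀))
    (h : ∀ a r, |Real.log (M.dens s a₀ r / M.dens s a r)| ≤ H r) :
    Integrable (M.logRatio a₀ s) (M.srcLaw s a₀) :=
  hH.mono' (M.measurable_logRatio a₀ s).aestronglyMeasurable (ae_of_all _ fun r =>
    (ContinuousMap.norm_le _ ((abs_nonneg _).trans (h a₀ r))).2 fun a => h a r)

/-- The Kullback-Leibler divergence as a continuous function of the parameter. -/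
def Setup.klMap [CompactSpace A] (M : Setup X A Ns ℛ) (a₀ : A) (s : Fin Ns) : C(A, ℝ) :=
  ∫ r, M.logRatio a₀ s r ∂M.srcLaw s a₀

/-- Evaluation at a point is continuous and linear, so it commutes with the Bochner integral;
continuity of the divergence in the parameter follows. -/
theorem Setup.klMap_apply [CompactSpace A] (M : Setup X A Ns ℛ) (a₀ : A) (s : Fin Ns)
    (h : Integrable (M.logRatio a₀ s) (M.srcLaw s a₀)) (a : A) :
    M.klMap a₀ s a = M.kl a₀ s a :=
  ((ContinuousMap.evalCLM ℝ a).integral_comp_comm h).symm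

theorem Setup.kl_self (M : Setup X A Ns ℛ) (a₀ : A) (s : Fin Ns) : M.kl a₀ s a₀ = 0 := by
  simp [Setup.kl, div_self (M.dens_pos s a₀ _).ne']

/-- Strong law of large numbers for the log-likelihood ratios, uniformly in the parameter. -/
theorem IsRun.ae_tendsto_logRatio [CompactSpace A] (hrun : IsRun M astar P ξ θ ε ρ act)
    (s : Fin Ns) (h : Integrable (M.logRatio astar s) (M.srcLaw s astar)) :
    ∀ᵐ ω ∂P, Tendsto (fun n : ℕ => (n : ℝ)⁻¹ • ∑ i ∈ Finset.range n,
      M.logRatio astar s (ρ s i ω)) atTop (𝓝 (M.klMap astar s)) := by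
  have hm := M.measurable_logRatio astar s
  have hid : ∀ k, IdentDistrib (ρ s k) (ρ s 0) P P := fun k =>
    ⟨(hrun.src_measurable s k).aemeasurable, (hrun.src_measurable s 0).aemeasurable, by
      rw [hrun.src_law, hrun.src_law]⟩
  have h0 : Integrable (fun ω => M.logRatio astar s (ρ s 0 ω)) P := by
    rw [← hrun.src_law s 0] at h
    exact h.comp_measurable (hrun.src_measurable s 0)
  -- The strong law is applied to variables with values in C(A, ℝ); the sup norm makes the
  -- convergence uniform in the parameter.
  have h1 := strong_law_ae (μ := P) (fun k ω => M.logRatio astar s (ρ s k ω)) h0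
    (fun i j hij => (hrun.src_indep.indepFun (i := (s, i)) (j := (s, j))
      (by simpa using hij)).comp hm hm) fun k => (hid k).comp hm
  have h2 : ∫ ω, M.logRatio astar s (ρ s 0 ω) ∂P = M.klMap astar s := by
    rw [Setup.klMap, ← hrun.src_law s 0, integral_map (hrun.src_measurable s 0).aemeasurable
      hm.aestronglyMeasurable]
  rwa [h2] at h1

omit [MeasurableSpace ℛ] in
theorem sum_map_srcList {E : Type*} [AddCommGroup E] (f : Fin Ns → ℛ → E) (l : List (Fin Ns))
    (ω : Ω) : ((srcList ρ l ω).map fun d => f d.1 d.2).sum =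
      ∑ s, ∑ i ∈ Finset.range (l.countP fun s' => s' = s), f s (ρ s i ω) := by
  induction l with
  | nil => simp [srcList]
  | cons s l ih =>
    rw [srcList, List.map_cons, List.sum_cons, ih, ← Finset.add_sum_erase _ _ (Finset.mem_univ s),
      ← Finset.add_sum_erase _ _ (Finset.mem_univ s), ← add_assoc]
    congr 1
    · rw [List.countP_cons_of_pos (by simp), Finset.sum_range_succ, add_comm]
    · refine Finset.sum_congr rfl fun s' hs' => ?_
      rw [List.countP_cons_of_neg (by simpa using (Finset.ne_of_mem_erase hs').symm)]

omit [MeasurableSpace ℛ] in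
theorem length_srcList (l : List (Fin Ns)) (ω : Ω) :
    (srcList ρ l ω).length = ∑ s, l.countP fun s' => s' = s := by
  have := sum_map_srcList (ρ := ρ) (fun _ _ => (1 : ℤ)) l ω
  simp only [List.map_const', List.sum_replicate, Finset.sum_const, Finset.card_range,
    nsmul_one] at this
  exact_mod_cast this

/-- The log-likelihood ratio of the source data. -/
def Setup.logLik (M : Setup X A Ns ℛ) (a₀ : A) (R : SrcData Ns ℛ) : C(A, ℝ) :=
  (R.map fun d => M.logRatio a₀ d.1 d.2).sum

theorem Setup.likelihood_eq (M : Setup X A Ns ℛ) (a₀ : A) (R : SrcData Ns ℛ) (a : A) :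
    M.likelihood R a = M.likelihood R a₀ * Real.exp (-M.logLik a₀ R a) := by
  induction R with
  | nil => simp [Setup.likelihood, Setup.logLik]
  | cons d R ih =>
    have h1 : M.logLik a₀ (d :: R) a = M.logRatio a₀ d.1 d.2 a + M.logLik a₀ R a := by
      simp [Setup.logLik]
    have h2 : Real.exp (-M.logRatio a₀ d.1 d.2 a) = M.dens d.1 a d.2 / M.dens d.1 a₀ d.2 := by
      rw [Real.exp_neg]
      change (Real.exp (Real.log _))⁻¹ = _
      rw [Real.exp_log (div_pos (M.dens_pos _ _ _) (M.dens_pos _ _ _)), inv_div]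
    have h3 := (M.dens_pos d.1 a₀ d.2).ne'
    rw [M.likelihood_cons, M.likelihood_cons, h1, neg_add, Real.exp_add, h2, ih]
    field_simp

/-- The log-likelihood ratio of the source data grows like the accumulated Kullback-Leibler
divergence, uniformly in the parameter. -/
theorem exists_forall_abs_logLik_sub_le [CompactSpace A] {ω : Ω}
    (hint : ∀ s, Integrable (M.logRatio astar s) (M.srcLaw s astar))
    (h : ∀ s, Tendsto (fun n : ℕ => (n : ℝ)⁻¹ • ∑ i ∈ Finset.range n,
      M.logRatio astar s (ρ s i ω)) atTop (𝓝 (M.klMap astar s))) {η : ℝ} (hη : 0 < η) :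
    ∃ C, ∀ (t : ℕ) (a : A), |M.logLik astar (srcData act ρ t ω) a -
      ((srcData act ρ t ω).map fun d => M.kl astar d.1 a).sum| ≤
        η * (srcData act ρ t ω).length + C := by
  obtain ⟨C, hC⟩ := exists_forall_norm_sum_sub_le h hη
  refine ⟨C, fun t a => ?_⟩
  rw [srcData_eq_srcList, length_srcList, Setup.logLik, sum_map_srcList,
    sum_map_srcList fun s _ => M.kl astar s a]
  -- The counts are random and chosen adaptively, which is harmless because the bound holds for all
  -- counts at once.
  refine le_trans ?_ (hC fun s => ((srcData act ρ t ω).map Prod.fst).countP fun s' => s' = s)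
  refine le_trans (le_of_eq ?_) (ContinuousMap.norm_coe_le_norm _ a)
  rw [Real.norm_eq_abs]
  congr 1
  simp only [Finset.sum_sub_distrib, ContinuousMap.sub_apply, ContinuousMap.coe_sum,
    Finset.sum_apply, ContinuousMap.coe_smul, Pi.smul_apply, M.klMap_apply astar _ (hint _),
    Finset.sum_const, Finset.card_range, nsmul_eq_mul, smul_eq_mul]

end LogLikelihood

/-! ### Concentration of the posterior at the true parameter. -/

section Consistency

variable {D J Ns : ℕ} {X : Finset (EuclideanSpace ℝ (Fin D))}
  {A : Set (EuclideanSpace ℝ (Fin J))} {ℛ : Type*} [MeasurableSpace ℛ] {M : Setup X A Ns ℛ}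
  {a₀ : A} {R : ℕ → SrcData Ns ℛ}

theorem exists_nhds_abs_sum_kl_sub_le (hkl : ∀ s, Continuous (M.kl a₀ s)) (a : A) {δ : ℝ}
    (hδ : 0 < δ) : ∀ᶠ a' in 𝓝 a, ∀ R : SrcData Ns ℛ,
      |(R.map fun d => M.kl a₀ d.1 a').sum - (R.map fun d => M.kl a₀ d.1 a).sum| ≤
        δ * R.length := by
  have h1 : ∀ᶠ a' in 𝓝 a, ∀ s, |M.kl a₀ s a' - M.kl a₀ s a| < δ :=
    eventually_all.2 fun s => Metric.continuousAt_iff'.1 (hkl s).continuousAt δ hδ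
  filter_upwards [h1] with a' ha' R
  induction R with
  | nil => simp
  | cons d R ih =>
    simp only [List.map_cons, List.sum_cons, List.length_cons]
    push_cast
    have := (ha' d.1).le
    rw [abs_le] at *
    constructor <;> linarith

/-- Near each a the rate drops by at most half, by continuity of the divergences of the finitely
many sources; a finite cover then gives a common positive rate. -/
theorem exists_forall_le_sum_kl (hkl : ∀ s, Continuous (M.kl a₀ s)) (hid : Identifies M a₀ R)
    {K : Set A} (hK : IsCompact K) (ha₀ : a₀ ∉ K) :
    ∃ c > 0, ∀ᶠ t in atTop, ∀ a ∈ K, c * ((R t).length : ℝ) ≤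
      ((R t).map fun d => M.kl a₀ d.1 a).sum := by
  refine hK.induction_on (p := fun S => ∃ c > 0, ∀ᶠ t in atTop, ∀ a ∈ S, c * ((R t).length : ℝ) ≤
      ((R t).map fun d => M.kl a₀ d.1 a).sum) ⟨1, one_pos, by simp⟩ ?_ ?_ ?_
  · rintro S S' hS ⟨c, hc, h⟩
    exact ⟨c, hc, h.mono fun t ht a ha => ht a (hS ha)⟩
  · rintro S S' ⟨c, hc, h⟩ ⟨c', hc', h'⟩
    refine ⟨min c c', lt_min hc hc', ?_⟩
    filter_upwards [h, h'] with t ht ht' a ha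
    rcases ha with ha | ha
    · exact (mul_le_mul_of_nonneg_right (min_le_left _ _) (Nat.cast_nonneg _)).trans (ht a ha)
    · exact (mul_le_mul_of_nonneg_right (min_le_right _ _) (Nat.cast_nonneg _)).trans (ht' a ha)
  · intro a ha
    obtain ⟨c, hc, h⟩ := hid a fun h => ha₀ (h ▸ ha)
    refine ⟨_, mem_nhdsWithin_of_mem_nhds (exists_nhds_abs_sum_kl_sub_le hkl a (half_pos hc)),
      c / 2, half_pos hc, ?_⟩
    filter_upwards [h] with t ht a' ha'
    have := (abs_le.1 (ha' (R t))).1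
    linarith

/-- The numerator is bounded above on K, the normalising constant below by its part on V, and the
likelihood at `a₀` cancels. -/
theorem posterior_le [CompactSpace A] (a₀ : A) (R : SrcData Ns ℛ) {V K : Set A} {β γ : ℝ}
    (hV : MeasurableSet V) (hK : MeasurableSet K) (hV0 : M.prior V ≠ 0)
    (hβ : ∀ a ∈ V, M.logLik a₀ R a ≤ β) (hγ : ∀ a ∈ K, γ ≤ M.logLik a₀ R a) :
    M.posterior R K ≤ (M.prior V)⁻¹ * ENNReal.ofReal (Real.exp (β - γ)) := by
  have := M.prior_prob
  have hl := M.likelihood_pos R a₀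
  have h1 : ∫⁻ a in K, ENNReal.ofReal (M.likelihood R a) ∂M.prior ≤
      ENNReal.ofReal (M.likelihood R a₀ * Real.exp (-γ)) := by
    refine (setLIntegral_mono' hK (g := fun _ => ENNReal.ofReal
      (M.likelihood R a₀ * Real.exp (-γ))) fun a ha => ?_).trans ?_
    · rw [M.likelihood_eq a₀ R a]
      exact ENNReal.ofReal_le_ofReal (mul_le_mul_of_nonneg_left
        (Real.exp_le_exp.2 (neg_le_neg (hγ a ha))) hl.le)
    · rw [setLIntegral_const]
      exact mul_le_of_le_one_right' prob_le_one
  have h2 : ENNReal.ofReal (M.likelihood R a₀ * Real.exp (-β)) * M.prior V ≤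
      ∫⁻ a, ENNReal.ofReal (M.likelihood R a) ∂M.prior := by
    rw [← setLIntegral_const]
    refine (setLIntegral_mono' hV fun a ha => ?_).trans (setLIntegral_le_lintegral _ _)
    rw [M.likelihood_eq a₀ R a]
    exact ENNReal.ofReal_le_ofReal (mul_le_mul_of_nonneg_left
      (Real.exp_le_exp.2 (neg_le_neg (hβ a ha))) hl.le)
  rw [M.posterior_apply R hK, ENNReal.inv_mul_le_iff (M.lintegral_likelihood_ne_zero R)
    (M.lintegral_likelihood_ne_top R)]
  refine h1.trans (le_trans (le_of_eq ?_) (mul_le_mul_left h2 _))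
  rw [mul_assoc, ← mul_assoc (M.prior V), ENNReal.mul_inv_cancel hV0 (measure_ne_top _ _), one_mul,
    ← ENNReal.ofReal_mul (by positivity), mul_assoc, ← Real.exp_add]
  congr 3
  ring

/-- Consistency of the posterior. -/
theorem tendsto_posterior [CompactSpace A] (hkl : ∀ s, Continuous (M.kl a₀ s))
    (hprior : ∀ U ∈ 𝓝 a₀, 0 < M.prior U) (hR : Tendsto (fun t => (R t).length) atTop atTop)
    (hid : Identifies M a₀ R)
    (hlog : ∀ η > 0, ∃ C, ∀ (t : ℕ) (a : A), |M.logLik a₀ (R t) a -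
      ((R t).map fun d => M.kl a₀ d.1 a).sum| ≤ η * (R t).length + C)
    {U : Set A} (hU : U ∈ 𝓝 a₀) : Tendsto (fun t => M.posterior (R t) U) atTop (𝓝 1) := by
  obtain ⟨O, hOU, hO, haO⟩ := mem_nhds_iff.1 hU
  have hp := fun t => M.isProbabilityMeasure_posterior (R t)
  obtain ⟨c, hc, hc'⟩ := exists_forall_le_sum_kl hkl hid hO.isClosed_compl.isCompact
    fun h => h haO
  -- With slack c/4 on V and sampling error c/8 on both sides, a rate c − c/4 − c/8 − c/8 = c/2 per
  -- query remains in the exponent.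
  obtain ⟨V, hVsub, hV, haV⟩ := eventually_nhds_iff.1
    (exists_nhds_abs_sum_kl_sub_le hkl a₀ (δ := c / 4) (by positivity))
  obtain ⟨C, hC⟩ := hlog (c / 8) (by positivity)
  have hV0 := (hprior V (hV.mem_nhds haV)).ne'
  have h1 : ∀ᶠ t in atTop, M.posterior (R t) Oᶜ ≤ (M.prior V)⁻¹ *
      ENNReal.ofReal (Real.exp (2 * C - c / 2 * (R t).length)) := by
    filter_upwards [hc'] with t ht
    have h2 : ∀ a ∈ V, M.logLik a₀ (R t) a ≤ c / 4 * (R t).length + (c / 8 * (R t).length + C) :=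
      fun a ha => by
        have h3 := (abs_le.1 (hVsub a ha (R t))).2
        have h4 := (abs_le.1 (hC t a)).2
        simp only [M.kl_self, List.map_const', List.sum_replicate, smul_zero, sub_zero] at h3
        linarith
    have h5 : ∀ a ∈ Oᶜ, c * (R t).length - (c / 8 * (R t).length + C) ≤ M.logLik a₀ (R t) a :=
      fun a ha => by
        have h3 := ht a ha
        have h4 := (abs_le.1 (hC t a)).1
        linarith
    refine (posterior_le a₀ (R t) hV.measurableSet hO.measurableSet.compl hV0 h2 h5).trans
      (le_of_eq ?_)
    congr 3
    ring
  have h2 : Tendsto (fun t => (M.prior V)⁻¹ *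
      ENNReal.ofReal (Real.exp (2 * C - c / 2 * (R t).length))) atTop (𝓝 0) := by
    have h3 : Tendsto (fun t => ((R t).length : ℝ)) atTop atTop :=
      tendsto_natCast_atTop_atTop.comp hR
    have h4 : Tendsto (fun t => 2 * C - c / 2 * ((R t).length : ℝ)) atTop atBot :=
      tendsto_const_nhds.add_atBot (tendsto_neg_atTop_atBot.comp
        (h3.const_mul_atTop (half_pos hc)))
    have h5 := ENNReal.Tendsto.const_mul (a := (M.prior V)⁻¹)
      (ENNReal.tendsto_ofReal (Real.tendsto_exp_atBot.comp h4))
      (Or.inr (ENNReal.inv_ne_top.2 hV0))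
    simpa using h5
  have h3 : Tendsto (fun t => M.posterior (R t) Oᶜ) atTop (𝓝 0) :=
    tendsto_of_tendsto_of_tendsto_of_le_of_le' tendsto_const_nhds h2
      (Eventually.of_forall fun _ => zero_le) h1
  have h4 : Tendsto (fun t => 1 - M.posterior (R t) Oᶜ) atTop (𝓝 1) := by
    have := ENNReal.Tendsto.sub (tendsto_const_nhds (x := (1 : ℝ≥0∞)) (f := atTop)) h3
      (Or.inl ENNReal.one_ne_top)
    simpa using this
  refine tendsto_of_tendsto_of_tendsto_of_le_of_le h4 tendsto_const_nhds (fun t => ?_)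
    fun t => prob_le_one
  simp only
  rw [← prob_compl_eq_one_sub hO.measurableSet.compl, compl_compl]
  exact measure_mono hOU

/-- On a small neighbourhood f is close to its value at y; off it the error is at most twice the sup
norm times a vanishing mass. -/
theorem tendsto_integral_of_tendsto_nhds {Y : Type*} [TopologicalSpace Y] [CompactSpace Y]
    [MeasurableSpace Y] [OpensMeasurableSpace Y] {π : ℕ → Measure Y}
    [∀ t, IsProbabilityMeasure (π t)] {y : Y}
    (h : ∀ U ∈ 𝓝 y, Tendsto (fun t => π t U) atTop (𝓝 1)) {f : Y → ℝ} (hf : Continuous f) :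
    Tendsto (fun t => ∫ a, f a ∂π t) atTop (𝓝 (f y)) := by
  obtain ⟨B, hB⟩ := isCompact_univ.exists_bound_of_continuousOn hf.continuousOn
  have hi : ∀ t, Integrable f (π t) := fun t =>
    Integrable.of_bound hf.measurable.aestronglyMeasurable B (ae_of_all _ fun a => hB a trivial)
  rw [Metric.tendsto_atTop']
  intro η hη
  set U : Set Y := {a | |f a - f y| < η / 2} with hU
  have hUo : IsOpen U := isOpen_lt (hf.sub continuous_const).abs continuous_const
  have hUy : U ∈ 𝓝 y := hUo.mem_nhds (by simpa [hU] using half_pos hη)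
  have h1 : Tendsto (fun t => η / 2 + 2 * B * (π t).real Uᶜ) atTop (𝓝 (η / 2)) := by
    have h2 : Tendsto (fun t => (π t).real U) atTop (𝓝 1) :=
      (ENNReal.tendsto_toReal ENNReal.one_ne_top).comp (h U hUy)
    have h3 := ((tendsto_const_nhds (x := (1 : ℝ))).sub h2).const_mul (2 * B) |>.const_add (η / 2)
    have h4 : ∀ t, (π t).real Uᶜ = 1 - (π t).real U := fun t =>
      probReal_compl_eq_one_sub hUo.measurableSet
    simpa [h4] using h3
  obtain ⟨N, hN⟩ := eventually_atTop.1 (h1.eventually_lt_const (half_lt_self hη))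
  refine ⟨N, fun t ht => lt_of_le_of_lt ?_ (hN t ht.le)⟩
  have h4 : ∫ a, f a ∂π t - f y = ∫ a, (f a - f y) ∂π t := by
    rw [integral_sub (hi t) (integrable_const _)]
    simp
  have h5 : ∫ a, (η / 2 + Uᶜ.indicator (fun _ => 2 * B) a) ∂π t =
      η / 2 + 2 * B * (π t).real Uᶜ := by
    rw [integral_add (integrable_const _)
      ((integrable_const _).indicator hUo.measurableSet.compl),
      integral_indicator_const _ hUo.measurableSet.compl]
    simp [mul_comm]
  rw [dist_eq_norm, h4, ← h5]
  have h8 : Integrable (fun a => η / 2 + Uᶜ.indicator (fun _ => 2 * B) a) (π t) :=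
    (integrable_const _).add ((integrable_const _).indicator hUo.measurableSet.compl)
  refine norm_integral_le_of_norm_le h8 (ae_of_all _ fun a => ?_)
  rw [Real.norm_eq_abs]
  by_cases ha : a ∈ U
  · have : |f a - f y| < η / 2 := ha
    simpa [ha] using this.le
  · rw [Set.indicator_of_mem (show a ∈ Uᶜ from ha)]
    have h6 := hB a trivial
    have h7 := hB y trivial
    rw [Real.norm_eq_abs] at h6 h7
    have := abs_sub (f a) (f y)
    linarith

end Consistency

end BICO

end

theorem mainTheorem2 {D J Ns : ℕ} {X : Finset (EuclideanSpace ℝ (Fin D))} (hX : X.Nonempty)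
    {A : Set (EuclideanSpace ℝ (Fin J))} (hA : IsCompact A)
    {ℛ : Type*} [MeasurableSpace ℛ] (M : BICO.Setup X A Ns ℛ)
    -- the true parameter
    (astar : A)
    {Ω : Type*} [MeasurableSpace Ω] (P : Measure Ω) [IsProbabilityMeasure P]
    {Ξ : Type*} [MeasurableSpace Ξ] (ξ : Ω → Ξ)
    (θ : X × A → Ω → ℝ) (ε : ℕ → Ω → ℝ) (ρ : Fin Ns → ℕ → Ω → ℛ)
    (act : ℕ → Ω → BICO.Action X A Ns) (hrun : BICO.IsRun M astar P ξ θ ε ρ act) :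
    ∀ᵐ ω ∂P,
      let R : ℕ → BICO.SrcData Ns ℛ := fun t => BICO.srcData act ρ t ω
      let F : ℕ → BICO.SimData X A := fun t => BICO.simData act θ ε t ω
      -- `Ginf T x` is `G(x; R^m, F^∞)` for the source data `R^m = R T`
      ∃ Ginf : ℕ → X → ℝ,
        (∀ T x, Tendsto (fun t => M.G (R T) (F t) x) atTop (𝓝 (Ginf T x))) ∧
        -- the limiting recommended solution
        (∀ T, (∀ z, Tendsto (fun t => M.voiSim (R T) (F t) z) atTop (𝓝 0)) →
          BICO.argmax (Ginf T) =
            BICO.argmax fun x => ∫ a, θ (x, a) ω ∂M.posterior (R T)) ∧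
        -- identification of the true parameter, and thereby of the true best solution
        -- (every neighbourhood of the true parameter has nonzero prior probability)
        ((∀ U ∈ 𝓝 astar, 0 < M.prior U) →
          -- the log-likelihood ratios have an integrable envelope
          (∀ s, ∃ H : ℛ → ℝ, Integrable H (M.srcLaw s astar) ∧
            ∀ a r, |Real.log (M.dens s astar r / M.dens s a r)| ≤ H r) →
          Tendsto (fun t => (R t).length) atTop atTop → BICO.Identifies M astar R →
          -- the value of every data source tends to zero
          (∃ τ : ℕ → ℕ, ∀ s, Tendsto (fun t => M.voiSrc (R t) (F (τ t)) s) atTop (𝓝 0)) →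
          (∀ U ∈ 𝓝 astar, Tendsto (fun t => M.posterior (R t) U) atTop (𝓝 1)) ∧
          ((∀ T z, Tendsto (fun t => M.voiSim (R T) (F t) z) atTop (𝓝 0)) →
            ∀ᶠ T in atTop, BICO.argmax (Ginf T) ⊆
              BICO.argmax fun x => θ (x, astar) ω)) := by
  have : CompactSpace A := isCompact_iff_compactSpace.1 hA
  have hsrc : ∀ᵐ ω ∂P, (∀ s, ∃ H : ℛ → ℝ, Integrable H (M.srcLaw s astar) ∧
      ∀ a r, |Real.log (M.dens s astar r / M.dens s a r)| ≤ H r) →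
        ∀ s, Tendsto (fun n : ℕ => (n : ℝ)⁻¹ • ∑ i ∈ Finset.range n,
          M.logRatio astar s (ρ s i ω)) atTop (𝓝 (M.klMap astar s)) := by
    -- The envelope condition does not involve ω, so it can be decided before the exceptional null
    -- set is chosen.
    by_cases h : ∀ s, ∃ H : ℛ → ℝ, Integrable H (M.srcLaw s astar) ∧
      ∀ a r, |Real.log (M.dens s astar r / M.dens s a r)| ≤ H r
    · choose H hH hHle using h
      filter_upwards [ae_all_iff.2 fun s =>
        hrun.ae_tendsto_logRatio s (M.integrable_logRatio astar s (hH s) (hHle s))] with ω hω _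
      exact hω
    · exact ae_of_all _ fun ω h' => absurd h' h
  filter_upwards [hrun.ae_tendsto_G, hsrc] with ω hG hsrc
  intro R F
  choose Ginf hGinf using fun T => (hG T).1
  have hargmax : ∀ T, (∀ z, Tendsto (fun t => M.voiSim (R T) (F t) z) atTop (𝓝 0)) →
      BICO.argmax (Ginf T) = BICO.argmax fun x => ∫ a, θ (x, a) ω ∂M.posterior (R T) :=
    -- Both limits of the differences of G coincide, and a common offset does not affect the
    -- maximisers.
    fun T hT => BICO.argmax_eq_of_sub_eq fun x x' => tendsto_nhds_unique
      ((hGinf T x).sub (hGinf T x'))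
      ((hG T).2 x x' (hrun.tendsto_varIntegralSub hX (R T) (hGinf T) hT x x'))
  refine ⟨Ginf, hGinf, hargmax, fun hprior henv hlen hid _ => ?_⟩
  have hint : ∀ s, Integrable (M.logRatio astar s) (M.srcLaw s astar) := fun s => by
    obtain ⟨H, hH, hHle⟩ := henv s
    exact M.integrable_logRatio astar s hH hHle
  have hkl : ∀ s, Continuous (M.kl astar s) := fun s => by
    have h1 : ⇑(M.klMap astar s) = M.kl astar s := funext (M.klMap_apply astar s (hint s))
    rw [← h1]
    exact (M.klMap astar s).continuous
  have hpost : ∀ U ∈ 𝓝 astar, Tendsto (fun t => M.posterior (R t) U) atTop (𝓝 1) := fun U hU =>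
    BICO.tendsto_posterior hkl hprior hlen hid
      (fun η hη => BICO.exists_forall_abs_logLik_sub_le hint (hsrc henv) hη) hU
  refine ⟨hpost, fun hvoi => ?_⟩
  have := fun t => M.isProbabilityMeasure_posterior (R t)
  have hlim : ∀ x, Tendsto (fun T => ∫ a, θ (x, a) ω ∂M.posterior (R T)) atTop
      (𝓝 (θ (x, astar) ω)) := fun x =>
    BICO.tendsto_integral_of_tendsto_nhds hpost (f := fun a => θ (x, a) ω)
      ((hrun.theta_continuous ω).comp (by fun_prop))
  filter_upwards [BICO.eventually_argmax_subset hlim] with T hT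
  rw [hargmax T (hvoi T)]
  exact hT
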